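/- **Setting.** Let $d\ge 0$, $N\ge1$. For finite $X\subset\mathbb Z^d$ let $\mathcal A_X$ be the algebra of operators on $\bigotimes_{x\in X}\mathbb C^N$, with operator norm $\|\cdot\|$ and normalized trace $\operatorname{tr}$ (so $\operatorname{tr} 1=1$). For $X\subset\Lambda$ identify $A\in\mathcal A_X$ with $A\otimes 1\in\mathcal A_\Lambda$. An interaction is a family $\Phi=(\Phi_X)$ with $\Phi_X\in\mathcal A_X$ for every finite $X\subset\mathbb Z^d$; put $$\|\Phi\|_r=\sup_{x\in\mathbb Z^d}\sum_{X\ni x}\|\Phi_X\|\,r^{|X|}\in[0,\infty],\qquad H_\Lambda=\sum_{X\subset\Lambda}\Phi_X,\qquad Z_\Lambda(\beta)=\operatorname{tr} e^{-\beta H_\Lambda}.$$ For finite $\Lambda\subset\mathbb Z^d$ let $\mathcal C_\Lambda$ be the set of clusters in $\Lambda$: sequences $C=(X_1,\dots,X_n)$, $n\ge1$, of subsets of $\Lambda$ such that the graph on $\{1,\dots,n\}$ with edges $\{i,j\}$, $i\ne j$, $X_i\cap X_j\neq\emptyset$, is connected. Put $\operatorname{supp}C=\bigcup_iX_i$ and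 $$w(C)=\frac{(-\beta)^n}{n!}\operatorname{tr}\,\Phi_{X_1}\cdots\Phi_{X_n},\qquad \varphi(C_1,\dots,C_k)=\sum_{g}\ \prod_{\{i,j\}\in g}\bigl(-1_{\operatorname{supp}C_i\cap\operatorname{supp}C_j\ne\emptyset}\bigr),$$ where $g$ runs over the connected graphs with vertices $1,\dots,k$ (so $\varphi(C_1)=1$). **Theorem 3.1.** Let $a>0$. (1) Let $\beta\in\mathbb C$ satisfy $|\beta|\,\|\Phi\|_{e^a(1+a)}\le a$ (with $0\cdot\infty=0$); this includes all real inverse temperatures $\beta\ge0$ with $\beta\|\Phi\|_{e^a(1+a)}\le a$. Then for every finite $\Lambda\subset\mathbb Z^d$ $$Z_\Lambda(\beta)=\exp\Bigl\{\sum_{k\ge1}\frac1{k!}\sum_{C_1,\dots,C_k\in\mathcal C_\Lambda}\varphi(C_1,\dots,C_k)\prod_{i=1}^kw(C_i)\Bigr\},$$ the sum over $k$ and $C_1,\dots,C_k$ being absolutely convergent, and for every $C_1\in\mathcal C_\Lambda$ $$1+\sum_{k\ge2}\frac{k}{k!}\sum_{C_2,\dots,C_k\in\mathcal C_\Lambda}\bigl|\varphi(C_1,\dots,C_k)\bigr|\prod_{i=2}^k|w(C_i)|\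 \le\ e^{a|\operatorname{supp}C_1|}.$$ (2) Let $D=\{\beta\in\mathbb C:|\beta|\,\|\Phi\|_{e^a(1+a)}<a\}$. For every finite nonempty $\Lambda\subset\mathbb Z^d$ there is a function $f_\Lambda$ (the free energy $-\frac1{|\Lambda|}\log Z_\Lambda$), analytic at every point of $D$, with $f_\Lambda(0)=0$ and $Z_\Lambda(\beta)=e^{-|\Lambda|f_\Lambda(\beta)}$ for all $\beta\in D$. These functions have the following property. If $(\Lambda_m)$ is a sequence of finite sets increasing to $\mathbb Z^d$ (every finite set is contained in $\Lambda_m$ for all large $m$) and $f_{\Lambda_m}(t)\to g(t)$ for every real $t\ge0$ in $D$, then there is a function $G$, analytic at every point of $D$, with $G(t)=g(t)$ for all real $t\ge0$ in $D$. -/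

import Mathlib

open scoped ENNReal Nat
open Filter Topology

namespace QLattice

/-- The sites of the simple cubic lattice of dimension `d`. -/
abbrev Site (d : ℕ) : Type := Fin d → ℤ

/-- Spin configurations on `X`. They label the product basis of the Hilbert space of `X`,
the tensor product over the sites `x ∈ X` of copies of `ℂ ^ N`. -/
abbrev Config {d : ℕ} (N : ℕ) (X : Finset (Site d)) : Type := X → Fin N

/-- The algebra of all operators on the Hilbert space of `X`, i.e. the tensor product over `x ∈ X`
of copies of the algebra of `N × N` matrices, written in the product basis. -/
abbrev LocalAlg {d : ℕ} (N : ℕ) (X : Finset (Site d)) : Type :=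
  Matrix (Config N X) (Config N X) ℂ

/-- The operator norm (with respect to the Hilbert space norm), in `[0, ∞]`. -/
noncomputable def opNorm {d N : ℕ} {X : Finset (Site d)} (A : LocalAlg N X) : ℝ≥0∞ :=
  ‖Matrix.toEuclideanCLM (n := Config N X) (𝕜 := ℂ) A‖ₑ

/-- The normalized trace. -/
noncomputable def ntr {d N : ℕ} {X : Finset (Site d)} (A : LocalAlg N X) : ℂ :=
  A.trace / (Fintype.card (Config N X) : ℂ)

/-- For `X ⊆ Λ`, the identification of `A` in the algebra of `X` with `A ⊗ 1` in the algebra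
of `Λ`, where `1` is the identity on the sites of `Λ` outside `X`. -/
def embed {d N : ℕ} {X Λ : Finset (Site d)} (h : X ⊆ Λ) (A : LocalAlg N X) : LocalAlg N Λ :=
  Matrix.of fun σ τ =>
    if ∀ x : Λ, x.1 ∉ X → σ x = τ x then
      A (fun x => σ ⟨x.1, h x.2⟩) (fun x => τ ⟨x.1, h x.2⟩)
    else 0

/-- An interaction: an operator in the algebra of `X`, for every finite set of sites `X`. -/
abbrev Interaction (d N : ℕ) : Type := (X : Finset (Site d)) → LocalAlg N X

/-- The norm `sup_x ∑_{X ∋ x} ‖Φ_X‖ r ^ |X|` of an interaction, possibly infinite. -/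
noncomputable def interactionNorm {d N : ℕ} (Φ : Interaction d N) (r : ℝ) : ℝ≥0∞ :=
  ⨆ x : Site d, ∑' X : {X : Finset (Site d) // x ∈ X},
    opNorm (Φ X.1) * ENNReal.ofReal r ^ X.1.card

/-- The interaction term of `X ⊆ Λ` as an operator on the Hilbert space of `Λ`. -/
def term {d N : ℕ} (Φ : Interaction d N) {Λ : Finset (Site d)} (X : Λ.powerset) : LocalAlg N Λ :=
  embed (Finset.mem_powerset.1 X.2) (Φ X.1)

/-- The Hamiltonian `H_Λ = ∑_{X ⊆ Λ} Φ_X`. -/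
def hamiltonian {d N : ℕ} (Φ : Interaction d N) (Λ : Finset (Site d)) : LocalAlg N Λ :=
  ∑ X : Λ.powerset, term Φ X

/-- The partition function `Z_Λ = tr exp (-β H_Λ)`, with the normalized trace. -/
noncomputable def partitionFunction {d N : ℕ} (Φ : Interaction d N) (Λ : Finset (Site d))
    (β : ℂ) : ℂ :=
  ntr (NormedSpace.exp (-β • hamiltonian Φ Λ))

/-- The graph on the positions of a sequence `(X_1, …, X_n)` of finite sets: two distinct positions
are joined if the corresponding sets intersect. -/
def overlapGraph {d n : ℕ} (X : Fin n → Finset (Site d)) : SimpleGraph (Fin n) where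
  Adj i j := i ≠ j ∧ (X i ∩ X j).Nonempty
  symm := ⟨fun i j h => ⟨h.1.symm, by rw [Finset.inter_comm]; exact h.2⟩⟩
  loopless := ⟨fun _ h => h.1 rfl⟩

/-- Clusters in `Λ`: finite sequences `(X_1, …, X_n)` of subsets of `Λ` whose overlap graph is
connected. Since a connected graph has a vertex, `n ≥ 1`. -/
structure Cluster {d : ℕ} (Λ : Finset (Site d)) where
  /-- The number of sets in the sequence. -/
  n : ℕ
  /-- The sets of the sequence. -/
  X : Fin n → Λ.powerset
  connected : (overlapGraph fun i => (X i).1).Connected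

/-- The support of a cluster: the union of its sets. -/
def Cluster.supp {d : ℕ} {Λ : Finset (Site d)} (C : Cluster Λ) : Finset (Site d) :=
  Finset.univ.biUnion fun i => (C.X i).1

/-- The weight `w(C) = (-β) ^ n / n! * tr (Φ_{X_1} ⋯ Φ_{X_n})` of `C = (X_1, …, X_n)`. -/
noncomputable def weight {d N : ℕ} (Φ : Interaction d N) (β : ℂ) {Λ : Finset (Site d)}
    (C : Cluster Λ) : ℂ :=
  (-β) ^ C.n / (C.n ! : ℂ) * ntr (List.ofFn fun i => term Φ (C.X i)).prod

open scoped Classical in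
/-- The combinatorial function `φ(C_1, …, C_k)`: the sum over all connected graphs `g` with vertices
`1, …, k` of the product over the edges `{i, j}` of `g` of `-1` or `0`, according to whether the
supports of `C_i` and `C_j` intersect or not. For `k = 1` this is the empty product `1`. -/
noncomputable def phi {d : ℕ} {Λ : Finset (Site d)} {k : ℕ} (C : Fin k → Cluster Λ) : ℤ :=
  ∑ g : SimpleGraph (Fin k) with g.Connected,
    ∏ e : Fin k × Fin k with e.1 < e.2 ∧ g.Adj e.1 e.2,
      if ((C e.1).supp ∩ (C e.2).supp).Nonempty then -1 else 0

/-- The term of `(C_1, …, C_k)` in the cluster expansion, without the factor `1 / k!`. -/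
noncomputable def clusterTerm {d N : ℕ} (Φ : Interaction d N) (β : ℂ) {Λ : Finset (Site d)}
    {k : ℕ} (C : Fin k → Cluster Λ) : ℂ :=
  (phi C : ℂ) * ∏ i, weight Φ β (C i)

/-- The disc of complex `β` with `|β| ‖Φ‖_r < a`, where `r = e ^ a (1 + a)`. -/
def highTempDisc {d N : ℕ} (Φ : Interaction d N) (a : ℝ) : Set ℂ :=
  {β | ‖β‖ₑ * interactionNorm Φ (Real.exp a * (1 + a)) < ENNReal.ofReal a}

end QLattice

/-! Expanding the exponential gives $Z_A=\sum_n\frac1{n!}\sum_{X_1,\dots,X_n\subset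
A}\operatorname{tr}\prod_i(-\beta\Phi_{X_i})$. The normalized trace is multiplicative over groups of
terms with disjoint supports, and such terms commute, so each summand factorizes over the connected
components of its sequence. Hence $Z$ is a gas of polymers, the clusters, with hard-core repulsion
between overlapping supports, and its logarithm is given by the Mayer expansion with coefficients
`phi`.

This identification avoids regrouping sequences into sets of components. Splitting off only the
component of one site $x$ gives $Z(A)=Z(A\setminus x)+\sum_{U\ni x}\omega(x,U)Z(A\setminus U)$,
where $\omega(x,U)$ is the total weight of the connected sequences with support $U$
(`Factorizes.expSum_eq`). A gas restricted to a finite set $F$ of clusters obeys the same recursion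
with $\omega_F(x,U)=\sum_{C\in F,\,\operatorname{supp}C=U}w(C)$. The recursion determines everything
from the value at $\emptyset$, so the finite gases converge to $Z$ as $F$ grows
(`tendsto_of_site_recursion`). Each finite gas is the exponential of its Mayer series
(`tsum_polymerWeight_eq_exp`), and dominated convergence passes to all clusters
(`eq_exp_tsum_ursellTerm`).

Two estimates carry the convergence. Exploring a connected sequence site by site gives $\sum_{C\ni
x}|w(C)|e^{a|\operatorname{supp}C|}\le a$ (`sum_spanned_le`, `sum_norm_weight_mem_le`); the radius
$e^a(1+a)$ combines $e^a$ from this weight with $1+a$ from the exploration. This is the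
Kotecký–Preiss criterion, which yields the bound with one cluster fixed (`sum_rootedSum_le`). Both
inductions rest on a recursion that deletes one root from a graph, `rootedSum`.

For analyticity, the expansion converges locally uniformly on the disc and is bounded there by a
constant times $|\Lambda|$. Limits of Taylor coefficients along an ultrafilter then give the
analytic limit function (`exists_analyticOnNhd_of_bounded`). -/

namespace ClusterExpansion

/-! ### Sums over lists and over their splittings -/

/-- The sum of `H A B` over all ways to split the list `l` into a subsequence `A` and the
complementary subsequence `B`. -/
def splitSum {α M : Type*} [AddCommMonoid M] : List α → (List α → List α → M) → M
  | [], H => H [] []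
  | a :: l, H => splitSum l (fun A B => H (a :: A) B) + splitSum l (fun A B => H A (a :: B))

/-- The sum of `f l` over all lists `l` of length `n` with entries in `F`. -/
def listSum {α M : Type*} [AddCommMonoid M] (F : Finset α) : ℕ → (List α → M) → M
  | 0, f => f []
  | n + 1, f => ∑ a ∈ F, listSum F n (fun l => f (a :: l))

section SplitSum

variable {α β M : Type*} [AddCommMonoid M]

theorem splitSum_congr {l : List α} {H H' : List α → List α → M}
    (h : ∀ A B, (A ++ B).Perm l → H A B = H' A B) : splitSum l H = splitSum l H' := by
  induction l generalizing H H' with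
  | nil => exact h [] [] (by simp)
  | cons a l ih =>
    simp only [splitSum]
    congr 1
    · exact ih fun A B hAB => h _ _ (by simpa using hAB)
    · exact ih fun A B hAB => h _ _ (List.perm_middle.trans (hAB.cons a))

theorem splitSum_zero (l : List α) : splitSum l (fun _ _ => (0 : M)) = 0 := by
  induction l with
  | nil => rfl
  | cons a l ih => simp [splitSum, ih]

theorem splitSum_add (l : List α) (H H' : List α → List α → M) :
    splitSum l (fun A B => H A B + H' A B) = splitSum l H + splitSum l H' := by
  induction l generalizing H H' with
  | nil => rfl
  | cons a l ih => simp only [splitSum, ih]; abel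

theorem splitSum_map {N : Type*} [AddCommMonoid N] (ψ : M →+ N) (l : List α)
    (H : List α → List α → M) : ψ (splitSum l H) = splitSum l (fun A B => ψ (H A B)) := by
  induction l generalizing H with
  | nil => rfl
  | cons a l ih => simp only [splitSum, map_add, ih]

theorem splitSum_mul_left {R : Type*} [Semiring R] (c : R) (l : List α)
    (H : List α → List α → R) : splitSum l (fun A B => c * H A B) = c * splitSum l H :=
  (splitSum_map (AddMonoidHom.mulLeft c) l H).symm

theorem splitSum_mul_right {R : Type*} [Semiring R] (c : R) (l : List α)
    (H : List α → List α → R) : splitSum l (fun A B => H A B * c) = splitSum l H * c :=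
  (splitSum_map (AddMonoidHom.mulRight c) l H).symm

theorem splitSum_list_map (g : α → β) (l : List α) (H : List β → List β → M) :
    splitSum (l.map g) H = splitSum l (fun A B => H (A.map g) (B.map g)) := by
  induction l generalizing H with
  | nil => rfl
  | cons a l ih => simp only [List.map_cons, splitSum, ih]

theorem splitSum_le_splitSum {l : List α} {H H' : List α → List α → ℝ}
    (h : ∀ A B, (A ++ B).Perm l → H A B ≤ H' A B) : splitSum l H ≤ splitSum l H' := by
  induction l generalizing H H' with
  | nil => exact h [] [] (by simp)
  | cons a l ih =>
    simp only [splitSum]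
    gcongr
    · exact ih fun A B hAB => h _ _ (by simpa using hAB)
    · exact ih fun A B hAB => h _ _ (List.perm_middle.trans (hAB.cons a))

theorem abs_splitSum_le (l : List α) (H : List α → List α → ℤ) :
    |splitSum l H| ≤ splitSum l (fun A B => |H A B|) := by
  induction l generalizing H with
  | nil => exact le_rfl
  | cons a l ih => exact (abs_add_le _ _).trans (add_le_add (ih _) (ih _))

/-- Exactly one splitting has all entries satisfying `p` on the left and all others on the right. -/
theorem splitSum_filter (p : α → Prop) [DecidablePred p] (l : List α) (H : List α → List α → M) :
    splitSum l (fun A B => if (∀ a ∈ A, p a) ∧ (∀ b ∈ B, ¬ p b) then H A B else 0) =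
      H (l.filter p) (l.filter (fun a => ¬ p a)) := by
  induction l generalizing H with
  | nil => simp [splitSum]
  | cons a l ih =>
    simp only [splitSum]
    by_cases ha : p a
    · have h2 : splitSum l (fun A B => if (∀ x ∈ A, p x) ∧ (∀ b ∈ a :: B, ¬ p b) then
          H A (a :: B) else 0) = 0 :=
        (splitSum_congr fun A B _ => by simp [ha]).trans (splitSum_zero l)
      rw [h2, add_zero]
      simpa [ha] using ih (fun A B => H (a :: A) B)
    · have h2 : splitSum l (fun A B => if (∀ x ∈ a :: A, p x) ∧ (∀ b ∈ B, ¬ p b) then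
          H (a :: A) B else 0) = 0 :=
        (splitSum_congr fun A B _ => by simp [ha]).trans (splitSum_zero l)
      rw [h2, zero_add]
      simpa [ha] using ih (fun A B => H A (a :: B))

/-- Only the trivial splitting has nothing on the left. -/
theorem splitSum_left_nil (l : List α) (H : List α → List α → M)
    (h : ∀ a A B, H (a :: A) B = 0) : splitSum l H = H [] l := by
  induction l generalizing H with
  | nil => rfl
  | cons a l ih =>
    rw [splitSum, ih (fun A B => H A (a :: B)) fun _ _ _ => h _ _ _]
    simp [h, splitSum_zero]

/-- Coassociativity of splitting. -/
theorem splitSum_assoc (l : List α) (H : List α → List α → List α → M) :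
    splitSum l (fun AB C => splitSum AB (fun A B => H A B C)) =
      splitSum l (fun A BC => splitSum BC (fun B C => H A B C)) := by
  induction l generalizing H with
  | nil => rfl
  | cons a l ih =>
    simp only [splitSum, splitSum_add]
    rw [ih (fun A B C => H (a :: A) B C), ih (fun A B C => H A (a :: B) C),
      ih (fun A B C => H A B (a :: C)), add_assoc]

theorem prod_one_add_eq_splitSum {R : Type*} [CommSemiring R] (f : α → R) (l : List α) :
    (l.map fun a => 1 + f a).prod = splitSum l (fun A _ => (A.map f).prod) := by
  induction l with
  | nil => rfl
  | cons a l ih =>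
    simp only [splitSum, List.map_cons, List.prod_cons, splitSum_mul_left, ← ih]
    ring

/-- Splittings of a list without repetitions correspond to subsets. -/
theorem splitSum_eq_sum_powerset [DecidableEq α] {l : List α} (hl : l.Nodup)
    (H : List α → List α → M) :
    splitSum l H =
      ∑ J ∈ l.toFinset.powerset, H (l.filter (· ∈ J)) (l.filter (· ∉ J)) := by
  induction l generalizing H with
  | nil => simp [splitSum]
  | cons a l ih =>
    obtain ⟨hal, hl⟩ := List.nodup_cons.1 hl
    have haF : a ∉ l.toFinset := by simpa using hal
    rw [List.toFinset_cons, Finset.sum_powerset_insert haF, splitSum, ih hl, ih hl, add_comm]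
    congr 1
    · refine Finset.sum_congr rfl fun J hJ => ?_
      have : a ∉ J := fun h => haF (Finset.mem_powerset.1 hJ h)
      simp [this]
    · refine Finset.sum_congr rfl fun J hJ => ?_
      have h1 : ∀ x ∈ l, (x ∈ insert a J ↔ x ∈ J) := fun x hx => by
        have : x ≠ a := fun h => hal (h ▸ hx)
        simp [this]
      rw [List.filter_cons_of_pos (by simp), List.filter_cons_of_neg (by simp)]
      rw [List.filter_congr (p := (· ∈ insert a J)) (q := (· ∈ J)) fun x hx => by simp [h1 x hx],
        List.filter_congr (p := (· ∉ insert a J)) (q := (· ∉ J)) fun x hx => by simp [h1 x hx]]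

end SplitSum

section ListSum

variable {α M : Type*} [AddCommMonoid M]

theorem listSum_congr {F : Finset α} {n : ℕ} {f g : List α → M}
    (h : ∀ l : List α, l.length = n → (∀ a ∈ l, a ∈ F) → f l = g l) :
    listSum F n f = listSum F n g := by
  induction n generalizing f g with
  | zero => exact h [] rfl (by simp)
  | succ n ih =>
    refine Finset.sum_congr rfl fun a ha => ih fun l hl hlF => h _ (by simp [hl]) ?_
    simpa using ⟨ha, hlF⟩

theorem listSum_zero (F : Finset α) (n : ℕ) : listSum F n (fun _ => (0 : M)) = 0 := by
  induction n with
  | zero => rfl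
  | succ n ih => simp [listSum, ih]

theorem listSum_add (F : Finset α) (n : ℕ) (f g : List α → M) :
    listSum F n (fun l => f l + g l) = listSum F n f + listSum F n g := by
  induction n generalizing f g with
  | zero => rfl
  | succ n ih => simp only [listSum, ih, Finset.sum_add_distrib]

theorem listSum_map {N : Type*} [AddCommMonoid N] (ψ : M →+ N) (F : Finset α) (n : ℕ)
    (f : List α → M) : ψ (listSum F n f) = listSum F n (fun l => ψ (f l)) := by
  induction n generalizing f with
  | zero => rfl
  | succ n ih => simp only [listSum, map_sum, ih]

theorem listSum_mul_left {R : Type*} [Semiring R] (c : R) (F : Finset α) (n : ℕ)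
    (f : List α → R) : listSum F n (fun l => c * f l) = c * listSum F n f :=
  (listSum_map (AddMonoidHom.mulLeft c) F n f).symm

theorem listSum_mul_right {R : Type*} [Semiring R] (c : R) (F : Finset α) (n : ℕ)
    (f : List α → R) : listSum F n (fun l => f l * c) = listSum F n f * c :=
  (listSum_map (AddMonoidHom.mulRight c) F n f).symm

theorem listSum_sum {ι : Type*} (s : Finset ι) (F : Finset α) (n : ℕ) (f : ι → List α → M) :
    listSum F n (fun l => ∑ i ∈ s, f i l) = ∑ i ∈ s, listSum F n (f i) := by
  induction n generalizing f with
  | zero => rfl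
  | succ n ih => simp only [listSum, ih]; exact Finset.sum_comm

theorem listSum_le_listSum {F : Finset α} {n : ℕ} {f g : List α → ℝ}
    (h : ∀ l : List α, l.length = n → (∀ a ∈ l, a ∈ F) → f l ≤ g l) :
    listSum F n f ≤ listSum F n g := by
  induction n generalizing f g with
  | zero => exact h [] rfl (by simp)
  | succ n ih =>
    refine Finset.sum_le_sum fun a ha => ih fun l hl hlF => h _ (by simp [hl]) ?_
    simpa using ⟨ha, hlF⟩

theorem listSum_nonneg {F : Finset α} {n : ℕ} {f : List α → ℝ} (h : ∀ l, 0 ≤ f l) :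
    0 ≤ listSum F n f :=
  (listSum_zero F n).symm.le.trans (listSum_le_listSum fun l _ _ => h l)

theorem norm_listSum_le {E : Type*} [SeminormedAddCommGroup E] (F : Finset α) (n : ℕ)
    (f : List α → E) : ‖listSum F n f‖ ≤ listSum F n (fun l => ‖f l‖) := by
  induction n generalizing f with
  | zero => exact le_rfl
  | succ n ih => exact (norm_sum_le _ _).trans (Finset.sum_le_sum fun a _ => ih _)

theorem listSum_prod {R : Type*} [Semiring R] (F : Finset α) (n : ℕ) (g : α → R) :
    listSum F n (fun l => (l.map g).prod) = (∑ a ∈ F, g a) ^ n := by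
  induction n with
  | zero => simp [listSum]
  | succ n ih =>
    simp only [listSum, List.map_cons, List.prod_cons, listSum_mul_left, ih, ← Finset.sum_mul,
      pow_succ']

theorem listSum_filter (F : Finset α) (p : α → Prop) [DecidablePred p] (n : ℕ) (f : List α → M) :
    listSum (F.filter p) n f = listSum F n (fun l => if ∀ a ∈ l, p a then f l else 0) := by
  induction n generalizing f with
  | zero => simp [listSum]
  | succ n ih =>
    simp only [listSum, ih, Finset.sum_filter]
    refine Finset.sum_congr rfl fun a _ => ?_
    by_cases ha : p a <;> simp [ha, listSum_zero]

/-- The Leibniz rule: summing over a list and its splittings amounts to summing over two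
independent lists, up to binomial coefficients. -/
theorem listSum_splitSum (F : Finset α) (n : ℕ) (H : List α → List α → M) :
    listSum F n (fun l => splitSum l H) =
      ∑ ij ∈ Finset.HasAntidiagonal.antidiagonal n,
        n.choose ij.1 • listSum F ij.1 (fun A => listSum F ij.2 (fun B => H A B)) := by
  induction n generalizing H with
  | zero => simp [listSum, splitSum]
  | succ n ih =>
    rw [Finset.sum_antidiagonal_choose_succ_nsmul
      (fun i j => listSum F i (fun A => listSum F j (fun B => H A B)))]
    change ∑ a ∈ F, listSum F n (fun l => splitSum (a :: l) H) = _
    rw [add_comm]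
    simp only [listSum, splitSum, listSum_add, ih, Finset.sum_add_distrib, listSum_sum]
    congr 1
    · rw [Finset.sum_comm]
      refine Finset.sum_congr rfl fun ij hij => ?_
      rw [← Finset.sum_nsmul, 
        Nat.choose_symm_of_eq_add (Finset.HasAntidiagonal.mem_antidiagonal.1 hij).symm]
    · rw [Finset.sum_comm]
      exact Finset.sum_congr rfl fun ij _ => (Finset.sum_nsmul _ _ _)

/-- The factorials absorb the binomial coefficients: splitting corresponds to the product of
exponential generating functions. -/
theorem listSum_splitSum_div_factorial {K : Type*} [Field K] [CharZero K] (F : Finset α) (n : ℕ)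
    (H : List α → List α → K) :
    (n ! : K)⁻¹ * listSum F n (fun l => splitSum l H) =
      ∑ ij ∈ Finset.HasAntidiagonal.antidiagonal n, (ij.1 ! : K)⁻¹ *
        listSum F ij.1 (fun A => (ij.2 ! : K)⁻¹ * listSum F ij.2 (fun B => H A B)) := by
  rw [listSum_splitSum, Finset.mul_sum]
  refine Finset.sum_congr rfl fun ij hij => ?_
  obtain rfl := Finset.HasAntidiagonal.mem_antidiagonal.1 hij
  rw [listSum_mul_left, nsmul_eq_mul, ← mul_assoc, ← mul_assoc]
  congr 1
  have h := Nat.add_choose_mul_factorial_mul_factorial ij.1 ij.2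
  have h' : ((ij.1 + ij.2).choose ij.1 : K) * (ij.1 ! : K) * (ij.2 ! : K) =
    ((ij.1 + ij.2)! : K) := by rw [Nat.choose_symm_add]; exact_mod_cast h
  have h1 : (ij.1 ! : K) ≠ 0 := by exact_mod_cast ij.1.factorial_ne_zero
  have h2 : (ij.2 ! : K) ≠ 0 := by exact_mod_cast ij.2.factorial_ne_zero
  have h3 : ((ij.1 + ij.2)! : K) ≠ 0 := by exact_mod_cast (ij.1 + ij.2).factorial_ne_zero
  field_simp
  rw [← h']

/-- The same product truncated at total length below `n`. Working with truncations keeps the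
convergence proofs free of infinite sums. -/
theorem sum_range_listSum_splitSum {K : Type*} [Field K] [CharZero K] (F : Finset α) (n : ℕ)
    (H : List α → List α → K) :
    ∑ m ∈ Finset.range n, (m ! : K)⁻¹ * listSum F m (fun l => splitSum l H) =
      ∑ i ∈ Finset.range n, (i ! : K)⁻¹ * listSum F i (fun A =>
        ∑ j ∈ Finset.range (n - i), (j ! : K)⁻¹ * listSum F j (fun B => H A B)) := by
  have h := Finset.sum_range_diag_flip n (fun i j => (i ! : K)⁻¹ * listSum F i (fun A =>
    (j ! : K)⁻¹ * listSum F j (fun B => H A B)))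
  simp only [listSum_sum, Finset.mul_sum]
  rw [← h]
  refine Finset.sum_congr rfl fun m _ => ?_
  rw [listSum_splitSum_div_factorial, Finset.Nat.sum_antidiagonal_eq_sum_range_succ_mk]

theorem listSum_eq_sum_piFinset [DecidableEq α] (F : Finset α) (n : ℕ) (f : List α → M) :
    listSum F n f = ∑ C ∈ Fintype.piFinset (fun _ : Fin n => F), f (List.ofFn C) := by
  induction n generalizing f with
  | zero => simp [listSum]
  | succ n ih =>
    simp only [listSum, ih]
    rw [← Finset.sum_product']
    refine Finset.sum_nbij' (fun p => Fin.cons p.1 p.2) (fun C => (C 0, Fin.tail C)) ?_ ?_ ?_ ?_ ?_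
    · rintro ⟨a, C⟩ h
      simp only [Finset.mem_product, Fintype.mem_piFinset] at h ⊢
      intro i
      refine Fin.cases ?_ (fun j => ?_) i
      · exact h.1
      · exact h.2 j
    · intro C h
      simp only [Finset.mem_product, Fintype.mem_piFinset] at h ⊢
      exact ⟨h 0, fun i => h i.succ⟩
    · rintro ⟨a, C⟩ _; simp
    · intro C _; simp
    · rintro ⟨a, C⟩ _; simp [List.ofFn_succ]

end ListSum

/-! ### The Mayer expansion in recursive form -/

section Mayer

variable {α β : Type*}

/-- The product over all pairs of entries of `1 + ζ`. -/
def pairProd (ζ : α → α → ℤ) : List α → ℤ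
  | [] => 1
  | a :: l => (l.map fun b => 1 + ζ a b).prod * pairProd ζ l

/-- The sum of `∏ ζ` over all graphs on the entries of `S` and `V` such that every entry of `V` is
connected to some entry of `S`, in the form of a recursion that removes the first entry of `S`. -/
def rootedSum (ζ : α → α → ℤ) (S V : List α) : ℤ :=
  match S with
  | [] => if V = [] then 1 else 0
  | v :: S => (S.map fun s => 1 + ζ v s).prod *
      splitSum V.attach (fun B A => (B.map fun b => ζ v b.1).prod *
        -- The length condition holds for every splitting; it is tested only to make termination
        -- visible. Moving `B` among the roots preserves the total length, while deleting `v` lowers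
        -- it by one.
        if _ : (B ++ A).length = V.length then
          rootedSum ζ (S ++ B.map Subtype.val) (A.map Subtype.val) else 0)
termination_by S.length + V.length
decreasing_by simp at *; omega

theorem rootedSum_nil_left (ζ : α → α → ℤ) (V : List α) [Decidable (V = [])] :
    rootedSum ζ [] V = if V = [] then 1 else 0 := by
  rw [rootedSum]; congr

theorem rootedSum_cons (ζ : α → α → ℤ) (v : α) (S V : List α) :
    rootedSum ζ (v :: S) V = (S.map fun s => 1 + ζ v s).prod *
      splitSum V (fun B A => (B.map (ζ v)).prod * rootedSum ζ (S ++ B) A) := by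
  rw [rootedSum]
  congr 1
  conv_rhs => rw [← List.attach_map_subtype_val V, splitSum_list_map]
  refine splitSum_congr fun B A h => ?_
  rw [dif_pos (by simpa using h.length_eq)]
  simp

theorem rootedSum_induction {motive : List α → List α → Prop}
    (nil : ∀ V, motive [] V)
    (cons : ∀ v S V, (∀ B A, (B ++ A).Perm V → motive (S ++ B) A) → motive (v :: S) V)
    (S V : List α) : motive S V := by
  induction h : S.length + V.length using Nat.strong_induction_on generalizing S V with
  | _ n ih =>
    cases S with
    | nil => exact nil V
    | cons v S =>
      refine cons v S V fun B A hBA => ih _ ?_ _ _ rfl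
      have := hBA.length_eq
      simp at this h ⊢
      omega

theorem rootedSum_map (ζ : β → β → ℤ) (g : α → β) (S V : List α) :
    rootedSum ζ (S.map g) (V.map g) = rootedSum (fun a b => ζ (g a) (g b)) S V := by
  induction S, V using rootedSum_induction with
  | nil V => classical simp [rootedSum_nil_left]
  | cons v S V ih =>
    rw [List.map_cons, rootedSum_cons, rootedSum_cons, splitSum_list_map]
    congr 1
    · simp [Function.comp_def]
    · refine splitSum_congr fun B A h => ?_
      rw [← List.map_append, ih B A h]
      simp [Function.comp_def]

theorem pairProd_perm {ζ : α → α → ℤ} (hζ : ∀ a b, ζ a b = ζ b a) {l l' : List α}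
    (h : l.Perm l') : pairProd ζ l = pairProd ζ l' := by
  induction h with
  | nil => rfl
  | cons a h ih => simp only [pairProd, ih, (h.map _).prod_eq]
  | swap a b l => simp only [pairProd, List.map_cons, List.prod_cons, hζ a b]; ring
  | trans _ _ h1 h2 => exact h1.trans h2

/-- Mayer identity: expand the product of `1 + ζ` into graphs and let `A` be the part of `V` linked
to `S`. No edge joins the rest `B` to `S` or `A`, so `B` carries a free product over pairs. -/
theorem splitSum_rootedSum_mul_pairProd {ζ : α → α → ℤ} (hζ : ∀ a b, ζ a b = ζ b a)
    (S V : List α) :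
    splitSum V (fun A B => rootedSum ζ S A * pairProd ζ B) = pairProd ζ (S ++ V) := by
  induction S, V using rootedSum_induction with
  | nil V =>
    classical
    rw [splitSum_left_nil] <;> simp [rootedSum_nil_left]
  | cons v S V ih =>
    simp only [rootedSum_cons, mul_assoc, splitSum_mul_left, ← splitSum_mul_right]
    rw [splitSum_assoc V (fun B A C => (B.map (ζ v)).prod * (rootedSum ζ (S ++ B) A * pairProd ζ C))]
    simp only [splitSum_mul_left]
    have : splitSum V (fun B R => (B.map (ζ v)).prod *
        splitSum R (fun A C => rootedSum ζ (S ++ B) A * pairProd ζ C)) =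
        splitSum V (fun B R => (B.map (ζ v)).prod * pairProd ζ (S ++ V)) := by
      -- By induction the inner sum is `pairProd ζ (S ++ V)` for every `B`, up to order; the
      -- remaining sum over `B` rebuilds the factors `1 + ζ v b` of the deleted root.
      refine splitSum_congr fun B R h => ?_
      rw [ih B R h, List.append_assoc, pairProd_perm hζ (h.append_left S)]
    rw [this, splitSum_mul_right, ← prod_one_add_eq_splitSum, List.cons_append, pairProd,
      List.map_append, List.prod_append, mul_assoc]

end Mayer

/-! ### The Kotecký–Preiss bound -/

section KoteckyPreiss

variable {α : Type*}

open scoped Classical in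
/-- The hard core interaction: `-1` for incompatible pairs and `0` for compatible ones. -/
noncomputable def hardCore (inc : α → α → Prop) (a b : α) : ℤ := if inc a b then -1 else 0

theorem one_add_hardCore_prod_abs_le (inc : α → α → Prop) (v : α) (l : List α) :
    |(l.map fun b => 1 + hardCore inc v b).prod| ≤ 1 := by
  induction l with
  | nil => simp
  | cons a l ih =>
    simp only [List.map_cons, List.prod_cons, abs_mul]
    refine mul_le_one₀ ?_ (abs_nonneg _) ih
    unfold hardCore
    split_ifs <;> simp

theorem abs_pairProd_hardCore_le (inc : α → α → Prop) (l : List α) :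
    |pairProd (hardCore inc) l| ≤ 1 := by
  induction l with
  | nil => simp [pairProd]
  | cons a l ih =>
    rw [pairProd, abs_mul]
    exact mul_le_one₀ (one_add_hardCore_prod_abs_le inc a l) (abs_nonneg _) ih

theorem hardCore_prod_abs_le (inc : α → α → Prop) (v : α) (l : List α) :
    |((l.map (hardCore inc v)).prod : ℝ)| ≤ (l.map fun b => |(hardCore inc v b : ℝ)|).prod := by
  induction l with
  | nil => simp
  | cons a l ih =>
    simp only [List.map_cons, List.prod_cons, Int.cast_mul, abs_mul]
    gcongr

/-- For a hard core the factors `1 + ζ v s` between roots are 0 or 1, so they can be dropped from an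
upper bound. -/
theorem rootedSum_cons_abs_le (inc : α → α → Prop) (v : α) (S V : List α) :
    |(rootedSum (hardCore inc) (v :: S) V : ℝ)| ≤
      splitSum V (fun B A => (B.map fun b => |(hardCore inc v b : ℝ)|).prod *
        |(rootedSum (hardCore inc) (S ++ B) A : ℝ)|) := by
  rw [rootedSum_cons, Int.cast_mul, abs_mul]
  refine (mul_le_of_le_one_left (abs_nonneg _)
    (by exact_mod_cast one_add_hardCore_prod_abs_le inc v S)).trans ?_
  have := abs_splitSum_le V (fun B A => (B.map (hardCore inc v)).prod *
    rootedSum (hardCore inc) (S ++ B) A)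
  rw [← Int.cast_abs]
  refine (Int.cast_le.2 this).trans ?_
  refine (splitSum_map (Int.castAddHom ℝ) V _).trans_le ?_
  refine splitSum_le_splitSum fun B A _ => ?_
  simp only [Int.coe_castAddHom, Int.cast_abs, Int.cast_mul, abs_mul]
  gcongr
  exact hardCore_prod_abs_le inc v B

/-- The Kotecký–Preiss bound, for finitely many polymers and truncated. -/
theorem sum_rootedSum_le {inc : α → α → Prop} {F : Finset α} {w b : α → ℝ} (hw : ∀ a, 0 ≤ w a)
    (hb : ∀ v, ∑ c ∈ F, |(hardCore inc v c : ℝ)| * (w c * Real.exp (b c)) ≤ b v)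
    (K : ℕ) (S : List α) :
    ∑ m ∈ Finset.range K, (m ! : ℝ)⁻¹ *
      listSum F m (fun l => |(rootedSum (hardCore inc) S l : ℝ)| * (l.map w).prod) ≤
        (S.map fun s => Real.exp (b s)).prod := by
  induction h : S.length + K using Nat.strong_induction_on generalizing S K with
  | _ n ih =>
  have hexp : ∀ T : List α, 0 ≤ (T.map fun s => Real.exp (b s)).prod := fun T =>
    List.prod_nonneg fun x hx => by
      obtain ⟨c, _, rfl⟩ := List.mem_map.1 hx
      exact (Real.exp_pos _).le
  have hwp : ∀ T : List α, 0 ≤ (T.map w).prod := fun T =>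
    List.prod_nonneg fun x hx => by
      obtain ⟨c, _, rfl⟩ := List.mem_map.1 hx
      exact hw c
  have hcp : ∀ (v : α) (T : List α), 0 ≤ (T.map fun c => |(hardCore inc v c : ℝ)|).prod :=
    fun v T => List.prod_nonneg fun x hx => by
      obtain ⟨c, _, rfl⟩ := List.mem_map.1 hx
      exact abs_nonneg _
  cases S with
  | nil =>
    classical
    simp only [rootedSum_nil_left, List.map_nil, List.prod_nil]
    cases K with
    | zero => simp
    | succ K =>
      rw [Finset.sum_range_succ', Finset.sum_eq_zero]
      · simp [listSum]
      · intro m _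
        simp [listSum, listSum_zero]
  | cons v S =>
    set f : List α → List α → ℝ := fun B A =>
      ((B.map fun c => |(hardCore inc v c : ℝ)|).prod * (B.map w).prod) *
        (|(rootedSum (hardCore inc) (S ++ B) A : ℝ)| * (A.map w).prod) with hf
    have h1 : ∀ l : List α, |(rootedSum (hardCore inc) (v :: S) l : ℝ)| * (l.map w).prod ≤
        splitSum l f := by
      intro l
      refine (mul_le_mul_of_nonneg_right (rootedSum_cons_abs_le inc v S l) (hwp l)).trans ?_
      rw [← splitSum_mul_right]
      refine splitSum_le_splitSum fun B A hBA => le_of_eq ?_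
      rw [← (hBA.map w).prod_eq, List.map_append, List.prod_append, hf]
      ring
    calc ∑ m ∈ Finset.range K, (m ! : ℝ)⁻¹ * listSum F m
          (fun l => |(rootedSum (hardCore inc) (v :: S) l : ℝ)| * (l.map w).prod)
        ≤ ∑ m ∈ Finset.range K, (m ! : ℝ)⁻¹ * listSum F m (fun l => splitSum l f) := by
          gcongr
          exact listSum_le_listSum fun l _ _ => h1 l
      _ = ∑ i ∈ Finset.range K, (i ! : ℝ)⁻¹ * listSum F i (fun B =>
            ∑ j ∈ Finset.range (K - i), (j ! : ℝ)⁻¹ * listSum F j (fun A => f B A)) :=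
          sum_range_listSum_splitSum F K f
      -- The induction hypothesis bounds the inner sum by the exponentials of `S ++ B`. The factors
      -- belonging to `B` decouple, and each sums to at most `b v`; the outer sum is then a partial
      -- sum of `exp (b v)`.
      _ ≤ ∑ i ∈ Finset.range K, (i ! : ℝ)⁻¹ * ((b v) ^ i *
            (S.map fun s => Real.exp (b s)).prod) := by
          refine Finset.sum_le_sum fun i hi => ?_
          gcongr
          have h2 : listSum F i (fun B => ∑ j ∈ Finset.range (K - i), (j ! : ℝ)⁻¹ *
                listSum F j (fun A => f B A)) ≤
              listSum F i (fun B => (B.map fun c => |(hardCore inc v c : ℝ)| *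
                (w c * Real.exp (b c))).prod * (S.map fun s => Real.exp (b s)).prod) := by
            refine listSum_le_listSum fun B hB _ => ?_
            -- The `i` entries added to the roots are paid for by the shorter truncation `K - i`;
            -- the loss of `v` makes the measure strictly smaller.
            have hlt : (S ++ B).length + (K - i) < n := by
              have := Finset.mem_range.1 hi
              simp at h ⊢
              omega
            have h3 := ih _ hlt (K - i) (S ++ B) rfl
            simp only [hf, listSum_mul_left, mul_left_comm _ ((B.map _).prod * _),
              ← Finset.mul_sum]
            refine (mul_le_mul_of_nonneg_left h3 (mul_nonneg (hcp v B) (hwp B))).trans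
              (le_of_eq ?_)
            rw [List.map_append, List.prod_append, List.prod_map_mul, List.prod_map_mul]
            ring
          refine h2.trans ?_
          rw [listSum_mul_right, listSum_prod]
          have h4 : 0 ≤ ∑ c ∈ F, |(hardCore inc v c : ℝ)| * (w c * Real.exp (b c)) :=
            Finset.sum_nonneg fun c _ => mul_nonneg (abs_nonneg _)
              (mul_nonneg (hw c) (Real.exp_pos _).le)
          exact mul_le_mul_of_nonneg_right (pow_le_pow_left₀ h4 (hb v) i) (hexp S)
      _ = (∑ i ∈ Finset.range K, (b v) ^ i / (i ! : ℝ)) *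
            (S.map fun s => Real.exp (b s)).prod := by
          rw [Finset.sum_mul]
          exact Finset.sum_congr rfl fun i _ => by ring
      _ ≤ ((v :: S).map fun s => Real.exp (b s)).prod := by
          rw [List.map_cons, List.prod_cons]
          refine mul_le_mul_of_nonneg_right (Real.sum_le_exp_of_nonneg ?_ K) (hexp S)
          exact (Finset.sum_nonneg fun c _ => mul_nonneg (abs_nonneg _)
            (mul_nonneg (hw c) (Real.exp_pos _).le)).trans (hb v)

end KoteckyPreiss

/-! ### The recursion computes sums over graphs -/

section Graphs

variable {ι : Type*}

/-- All edges of `g` have their ends in `W`. -/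
def GraphOn (W : Finset ι) (g : SimpleGraph ι) : Prop := ∀ a b, g.Adj a b → a ∈ W

theorem GraphOn.right {W : Finset ι} {g : SimpleGraph ι} (h : GraphOn W g) {a b : ι}
    (hab : g.Adj a b) : b ∈ W := h b a hab.symm

/-- The graph whose edges join `v` to the elements of `N`. -/
def star (v : ι) (N : Finset ι) : SimpleGraph ι where
  Adj a b := a ≠ b ∧ ((a = v ∧ b ∈ N) ∨ (b = v ∧ a ∈ N))
  symm := ⟨fun _ _ h => ⟨h.1.symm, h.2.symm⟩⟩
  loopless := ⟨fun _ h => h.1 rfl⟩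

/-- The graph without the edges at `v`. -/
def isolate (v : ι) (g : SimpleGraph ι) : SimpleGraph ι where
  Adj a b := g.Adj a b ∧ a ≠ v ∧ b ≠ v
  symm := ⟨fun _ _ h => ⟨h.1.symm, h.2.2, h.2.1⟩⟩
  loopless := ⟨fun _ h => h.1.ne rfl⟩

/-- Every entry of `V` is connected to some entry of `S`. -/
def Linked (S V : List ι) (g : SimpleGraph ι) : Prop := ∀ u ∈ V, ∃ s ∈ S, g.Reachable u s

/-- Deleting the root `v` turns its neighbours in `V` into roots. A walk to an old root can be
stopped at its first visit to `S` or `N`, before it uses an edge at `v`. -/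
theorem linked_sup_star_iff {W N : Finset ι} {v : ι} {S V : List ι} {g : SimpleGraph ι}
    (hg : GraphOn W g) (hv : v ∉ W) (hN : N ⊆ W) (hW : ∀ a, a ∈ W ↔ a ∈ S ∨ a ∈ V) :
    Linked (v :: S) V (g ⊔ star v N) ↔
      ∀ u ∈ V, u ∉ N → ∃ s, (s ∈ S ∨ (s ∈ V ∧ s ∈ N)) ∧ g.Reachable u s := by
  have hadj : ∀ n ∈ N, (g ⊔ star v N).Adj n v := fun n hn =>
    Or.inr ⟨fun h => hv (h ▸ hN hn), Or.inr ⟨rfl, hn⟩⟩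
  constructor
  · intro h u hu huN
    obtain ⟨s, hs, ⟨p⟩⟩ := h u hu
    have huW : u ∈ W := (hW u).2 (Or.inr hu)
    clear h hu huN
    induction p with
    | nil =>
      rcases List.mem_cons.1 hs with rfl | hs
      · exact absurd huW hv
      · exact ⟨_, Or.inl hs, SimpleGraph.Reachable.refl _⟩
    | @cons a b c hab p ih =>
      by_cases haS : a ∈ S
      · exact ⟨a, Or.inl haS, SimpleGraph.Reachable.refl _⟩
      by_cases haN : a ∈ N
      · exact ⟨a, Or.inr ⟨((hW a).1 huW).resolve_left haS, haN⟩, SimpleGraph.Reachable.refl _⟩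
      rcases hab with hab | ⟨_, ⟨rfl, _⟩ | ⟨_, h⟩⟩
      · by_cases hbN : b ∈ N
        · have hb := (hW b).1 (hN hbN)
          refine ⟨b, ?_, hab.reachable⟩
          tauto
        · obtain ⟨s, hs', hr⟩ := ih hs (hg.right hab)
          exact ⟨s, hs', hab.reachable.trans hr⟩
      · exact absurd huW hv
      · exact absurd h haN
  · intro h u hu
    by_cases huN : u ∈ N
    · exact ⟨v, by simp, (hadj u huN).reachable⟩
    · obtain ⟨s, hs, hr⟩ := h u hu huN
      have hr' := hr.mono (le_sup_left (b := star v N))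
      rcases hs with hs | ⟨_, hs⟩
      · exact ⟨s, by simp [hs], hr'⟩
      · exact ⟨v, by simp, hr'.trans (hadj s hs).reachable⟩

variable [Fintype ι] [LinearOrder ι]

open scoped Classical in
/-- The edges of `g`, as increasing pairs. -/
noncomputable def edgePairs (g : SimpleGraph ι) : Finset (ι × ι) :=
  Finset.univ.filter fun e => e.1 < e.2 ∧ g.Adj e.1 e.2

@[simp] theorem mem_edgePairs {g : SimpleGraph ι} {e : ι × ι} :
    e ∈ edgePairs g ↔ e.1 < e.2 ∧ g.Adj e.1 e.2 := by
  simp [edgePairs]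

open scoped Classical in
/-- The graphs all of whose edges have their ends in `W`. -/
noncomputable def graphsOn (W : Finset ι) : Finset (SimpleGraph ι) :=
  Finset.univ.filter (GraphOn W)

@[simp] theorem mem_graphsOn {W : Finset ι} {g : SimpleGraph ι} :
    g ∈ graphsOn W ↔ GraphOn W g := by
  simp [graphsOn]

/-- The product of `ζ` over the edges of `g`. -/
noncomputable def graphWeight (ζ : ι → ι → ℤ) (g : SimpleGraph ι) : ℤ :=
  ∏ e ∈ edgePairs g, ζ e.1 e.2

theorem graphWeight_sup_star {ζ : ι → ι → ℤ} (hζ : ∀ a b, ζ a b = ζ b a) {W N : Finset ι} {v : ι}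
    {g : SimpleGraph ι} (hg : GraphOn W g) (hv : v ∉ W) (hN : N ⊆ W) :
    graphWeight ζ (g ⊔ star v N) = (∏ n ∈ N, ζ v n) * graphWeight ζ g := by
  classical
  unfold graphWeight
  have hne : ∀ n ∈ N, n ≠ v := fun n hn h => hv (h ▸ hN hn)
  rw [show edgePairs (g ⊔ star v N) = edgePairs (star v N) ∪ edgePairs g from ?_,
    Finset.prod_union ?_]
  · congr 1
    symm
    -- Edges are stored as increasing pairs, so the edge between `v` and `n` has to be sorted.
    refine Finset.prod_bij (fun n _ => (min v n, max v n)) ?_ ?_ ?_ ?_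
    · intro n hn
      have := hne n hn
      rcases lt_or_gt_of_ne this with h | h
      · simp [star, h.le, h, this, hn]
      · simp [star, h.le, h, this.symm, hn]
    · intro n hn m hm h
      have h1 := hne n hn
      have h2 := hne m hm
      simp only [Prod.mk.injEq] at h
      rcases lt_or_gt_of_ne h1 with h3 | h3 <;> rcases lt_or_gt_of_ne h2 with h4 | h4 <;>
        simp [h3.le, h4.le] at h <;> grind
    · rintro ⟨a, b⟩ h
      simp only [mem_edgePairs, star] at h
      obtain ⟨hab, _, ⟨rfl, hb⟩ | ⟨rfl, ha⟩⟩ := h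
      · exact ⟨b, hb, by simp [hab.le]⟩
      · exact ⟨a, ha, by simp [hab.le]⟩
    · intro n hn
      rcases le_total v n with h | h
      · simp [h]
      · simp [h, hζ v n]
  · rw [Finset.disjoint_left]
    rintro ⟨a, b⟩ h h'
    simp only [mem_edgePairs, star] at h h'
    obtain ⟨hab, _, ⟨rfl, hb⟩ | ⟨rfl, ha⟩⟩ := h
    · exact hv (hg _ _ h'.2)
    · exact hv (hg.right h'.2)
  · ext e
    simp only [mem_edgePairs, Finset.mem_union, SimpleGraph.sup_adj]
    tauto

-- A graph is determined by the neighbourhood `N` of `v` and the graph left after isolating `v`, and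
-- both can be chosen freely.
open scoped Classical in
theorem sum_graphOn_insert {M : Type*} [AddCommMonoid M] {W : Finset ι} {v : ι} (hv : v ∉ W)
    (f : SimpleGraph ι → M) :
    ∑ g ∈ graphsOn (insert v W), f g =
      ∑ N ∈ W.powerset, ∑ g ∈ graphsOn W, f (g ⊔ star v N) := by
  rw [← Finset.sum_product']
  obtain ⟨nb, hnb⟩ : ∃ nb : SimpleGraph ι → Finset ι, ∀ g n, n ∈ nb g ↔ n ∈ W ∧ g.Adj v n :=
    ⟨fun g => W.filter (g.Adj v), by simp⟩
  have key : ∀ g : SimpleGraph ι, GraphOn (insert v W) g →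
      isolate v g ⊔ star v (nb g) = g := by
    intro g hg
    ext a b
    simp only [SimpleGraph.sup_adj, isolate, star, hnb]
    constructor
    · rintro (h | ⟨_, ⟨rfl, h⟩ | ⟨rfl, h⟩⟩)
      · exact h.1
      · exact h.2
      · exact h.2.symm
    · intro h
      have ha := Finset.mem_insert.1 (hg _ _ h)
      have hb := Finset.mem_insert.1 (hg.right h)
      by_cases hav : a = v
      · subst hav
        exact Or.inr ⟨h.ne, Or.inl ⟨rfl, hb.resolve_left h.ne', h⟩⟩
      by_cases hbv : b = v
      · subst hbv
        exact Or.inr ⟨h.ne, Or.inr ⟨rfl, ha.resolve_left h.ne, h.symm⟩⟩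
      exact Or.inl ⟨h, hav, hbv⟩
  refine Finset.sum_nbij' (fun g => (nb g, isolate v g))
    (fun p => p.2 ⊔ star v p.1) ?_ ?_ ?_ ?_ ?_
  · intro g hg
    simp only [mem_graphsOn, Finset.mem_product, Finset.mem_powerset] at hg ⊢
    refine ⟨fun n hn => ((hnb _ _).1 hn).1, ?_⟩
    exact fun a b h => (Finset.mem_insert.1 (hg _ _ h.1)).resolve_left h.2.1
  · rintro ⟨N, g⟩ h
    simp only [mem_graphsOn, Finset.mem_product, Finset.mem_powerset] at h ⊢
    rintro a b (hab | ⟨_, ⟨rfl, hb⟩ | ⟨rfl, ha⟩⟩)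
    · exact Finset.mem_insert_of_mem (h.2 _ _ hab)
    · exact Finset.mem_insert_self _ _
    · exact Finset.mem_insert_of_mem (h.1 ha)
  · intro g hg
    exact key g (by simpa using hg)
  · rintro ⟨N, g⟩ h
    simp only [mem_graphsOn, Finset.mem_product, Finset.mem_powerset] at h
    ext1
    · ext n
      refine (hnb _ _).trans ?_
      simp only [SimpleGraph.sup_adj, star]
      constructor
      · rintro ⟨_, hn | ⟨_, ⟨_, hn⟩ | ⟨rfl, hn⟩⟩⟩
        · exact absurd (h.2 _ _ hn) hv
        · exact hn
        · exact hn
      · intro hn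
        exact ⟨h.1 hn, Or.inr ⟨fun e => hv (e ▸ h.1 hn), Or.inl ⟨trivial, hn⟩⟩⟩
    · ext a b
      simp only [isolate, SimpleGraph.sup_adj, star]
      constructor
      · rintro ⟨hab | ⟨_, ⟨rfl, hb⟩ | ⟨rfl, ha⟩⟩, hav, hbv⟩
        · exact hab
        · exact absurd rfl hav
        · exact absurd rfl hbv
      · intro hab
        exact ⟨Or.inl hab, fun e => hv (e ▸ h.2 _ _ hab), fun e => hv (e ▸ h.2.right hab)⟩
  · intro g hg
    rw [key g (by simpa using hg)]

open scoped Classical in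
/-- The recursion of `rootedSum` computes the sum over graphs. -/
theorem rootedSum_eq_sum_graphs {ζ : ι → ι → ℤ} (hζ : ∀ a b, ζ a b = ζ b a) (S V : List ι)
    (hSV : (S ++ V).Nodup) :
    rootedSum ζ S V = ∑ g ∈ graphsOn (S ++ V).toFinset,
      if Linked S V g then graphWeight ζ g else 0 := by
  induction S, V using rootedSum_induction with
  | nil V =>
    rw [rootedSum_nil_left]
    cases V with
    | nil =>
      rw [Finset.sum_eq_single_of_mem ⊥ (by simp [GraphOn])]
      · simp [graphWeight, Linked, edgePairs]
      · intro g hg hne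
        refine absurd ?_ hne
        ext a b
        simp only [mem_graphsOn, GraphOn] at hg
        simpa using fun h => hg a b h
    | cons a V =>
      rw [if_neg (by simp), Finset.sum_eq_zero]
      exact fun g _ => if_neg fun h => by simpa using h a (by simp)
  | cons v S V ih =>
    have hv : v ∉ (S ++ V).toFinset := by
      simp only [List.cons_append, List.nodup_cons] at hSV
      simpa using hSV.1
    have hSV' : (S ++ V).Nodup := (List.nodup_cons.1 hSV).2
    obtain ⟨hS, hV, hdisj⟩ := List.nodup_append'.1 hSV'
    have hW : ∀ a, a ∈ (S ++ V).toFinset ↔ a ∈ S ∨ a ∈ V := by simp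
    rw [rootedSum_cons, List.cons_append, List.toFinset_cons, sum_graphOn_insert hv,
      splitSum_eq_sum_powerset hV]
    have h1 : ∀ J ∈ V.toFinset.powerset,
        ((V.filter (· ∈ J)).map (ζ v)).prod *
          rootedSum ζ (S ++ V.filter (· ∈ J)) (V.filter (· ∉ J)) =
        (∏ n ∈ J, ζ v n) * ∑ g ∈ graphsOn (S ++ V).toFinset,
          if ∀ u ∈ V, u ∉ J → ∃ s, (s ∈ S ∨ (s ∈ V ∧ s ∈ J)) ∧ g.Reachable u s then
            graphWeight ζ g else 0 := by
      intro J hJ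
      have hJV := Finset.mem_powerset.1 hJ
      have hp : (V.filter (· ∈ J) ++ V.filter (· ∉ J)).Perm V := by
        simpa using List.filter_append_perm (fun a => decide (a ∈ J)) V
      rw [ih _ _ hp ?_]
      · congr 1
        · rw [← List.prod_toFinset _ (hV.filter _)]
          refine Finset.prod_congr ?_ fun _ _ => rfl
          ext a
          simp only [List.mem_toFinset, List.mem_filter, decide_eq_true_eq, and_iff_right_iff_imp]
          exact fun ha => List.mem_toFinset.1 (hJV ha)
        · rw [List.append_assoc, List.toFinset_eq_of_perm _ _ (hp.append_left S)]
          refine Finset.sum_congr rfl fun g _ => ?_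
          congr 1
          simp [Linked]
      · rw [List.append_assoc]
        exact (hp.append_left S).nodup_iff.2 hSV'
    rw [Finset.sum_congr rfl h1, ← List.prod_toFinset _ hS, Finset.prod_one_add,
      Finset.sum_mul_sum, ← Finset.sum_product']
    symm
    have hinj : ∀ N ∈ (S ++ V).toFinset.powerset,
        N ∩ S.toFinset ∪ N ∩ V.toFinset = N := by
      intro N hN
      rw [← Finset.inter_union_distrib_left, ← List.toFinset_append]
      exact Finset.inter_eq_left.2 (Finset.mem_powerset.1 hN)
    -- Neighbours of `v` in `S` do not affect linkedness and sum to the product of `1 + ζ v s`;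
    -- neighbours in `V` are the set `J` of new roots.
    refine Finset.sum_nbij' (fun N => (N ∩ S.toFinset, N ∩ V.toFinset)) (fun p => p.1 ∪ p.2)
      ?_ ?_ hinj ?_ ?_
    · intro N _
      simp
    · rintro ⟨N, J⟩ h
      simp only [Finset.mem_product, Finset.mem_powerset] at h ⊢
      rw [List.toFinset_append]
      exact Finset.union_subset_union h.1 h.2
    · rintro ⟨N, J⟩ h
      simp only [Finset.mem_product, Finset.mem_powerset] at h
      have hd : Disjoint S.toFinset V.toFinset := by
        rw [Finset.disjoint_left]
        intro a ha hb
        exact hdisj (by simpa using ha) (by simpa using hb)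
      ext1
      · ext a
        have h1 : a ∈ N → a ∈ S.toFinset := fun h' => Finset.mem_of_subset h.1 h'
        have h2 : a ∈ J → a ∈ V.toFinset := fun h' => Finset.mem_of_subset h.2 h'
        have h3 : a ∈ S.toFinset → a ∉ V.toFinset := fun h' => Finset.disjoint_left.1 hd h'
        simp only [Finset.mem_inter, Finset.mem_union]
        tauto
      · ext a
        have h1 : a ∈ N → a ∈ S.toFinset := fun h' => Finset.mem_of_subset h.1 h'
        have h2 : a ∈ J → a ∈ V.toFinset := fun h' => Finset.mem_of_subset h.2 h'
        have h3 : a ∈ S.toFinset → a ∉ V.toFinset := fun h' => Finset.disjoint_left.1 hd h'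
        simp only [Finset.mem_inter, Finset.mem_union]
        tauto
    · intro N hN
      have hNW := Finset.mem_powerset.1 hN
      rw [← mul_assoc, ← Finset.prod_union, hinj N hN, Finset.mul_sum]
      · refine Finset.sum_congr rfl fun g hg => ?_
        have hg' : GraphOn (S ++ V).toFinset g := mem_graphsOn.1 hg
        rw [graphWeight_sup_star hζ hg' hv hNW, mul_ite, mul_zero]
        refine if_congr (Iff.symm ?_) rfl rfl
        rw [linked_sup_star_iff hg' hv hNW hW]
        refine forall₂_congr fun u hu => ?_
        simp only [hu, Finset.mem_inter, List.mem_toFinset, and_true]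
        refine imp_congr_right fun _ => exists_congr fun s => and_congr_left fun _ => ?_
        tauto
      · rw [Finset.disjoint_left]
        intro a ha hb
        exact hdisj (List.mem_toFinset.1 (Finset.mem_inter.1 ha).2)
          (List.mem_toFinset.1 (Finset.mem_inter.1 hb).2)

end Graphs

/-! ### The coefficients `phi` as rooted sums -/

section Phi

/-- Two polymers are incompatible if their supports intersect. -/
def Overlap {α σ : Type*} [DecidableEq σ] (supp : α → Finset σ) (a b : α) : Prop :=
  (supp a ∩ supp b).Nonempty

open QLattice

theorem phi_eq_rootedSum {d : ℕ} {Λ : Finset (Site d)} {k : ℕ} (C : Fin (k + 1) → Cluster Λ) :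
    phi C = rootedSum (hardCore (Overlap Cluster.supp)) [C 0] (List.ofFn fun i : Fin k => C i.succ) := by
  classical
  have h : List.ofFn (fun i : Fin k => C i.succ) = (List.ofFn fun i : Fin k => i.succ).map C := by
    rw [List.map_ofFn]; rfl
  -- The clusters may repeat, so the sum is pulled back to the indices, which are distinct.
  -- Connectedness then means that every index is linked to the root 0.
  rw [h, ← List.map_singleton, rootedSum_map, rootedSum_eq_sum_graphs]
  · have huniv : ([0] ++ List.ofFn fun i : Fin k => i.succ).toFinset = Finset.univ := by
      ext i
      refine Fin.cases ?_ (fun j => ?_) i <;> simp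
    rw [huniv, ← Finset.sum_filter]
    unfold phi
    refine Finset.sum_congr ?_ fun g _ => ?_
    · ext g
      simp only [Finset.mem_filter, mem_graphsOn, Finset.mem_univ, true_and, GraphOn, implies_true]
      constructor
      · exact fun hg u _ => ⟨0, by simp, hg.preconnected _ _⟩
      · intro hg
        have h0 : ∀ i, g.Reachable i 0 := by
          intro i
          refine Fin.cases (SimpleGraph.Reachable.refl _) (fun j => ?_) i
          simpa using hg j.succ (by simp)
        exact ⟨fun i j => (h0 i).trans (h0 j).symm⟩
    · unfold graphWeight
      refine Finset.prod_congr ?_ fun e _ => ?_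
      · ext e; simp
      · unfold hardCore Overlap
        congr
  · intro a b
    unfold hardCore Overlap
    rw [Finset.inter_comm]
  · simp only [List.singleton_append, List.nodup_cons, List.mem_ofFn', Set.mem_range, not_exists]
    exact ⟨fun j => Fin.succ_ne_zero j, List.nodup_ofFn.2 (Fin.succ_injective k)⟩

end Phi

/-! ### Exploring connected sequences site by site -/

section Spanned

variable {α σ : Type*} [DecidableEq σ]

/-- The union of the supports of the entries of a list. -/
def listSupp (supp : α → Finset σ) : List α → Finset σ
  | [] => ∅
  | a :: l => supp a ∪ listSupp supp l

/-- Every entry of `l` has nonempty support and is connected to `Y` through entries of `l`: a set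
that contains `Y` and is not crossed by any entry contains all of them. -/
def Spanned (supp : α → Finset σ) (Y : Finset σ) (l : List α) : Prop :=
  (∀ a ∈ l, (supp a).Nonempty) ∧
    ∀ U : Finset σ, Y ⊆ U → (∀ a ∈ l, supp a ⊆ U ∨ Disjoint (supp a) U) → ∀ a ∈ l, supp a ⊆ U

variable {supp : α → Finset σ}

theorem mem_listSupp {l : List α} {y : σ} : y ∈ listSupp supp l ↔ ∃ a ∈ l, y ∈ supp a := by
  induction l with
  | nil => simp [listSupp]
  | cons a l ih => simp [listSupp, ih]

theorem subset_listSupp {l : List α} {a : α} (ha : a ∈ l) : supp a ⊆ listSupp supp l :=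
  fun _ hy => mem_listSupp.2 ⟨a, ha, hy⟩

theorem listSupp_subset_iff {l : List α} {U : Finset σ} :
    listSupp supp l ⊆ U ↔ ∀ a ∈ l, supp a ⊆ U := by
  refine ⟨fun h a ha => (subset_listSupp ha).trans h, fun h y hy => ?_⟩
  obtain ⟨a, ha, hya⟩ := mem_listSupp.1 hy
  exact h a ha hya

omit [DecidableEq σ] in
theorem Spanned.eq_nil {l : List α} (h : Spanned supp ∅ l) : l = [] := by
  rw [List.eq_nil_iff_forall_not_mem]
  intro a ha
  exact (h.1 a ha).ne_empty (Finset.subset_empty.1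
    (h.2 ∅ le_rfl (fun b _ => Or.inr (Finset.disjoint_empty_right _)) a ha))

theorem Spanned.mem_listSupp {l : List α} {x : σ} (h : Spanned supp {x} l) (hl : l ≠ []) :
    x ∈ listSupp supp l := by
  by_contra hx
  have hx' : ∀ a ∈ l, x ∉ supp a := fun a ha hxa => hx (subset_listSupp ha hxa)
  obtain ⟨a, ha⟩ := List.exists_mem_of_ne_nil l hl
  have h1 := h.2 {x} le_rfl (fun b hb => Or.inr (Finset.disjoint_singleton_right.2 (hx' b hb))) a ha
  obtain ⟨y, hy⟩ := h.1 a ha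
  exact hx' a ha (Finset.mem_singleton.1 (h1 hy) ▸ hy)

/-- One exploration step: once the entries `B` at `x` are revealed, `x` is finished and the sites of
`B` are added to those to explore. If `A` does not cross `U`, then `l` does not cross `insert x U`;
entries of `A` avoid `x`, so they land in `U` itself. -/
theorem Spanned.explore {Y : Finset σ} {x : σ} {l A B : List α} (h : Spanned supp Y l)
    (hl : (B ++ A).Perm l) (hA : ∀ a ∈ A, x ∉ supp a) :
    Spanned supp ((Y ∪ listSupp supp B).erase x) A := by
  have hmem : ∀ a, a ∈ l ↔ a ∈ B ∨ a ∈ A := fun a => by rw [← hl.mem_iff, List.mem_append]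
  refine ⟨fun a ha => h.1 a ((hmem a).2 (Or.inr ha)), fun U hYU hU a ha => ?_⟩
  have hsub : Y ∪ listSupp supp B ⊆ insert x U := by
    rw [Finset.subset_insert_iff]
    exact hYU
  have h1 := h.2 (insert x U) (Finset.subset_union_left.trans hsub) ?_ a ((hmem a).2 (Or.inr ha))
  · exact (Finset.subset_insert_iff_of_notMem (hA a ha)).1 h1
  · intro b hb
    rcases (hmem b).1 hb with hb | hb
    · exact Or.inl (((subset_listSupp hb).trans Finset.subset_union_right).trans hsub)
    · refine (hU b hb).imp (fun h => h.trans (Finset.subset_insert _ _)) fun h => ?_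
      rw [Finset.disjoint_insert_right]
      exact ⟨hA b hb, h⟩

theorem pow_card_erase_listSupp_le {c : ℝ} (hc : 1 ≤ c) (x : σ) (B : List α) :
    c ^ ((listSupp supp B).erase x).card ≤ (B.map fun b => c ^ ((supp b).erase x).card).prod := by
  have hc0 : 0 ≤ c := zero_le_one.trans hc
  induction B with
  | nil => simp [listSupp]
  | cons b B ih =>
    rw [listSupp, Finset.erase_union_distrib, List.map_cons, List.prod_cons]
    calc _ ≤ c ^ (((supp b).erase x).card + ((listSupp supp B).erase x).card) :=
          pow_le_pow_right₀ hc (Finset.card_union_le _ _)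
      _ ≤ _ := by rw [pow_add]; gcongr

theorem prod_map_nonneg {w : α → ℝ} (hw : ∀ a, 0 ≤ w a) (l : List α) : 0 ≤ (l.map w).prod :=
  List.prod_nonneg fun x hx => by
    obtain ⟨c, _, rfl⟩ := List.mem_map.1 hx
    exact hw c

omit [DecidableEq σ] in
open scoped Classical in
theorem sum_spanned_empty_le (F : Finset α) (u : α → ℝ) (K : ℕ) :
    ∑ m ∈ Finset.range K, (m ! : ℝ)⁻¹ *
      listSum F m (fun l => if Spanned supp ∅ l then (l.map u).prod else 0) ≤ 1 := by
  cases K with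
  | zero => simp
  | succ K =>
    rw [Finset.sum_range_succ', Finset.sum_eq_zero]
    · simp [listSum, Spanned]
    · intro m _
      rw [listSum_congr (g := fun _ => 0) fun l hl _ => if_neg fun h => by simp [h.eq_nil] at hl]
      simp [listSum_zero]

open scoped Classical in
/-- The sum over the sequences spanned by `Y`. -/
theorem sum_spanned_le {u : α → ℝ} (hu : ∀ c, 0 ≤ u c) {a : ℝ} (ha : 0 ≤ a) (A : Finset σ)
    (F : Finset α) (hFA : ∀ c ∈ F, supp c ⊆ A)
    (hF : ∀ x, ∑ c ∈ F with x ∈ supp c, u c * (1 + a) ^ (supp c).card ≤ a) (K : ℕ)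
    (Y : Finset σ) (hY : Y ⊆ A) :
    ∑ m ∈ Finset.range K, (m ! : ℝ)⁻¹ *
      listSum F m (fun l => if Spanned supp Y l then (l.map u).prod else 0) ≤
        (1 + a) ^ Y.card := by
  induction h : A.card generalizing A F K Y with
  | zero =>
    obtain rfl : Y = ∅ := Finset.subset_empty.1 (Finset.card_eq_zero.1 h ▸ hY)
    exact (sum_spanned_empty_le F u K).trans (by simp)
  | succ n ih =>
  rcases Y.eq_empty_or_nonempty with rfl | ⟨x, hx⟩
  · exact (sum_spanned_empty_le F u K).trans (by simp)
  have h1a : 1 ≤ 1 + a := by linarith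
  set F' := F.filter (fun c => x ∉ supp c) with hF'
  -- Only the splitting into the entries that contain `x` and those that do not survives. The
  -- entries of `R` live on `A.erase x`, which drives the induction on the volume.
  set H : List α → List α → ℝ := fun B R =>
    if (∀ b ∈ B, x ∈ supp b) ∧ (∀ r ∈ R, ¬ x ∈ supp r) then
      (B.map u).prod * (if Spanned supp ((Y ∪ listSupp supp B).erase x) R then (R.map u).prod
        else 0) else 0 with hH
  have hH0 : ∀ l : List α, (if Spanned supp Y l then (l.map u).prod else 0) ≤ splitSum l H := by
    intro l
    rw [hH, splitSum_filter (fun c => x ∈ supp c) l]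
    have hperm : (l.filter (fun c => x ∈ supp c) ++ l.filter (fun c => ¬ x ∈ supp c)).Perm l := by
      simpa using List.filter_append_perm (fun c => decide (x ∈ supp c)) l
    split_ifs with h1 h2
    · rw [← List.prod_append, ← List.map_append, (hperm.map u).prod_eq]
    · exact absurd (h1.explore hperm (by simp)) h2
    · exact mul_nonneg (prod_map_nonneg hu _) (prod_map_nonneg hu _)
    · simp
  -- The site `x` needs no further exploration, so one power of `1 + a` is saved and the total of
  -- `g` is at most `a / (1 + a)`.
  set g : α → ℝ := fun c => if x ∈ supp c then u c * (1 + a) ^ ((supp c).erase x).card else 0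
    with hg
  have hg0 : ∀ c, 0 ≤ g c := fun c => by
    rw [hg]; dsimp only; split_ifs
    · exact mul_nonneg (hu c) (by positivity)
    · exact le_rfl
  have hgsum : ∑ c ∈ F, g c ≤ a / (1 + a) := by
    rw [le_div_iff₀ (by linarith), Finset.sum_mul]
    refine le_trans (le_of_eq ?_) (hF x)
    rw [Finset.sum_filter]
    refine Finset.sum_congr rfl fun c _ => ?_
    rw [hg]; dsimp only; split_ifs with hc
    · rw [mul_assoc, ← pow_succ, Finset.card_erase_add_one hc]
    · simp
  have hinner : ∀ (i : ℕ) (B : List α), (∀ b ∈ B, b ∈ F) →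
      ∑ j ∈ Finset.range (K - i), (j ! : ℝ)⁻¹ * listSum F j (fun R => H B R) ≤
        (B.map g).prod * (1 + a) ^ (Y.erase x).card := by
    intro i B hBF
    by_cases hB : ∀ b ∈ B, x ∈ supp b
    · have h2 := ih (A.erase x) F'
        (fun c hc => Finset.subset_erase.2
          ⟨hFA c (Finset.mem_filter.1 hc).1, (Finset.mem_filter.1 hc).2⟩)
        (fun y => (Finset.sum_le_sum_of_subset_of_nonneg
          (Finset.filter_subset_filter _ (Finset.filter_subset _ _))
          fun c _ _ => mul_nonneg (hu c) (by positivity)).trans (hF y)) (K - i)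
        ((Y ∪ listSupp supp B).erase x)
        (Finset.erase_subset_erase _ (Finset.union_subset hY
          (listSupp_subset_iff.2 fun b hb => hFA b (hBF b hb))))
        (by rw [Finset.card_erase_of_mem (hY hx), h]; rfl)
      have h4 : ∀ j, listSum F j (fun R => H B R) = (B.map u).prod * listSum F' j (fun R =>
          if Spanned supp ((Y ∪ listSupp supp B).erase x) R then (R.map u).prod else 0) := by
        intro j
        rw [hF', listSum_filter, ← listSum_mul_left]
        refine listSum_congr fun R _ _ => ?_
        rw [hH]
        dsimp only
        by_cases hR : ∀ r ∈ R, x ∉ supp r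
        · rw [if_pos ⟨hB, hR⟩, if_pos hR]
        · rw [if_neg fun h => hR h.2, if_neg hR, mul_zero]
      simp only [h4, mul_left_comm _ (B.map u).prod, ← Finset.mul_sum]
      refine (mul_le_mul_of_nonneg_left h2 (prod_map_nonneg hu B)).trans ?_
      have h5 : (B.map g).prod =
          (B.map u).prod * (B.map fun b => (1 + a) ^ ((supp b).erase x).card).prod := by
        rw [← List.prod_map_mul]
        refine congrArg _ (List.map_congr_left fun b hb => ?_)
        rw [hg]; simp [hB b hb]
      rw [h5, mul_assoc]
      refine mul_le_mul_of_nonneg_left ?_ (prod_map_nonneg hu B)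
      rw [Finset.erase_union_distrib]
      calc _ ≤ (1 + a) ^ (((listSupp supp B).erase x).card + (Y.erase x).card) :=
            pow_le_pow_right₀ h1a ((Finset.card_union_le _ _).trans_eq (add_comm _ _))
        _ ≤ _ := by
            rw [pow_add]
            gcongr
            exact pow_card_erase_listSupp_le h1a x B
    · simp only [hH, hB, false_and, if_false, listSum_zero, mul_zero, Finset.sum_const_zero]
      exact mul_nonneg (prod_map_nonneg hg0 B) (by positivity)
  calc _ ≤ ∑ m ∈ Finset.range K, (m ! : ℝ)⁻¹ * listSum F m (fun l => splitSum l H) := by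
        gcongr
        exact listSum_le_listSum fun l _ _ => hH0 l
    _ = ∑ i ∈ Finset.range K, (i ! : ℝ)⁻¹ * listSum F i (fun B =>
          ∑ j ∈ Finset.range (K - i), (j ! : ℝ)⁻¹ * listSum F j (fun R => H B R)) :=
        sum_range_listSum_splitSum F K H
    _ ≤ ∑ i ∈ Finset.range K, (i ! : ℝ)⁻¹ * listSum F i (fun B =>
          (B.map g).prod * (1 + a) ^ (Y.erase x).card) := by
        gcongr with i _
        exact listSum_le_listSum fun B _ hB => hinner i B hB
    _ = (∑ i ∈ Finset.range K, (∑ c ∈ F, g c) ^ i / (i ! : ℝ)) * (1 + a) ^ (Y.erase x).card := by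
        rw [Finset.sum_mul]
        refine Finset.sum_congr rfl fun i _ => ?_
        rw [listSum_mul_right, listSum_prod]
        ring
    _ ≤ (1 + a) * (1 + a) ^ (Y.erase x).card := by
        gcongr
        refine (Real.sum_le_exp_of_nonneg (Finset.sum_nonneg fun c _ => hg0 c) K).trans ?_
        -- From $1-\frac a{1+a}=\frac1{1+a}$ and $1+y\le e^y$; hence $e^{a/(1+a)}\le 1+a$, which
        -- restores the saved power.
        have h3 : (1 + a)⁻¹ ≤ Real.exp (-(a / (1 + a))) := by
          refine le_trans (le_of_eq ?_) (Real.add_one_le_exp _)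
          field_simp
          ring
        rw [Real.exp_neg] at h3
        exact (Real.exp_le_exp.2 hgsum).trans
          ((inv_le_inv₀ (by linarith) (Real.exp_pos _)).1 h3)
    _ = (1 + a) ^ Y.card := by
        rw [← pow_succ', Finset.card_erase_add_one hx]

end Spanned
-- The recursion over sites
section SiteRecursion

variable {α σ : Type*} [DecidableEq σ] {supp : α → Finset σ}

/-- A set that is not crossed by the entries of a list, and is minimal among those that contain
a given point. -/
theorem exists_component {l : List α} {x : σ} (hx : x ∈ listSupp supp l) :
    ∃ U : Finset σ, x ∈ U ∧ (∀ a ∈ l, supp a ⊆ U ∨ Disjoint (supp a) U) ∧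
      ∀ U' : Finset σ, x ∈ U' → (∀ a ∈ l, supp a ⊆ U' ∨ Disjoint (supp a) U') → U ⊆ U' := by
  classical
  refine ⟨(listSupp supp l).filter fun y => ∀ U' : Finset σ, x ∈ U' →
    (∀ a ∈ l, supp a ⊆ U' ∨ Disjoint (supp a) U') → y ∈ U', ?_, ?_, ?_⟩
  · exact Finset.mem_filter.2 ⟨hx, fun U' h _ => h⟩
  · intro a ha
    rw [or_iff_not_imp_right, Finset.not_disjoint_iff]
    rintro ⟨y, hya, hy⟩ z hz
    refine Finset.mem_filter.2 ⟨subset_listSupp ha hz, fun U' h1 h2 => ?_⟩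
    have hyU := (Finset.mem_filter.1 hy).2 U' h1 h2
    exact ((h2 a ha).resolve_right fun h => Finset.disjoint_left.1 h hya hyU) hz
  · exact fun U' h1 h2 y hy => (Finset.mem_filter.1 hy).2 U' h1 h2

/-- A function of lists that is multiplicative over lists with disjoint supports. -/
structure Factorizes {R : Type*} [Semiring R] (supp : α → Finset σ) (t : List α → R) : Prop where
  nil : t [] = 1
  cons : ∀ a l, supp a = ∅ → t (a :: l) = t [a] * t l
  filter : ∀ (p : α → Prop) [DecidablePred p] (l : List α),
    (∀ a ∈ l, ∀ b ∈ l, p a → ¬ p b → Disjoint (supp a) (supp b)) →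
      t l = t (l.filter p) * t (l.filter fun a => ¬ p a)

-- If some entry contains `x`, exactly one splitting survives: `A` collects the entries in the
-- component of `x` and `B` all others.
open scoped Classical in
theorem Factorizes.eq_add_splitSum {R : Type*} [Semiring R] {t : List α → R}
    (ht : Factorizes supp t) (x : σ) (l : List α) :
    t l = (if ∀ a ∈ l, x ∉ supp a then t l else 0) +
      splitSum l (fun A B => if (A ≠ [] ∧ Spanned supp {x} A) ∧
        ∀ b ∈ B, Disjoint (supp b) (listSupp supp A) then t A * t B else 0) := by
  by_cases hx : x ∈ listSupp supp l
  · have hx' : ¬ ∀ a ∈ l, x ∉ supp a := fun h => by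
      obtain ⟨a, ha, hxa⟩ := mem_listSupp.1 hx
      exact h a ha hxa
    obtain ⟨U, hxU, hU, hmin⟩ := exists_component hx
    set p : α → Prop := fun a => ¬ Disjoint (supp a) U with hp
    have hpU : ∀ a ∈ l, p a → supp a ⊆ U := fun a ha hpa => (hU a ha).resolve_right hpa
    rw [if_neg hx', zero_add]
    have key : ∀ A B : List α, (A ++ B).Perm l →
        (((A ≠ [] ∧ Spanned supp {x} A) ∧ ∀ b ∈ B, Disjoint (supp b) (listSupp supp A)) ↔
          (∀ a ∈ A, p a) ∧ ∀ b ∈ B, ¬ p b) := by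
      intro A B hAB
      have hmem : ∀ a, a ∈ l ↔ a ∈ A ∨ a ∈ B := fun a => by rw [← hAB.mem_iff, List.mem_append]
      constructor
      · rintro ⟨⟨hA, hsp⟩, hB⟩
        have h1 : U ⊆ listSupp supp A := hmin _ (hsp.mem_listSupp hA) fun a ha =>
          ((hmem a).1 ha).imp (fun h => subset_listSupp h) fun h => hB a h
        have h2 := hsp.2 U (Finset.singleton_subset_iff.2 hxU)
          fun a ha => hU a ((hmem a).2 (Or.inl ha))
        refine ⟨fun a ha hd => ?_, fun b hb hpb => hpb ((hB b hb).mono_right h1)⟩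
        obtain ⟨y, hy⟩ := hsp.1 a ha
        exact Finset.disjoint_left.1 hd hy (h2 a ha hy)
      · rintro ⟨hA, hB⟩
        have hAU : ∀ a ∈ A, supp a ⊆ U := fun a ha => hpU a ((hmem a).2 (Or.inl ha)) (hA a ha)
        have hB' : ∀ b ∈ B, Disjoint (supp b) U := fun b hb => not_not.1 (hB b hb)
        refine ⟨⟨?_, ?_, ?_⟩, fun b hb => (hB' b hb).mono_right (listSupp_subset_iff.2 hAU)⟩
        · rintro rfl
          obtain ⟨a, ha, hxa⟩ := mem_listSupp.1 hx
          exact Finset.disjoint_left.1 (hB' a (((hmem a).1 ha).resolve_left (by simp))) hxa hxU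
        · intro a ha
          rw [Finset.nonempty_iff_ne_empty]
          intro h0
          exact hA a ha (by rw [h0]; exact Finset.disjoint_empty_left _)
        · intro U' hxU' hU' a ha
          -- `U' ∩ U` contains `x` and is crossed by no entry of the whole list, so the minimality
          -- of `U` applies.
          have h3 : U ⊆ U' ∩ U := by
            refine hmin _ (Finset.mem_inter.2 ⟨Finset.singleton_subset_iff.1 hxU', hxU⟩) ?_
            intro b hb
            rcases (hmem b).1 hb with hb | hb
            · exact (hU' b hb).imp (fun h => Finset.subset_inter h (hAU b hb))
                fun h => h.mono_right Finset.inter_subset_left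
            · exact Or.inr ((hB' b hb).mono_right Finset.inter_subset_right)
          exact (hAU a ha).trans (h3.trans Finset.inter_subset_left)
    rw [splitSum_congr (H' := fun A B => if (∀ a ∈ A, p a) ∧ (∀ b ∈ B, ¬ p b) then t A * t B else 0)
      fun A B hAB => if_congr (key A B hAB) rfl rfl, splitSum_filter]
    refine ht.filter p l fun a ha b hb hpa hpb => ?_
    exact ((not_not.1 hpb).mono_right (hpU a ha hpa)).symm
  · have hx' : ∀ a ∈ l, x ∉ supp a := fun a ha hxa => hx (mem_listSupp.2 ⟨a, ha, hxa⟩)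
    rw [if_pos hx', splitSum_congr (H' := fun _ _ => 0), splitSum_zero, add_zero]
    intro A B hAB
    refine if_neg fun h => hx ?_
    obtain ⟨a, ha, hxa⟩ := ClusterExpansion.mem_listSupp.1 (h.1.2.mem_listSupp h.1.1)
    exact mem_listSupp.2 ⟨a, hAB.mem_iff.1 (List.mem_append_left _ ha), hxa⟩

/-- The exponential generating sum of `t` over all lists of elements supported in `A`. -/
noncomputable def expSum (supp : α → Finset σ) (F : Finset α) (t : List α → ℂ) (A : Finset σ) : ℂ :=
  ∑' n : ℕ, (n ! : ℂ)⁻¹ * listSum (F.filter fun a => supp a ⊆ A) n t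

open scoped Classical in
/-- The total weight of the sequences of support `U` spanned by `x`. -/
noncomputable def spannedSum (supp : α → Finset σ) (F : Finset α) (t : List α → ℂ) (x : σ)
    (U : Finset σ) : ℂ :=
  ∑' n : ℕ, (n ! : ℂ)⁻¹ * listSum F n
    (fun l => if (l ≠ [] ∧ Spanned supp {x} l) ∧ listSupp supp l = U then t l else 0)

omit [DecidableEq σ] in
theorem norm_listSum_div_factorial_le {F : Finset α} {t : List α → ℂ} {w : α → ℝ}
    (h : ∀ l : List α, (∀ a ∈ l, a ∈ F) → ‖t l‖ ≤ (l.map w).prod) (n : ℕ) :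
    ‖(n ! : ℂ)⁻¹ * listSum F n t‖ ≤ (∑ a ∈ F, w a) ^ n / (n ! : ℝ) := by
  rw [norm_mul, norm_inv, Complex.norm_natCast, div_eq_inv_mul]
  gcongr
  refine (norm_listSum_le F n t).trans ?_
  rw [← listSum_prod]
  exact listSum_le_listSum fun l _ hl => h l hl

omit [DecidableEq σ] in
theorem summable_norm_listSum {F : Finset α} {t : List α → ℂ} {w : α → ℝ}
    (h : ∀ l : List α, (∀ a ∈ l, a ∈ F) → ‖t l‖ ≤ (l.map w).prod) :
    Summable fun n : ℕ => ‖(n ! : ℂ)⁻¹ * listSum F n t‖ :=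
  Summable.of_nonneg_of_le (fun _ => norm_nonneg _) (norm_listSum_div_factorial_le h)
    (Real.summable_pow_div_factorial _)

/-- The component of `x` and the remaining entries are chosen independently once the support `U` of
the component is fixed, since the remaining entries need only lie in `A \ U`. The bound `w` supplies
the absolute convergence needed for the Cauchy products. -/
theorem Factorizes.expSum_eq {F : Finset α} {t : List α → ℂ} (ht : Factorizes supp t) {w : α → ℝ}
    (hw : ∀ a, 0 ≤ w a) (h : ∀ l : List α, (∀ a ∈ l, a ∈ F) → ‖t l‖ ≤ (l.map w).prod)
    (A : Finset σ) (x : σ) :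
    expSum supp F t A = expSum supp F t (A.erase x) +
      ∑ U ∈ A.powerset with x ∈ U, spannedSum supp F t x U * expSum supp F t (A \ U) := by
  classical
  have hsum1 : ∀ A : Finset σ, Summable fun n : ℕ =>
      ‖(n ! : ℂ)⁻¹ * listSum (F.filter fun a => supp a ⊆ A) n t‖ := fun A =>
    summable_norm_listSum fun l hl => h l fun a ha => (Finset.mem_filter.1 (hl a ha)).1
  have hsum2 : ∀ U : Finset σ, Summable fun n : ℕ => ‖(n ! : ℂ)⁻¹ * listSum F n
      (fun l => if (l ≠ [] ∧ Spanned supp {x} l) ∧ listSupp supp l = U then t l else 0)‖ := by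
    refine fun U => summable_norm_listSum (w := w) fun l hl => ?_
    split_ifs
    · exact h l hl
    · simpa using prod_map_nonneg hw l
  have hterm : ∀ n : ℕ, (n ! : ℂ)⁻¹ * listSum (F.filter fun a => supp a ⊆ A) n t =
      (n ! : ℂ)⁻¹ * listSum (F.filter fun a => supp a ⊆ A.erase x) n t +
      ∑ U ∈ A.powerset with x ∈ U, ∑ ij ∈ Finset.HasAntidiagonal.antidiagonal n,
        ((ij.1 ! : ℂ)⁻¹ * listSum F ij.1
          (fun l => if (l ≠ [] ∧ Spanned supp {x} l) ∧ listSupp supp l = U then t l else 0)) *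
        ((ij.2 ! : ℂ)⁻¹ * listSum (F.filter fun a => supp a ⊆ A \ U) ij.2 t) := by
    intro n
    rw [listSum_congr fun l _ _ => ht.eq_add_splitSum x l, listSum_add, mul_add,
      listSum_splitSum_div_factorial]
    congr 2
    · rw [← listSum_filter, Finset.filter_filter]
      congr 1
      ext a
      simp [Finset.subset_erase]
    · rw [Finset.sum_comm]
      refine Finset.sum_congr rfl fun ij _ => ?_
      have hF : ∀ U ∈ A.powerset.filter (x ∈ ·), listSum F ij.1
          (fun l => if (l ≠ [] ∧ Spanned supp {x} l) ∧ listSupp supp l = U then t l else 0) =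
          listSum (F.filter fun a => supp a ⊆ A) ij.1
          (fun l => if (l ≠ [] ∧ Spanned supp {x} l) ∧ listSupp supp l = U then t l else 0) := by
        intro U hU
        rw [listSum_filter]
        refine listSum_congr fun l _ _ => ?_
        by_cases hl : ∀ a ∈ l, supp a ⊆ A
        · rw [if_pos hl]
        · rw [if_neg hl]
          refine if_neg fun hc => hl (listSupp_subset_iff.1 ?_)
          rw [hc.2]
          exact Finset.mem_powerset.1 (Finset.mem_filter.1 hU).1
      rw [Finset.sum_congr rfl fun U hU => by rw [hF U hU]]
      simp only [mul_assoc, ← Finset.mul_sum]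
      congr 1
      simp only [← listSum_mul_right, ← listSum_sum]
      refine listSum_congr fun l _ hl => ?_
      by_cases hc : l ≠ [] ∧ Spanned supp {x} l
      · have hlA : listSupp supp l ⊆ A :=
          listSupp_subset_iff.2 fun a ha => (Finset.mem_filter.1 (hl a ha)).2
        -- The sum over `U` only records the support of the component.
        rw [Finset.sum_eq_single (listSupp supp l)]
        · simp only [hc, true_and, if_true, ne_eq, not_false_eq_true, and_self]
          rw [mul_left_comm]
          congr 1
          rw [← listSum_mul_left, listSum_filter, listSum_filter]
          refine listSum_congr fun B _ _ => ?_
          by_cases hB : ∀ b ∈ B, supp b ⊆ A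
          · rw [if_pos hB]
            refine if_congr ?_ rfl rfl
            refine forall₂_congr fun b hb => ?_
            rw [Finset.subset_sdiff]
            simp [hB b hb]
          · rw [if_neg hB, if_neg]
            exact fun hB' => hB fun b hb => (hB' b hb).trans Finset.sdiff_subset
        · intro U _ hU
          rw [if_neg fun h => hU h.2.symm, zero_mul]
        · intro hn
          exact absurd (Finset.mem_filter.2 ⟨Finset.mem_powerset.2 hlA, hc.2.mem_listSupp hc.1⟩) hn
      · simp [hc, listSum_zero]
  unfold expSum spannedSum
  rw [tsum_congr hterm, Summable.tsum_add (hsum1 _).of_norm]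
  · congr 1
    rw [Summable.tsum_finsetSum]
    · refine Finset.sum_congr rfl fun U _ => ?_
      rw [tsum_mul_tsum_eq_tsum_sum_antidiagonal_of_summable_norm (hsum2 U) (hsum1 _)]
    · intro U _
      exact (summable_norm_sum_mul_antidiagonal_of_summable_norm (hsum2 U) (hsum1 _)).of_norm
  · refine summable_sum fun U _ => ?_
    exact (summable_norm_sum_mul_antidiagonal_of_summable_norm (hsum2 U) (hsum1 _)).of_norm

/-- Entries with empty support are invisible to the recursion; they factor out one by one and
exponentiate. This is the starting value. -/
theorem Factorizes.expSum_empty {F : Finset α} {t : List α → ℂ} (ht : Factorizes supp t) :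
    expSum supp F t ∅ = Complex.exp (∑ a ∈ F with supp a = ∅, t [a]) := by
  rw [Complex.exp_eq_exp_ℂ, NormedSpace.exp_eq_tsum_div, expSum]
  refine tsum_congr fun n => ?_
  rw [div_eq_inv_mul, ← listSum_prod]
  simp only [Finset.subset_empty]
  congr 1
  refine listSum_congr fun l hn hl => ?_
  clear hn
  induction l with
  | nil => simp [ht.nil]
  | cons a l ih =>
    rw [ht.cons a l (Finset.mem_filter.1 (hl a (by simp))).2, List.map_cons, List.prod_cons,
      ih fun b hb => hl b (List.mem_cons_of_mem _ hb)]

/-- Families that satisfy the same recursion over sites have the same limit. -/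
theorem tendsto_of_site_recursion {ι : Type*} {L : Filter ι} {Z : Finset σ → ℂ}
    {X : ι → Finset σ → ℂ} {ω : σ → Finset σ → ℂ} {ω' : ι → σ → Finset σ → ℂ}
    (hZ : ∀ A, ∀ x ∈ A, Z A = Z (A.erase x) + ∑ U ∈ A.powerset with x ∈ U, ω x U * Z (A \ U))
    (hX : ∀ i A, ∀ x ∈ A, X i A = X i (A.erase x) +
      ∑ U ∈ A.powerset with x ∈ U, ω' i x U * X i (A \ U))
    (h0 : Tendsto (fun i => X i ∅) L (𝓝 (Z ∅)))
    (hω : ∀ x U, x ∈ U → Tendsto (fun i => ω' i x U) L (𝓝 (ω x U))) (A : Finset σ) :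
    Tendsto (fun i => X i A) L (𝓝 (Z A)) := by
  induction A using Finset.strongInduction with
  | H A ih =>
    rcases A.eq_empty_or_nonempty with rfl | ⟨x, hx⟩
    · exact h0
    · rw [hZ A x hx]
      simp only [hX _ A x hx]
      refine (ih _ (Finset.erase_ssubset hx)).add (tendsto_finsetSum _ fun U hU => ?_)
      have hxU := (Finset.mem_filter.1 hU).2
      refine (hω x U hxU).mul (ih _ ?_)
      rw [Finset.ssubset_iff_of_subset Finset.sdiff_subset]
      exact ⟨x, hx, fun h => (Finset.mem_sdiff.1 h).2 hxU⟩

end SiteRecursion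
-- Exponentials of power series with absolute convergence on the unit circle
section PowerSeries

theorem hasDerivAt_tsum_mul_pow {p : ℕ → ℂ} (hp : Summable fun n => ‖p n‖) {r : ℝ}
    (hr : |r| < 1) :
    HasDerivAt (fun r : ℝ => ∑' n, p n * (r : ℂ) ^ n)
      (∑' n, ((n + 1 : ℕ) * p (n + 1)) * (r : ℂ) ^ n) r := by
  -- Bounded coefficients make the differentiated series converge uniformly for arguments of modulus
  -- below `ρ`.
  obtain ⟨ρ, hrρ, hρ⟩ := exists_between hr
  have hρ0 : 0 < ρ := (abs_nonneg r).trans_lt hrρ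
  have hgeo : Summable fun n : ℕ => (n : ℝ) * ρ ^ (n - 1) := by
    have h1 := (hasSum_coe_mul_geometric_of_norm_lt_one (𝕜 := ℝ) (r := ρ)
      (by rwa [Real.norm_of_nonneg hρ0.le])).summable.mul_left ρ⁻¹
    refine h1.congr fun n => ?_
    cases n with
    | zero => simp
    | succ n =>
      rw [Nat.add_sub_cancel, pow_succ]
      field_simp
  have hu : Summable fun n : ℕ => (∑' m, ‖p m‖) * ((n : ℝ) * ρ ^ (n - 1)) := hgeo.mul_left _
  have hder : ∀ (n : ℕ) (y : ℝ), HasDerivAt (fun r : ℝ => p n * (r : ℂ) ^ n)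
      (p n * (n * (y : ℂ) ^ (n - 1))) y := by
    intro n y
    have := ((hasDerivAt_pow n (y : ℂ)).const_mul (p n)).comp_ofReal
    simpa using this
  have hbound : ∀ (n : ℕ), ∀ y ∈ Set.Ioo (-ρ) ρ, ‖p n * (n * (y : ℂ) ^ (n - 1))‖ ≤
      (∑' m, ‖p m‖) * ((n : ℝ) * ρ ^ (n - 1)) := by
    intro n y hy
    rw [norm_mul, norm_mul, norm_pow, Complex.norm_natCast, Complex.norm_real, Real.norm_eq_abs]
    have := abs_lt.2 hy
    gcongr
    exact hp.le_tsum n fun _ _ => norm_nonneg _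
  have h := hasDerivAt_tsum_of_isPreconnected hu isOpen_Ioo isPreconnected_Ioo
    (fun n y _ => hder n y) hbound (y₀ := 0) ⟨by linarith, hρ0⟩ ?_ (abs_lt.1 hrρ)
  · refine h.congr_deriv ?_
    rw [Summable.tsum_eq_zero_add (f := fun n : ℕ => p n * (n * (r : ℂ) ^ (n - 1)))]
    · simp only [Nat.cast_zero, zero_mul, mul_zero, zero_add, Nat.add_sub_cancel]
      exact tsum_congr fun n => by ring
    · exact Summable.of_norm_bounded hu fun n => hbound n r (abs_lt.1 hrρ)
  · refine summable_of_ne_finset_zero (s := {0}) fun n hn => ?_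
    have : n ≠ 0 := by simpa using hn
    simp [this]

theorem continuousOn_tsum_mul_pow {p : ℕ → ℂ} (hp : Summable fun n => ‖p n‖) :
    ContinuousOn (fun r : ℝ => ∑' n, p n * (r : ℂ) ^ n) (Set.Icc 0 1) := by
  refine continuousOn_tsum (fun n => by fun_prop) hp fun n r hr => ?_
  rw [norm_mul, norm_pow, Complex.norm_real, Real.norm_of_nonneg hr.1]
  exact mul_le_of_le_one_right (norm_nonneg _) (pow_le_one₀ hr.1 hr.2)

/-- If the coefficients satisfy the recursion of `B' = A' B`, `B 0 = 1`, then `B 1 = exp (A 1)`,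
provided that both series converge absolutely at `1`. -/
theorem tsum_eq_exp_tsum {p q : ℕ → ℂ} (hp : Summable fun n => ‖p n‖)
    (hq : Summable fun n => ‖q n‖) (hp0 : p 0 = 1) (hq0 : q 0 = 0)
    (hrec : ∀ n : ℕ, ((n + 1 : ℕ) : ℂ) * p (n + 1) = ∑ ij ∈ Finset.HasAntidiagonal.antidiagonal n,
      ((ij.1 + 1 : ℕ) * q (ij.1 + 1)) * p ij.2) :
    ∑' n, p n = Complex.exp (∑' n, q n) := by
  set B : ℝ → ℂ := fun r => ∑' n, p n * (r : ℂ) ^ n with hB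
  set A : ℝ → ℂ := fun r => ∑' n, q n * (r : ℂ) ^ n with hA
  have hder : ∀ r : ℝ, |r| < 1 → HasDerivAt (fun r => B r * Complex.exp (-A r)) 0 r := by
    intro r hr
    have hB' := hasDerivAt_tsum_mul_pow hp hr
    have hA' := hasDerivAt_tsum_mul_pow hq hr
    have hr' : ‖(r : ℂ)‖ < 1 := by rwa [Complex.norm_real, Real.norm_eq_abs]
    have hsp : Summable fun n => ‖p n * (r : ℂ) ^ n‖ :=
      Summable.of_nonneg_of_le (fun _ => norm_nonneg _) (fun n => by
        rw [norm_mul, norm_pow]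
        exact mul_le_of_le_one_right (norm_nonneg _) (pow_le_one₀ (norm_nonneg _) hr'.le)) hp
    have hsq : Summable fun n => ‖((n + 1 : ℕ) * q (n + 1)) * (r : ℂ) ^ n‖ := by
      have h1 : Summable fun n : ℕ => ((n + 1 : ℕ) : ℝ) * |r| ^ n := by
        have h2 := (hasSum_coe_mul_geometric_of_norm_lt_one (𝕜 := ℝ) (r := |r|)
          (by simpa using hr)).summable
        have h3 := summable_geometric_of_lt_one (abs_nonneg r) hr
        refine (h2.add h3).congr fun n => ?_
        push_cast; ring
      refine Summable.of_nonneg_of_le (fun _ => norm_nonneg _) (fun n => ?_)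
        (h1.mul_left (∑' m, ‖q m‖))
      rw [norm_mul, norm_mul, norm_pow, Complex.norm_natCast, Complex.norm_real,
        Real.norm_eq_abs, mul_right_comm, mul_comm (∑' m, ‖q m‖)]
      gcongr
      exact hq.le_tsum (n + 1) fun _ _ => norm_nonneg _
    have hprod : ∑' n, ((n + 1 : ℕ) * p (n + 1)) * (r : ℂ) ^ n =
        (∑' n, ((n + 1 : ℕ) * q (n + 1)) * (r : ℂ) ^ n) * B r := by
      rw [hB, tsum_mul_tsum_eq_tsum_sum_antidiagonal_of_summable_norm hsq hsp]
      refine tsum_congr fun n => ?_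
      rw [hrec, Finset.sum_mul]
      refine Finset.sum_congr rfl fun ij hij => ?_
      rw [← Finset.HasAntidiagonal.mem_antidiagonal.1 hij, pow_add]
      ring
    rw [hprod] at hB'
    refine (hB'.mul hA'.neg.cexp).congr_deriv ?_
    simp only [hB, Pi.neg_apply]
    ring
  -- The derivative is known only for $|r|<1$; absolute convergence at 1 gives continuity up to the
  -- endpoint, where the identity is wanted.
  have hcont : ContinuousOn (fun r => B r * Complex.exp (-A r)) (Set.Icc 0 1) :=
    (continuousOn_tsum_mul_pow hp).mul (continuousOn_tsum_mul_pow hq).neg.cexp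
  have hconst := constant_of_has_deriv_right_zero hcont (fun r hr =>
    (hder r (abs_lt.2 ⟨by linarith [hr.1], hr.2⟩)).hasDerivWithinAt) 1 ⟨zero_le_one, le_rfl⟩
  have hB0 : B 0 = 1 := by
    simp only [hB]
    rw [tsum_eq_single 0 fun n hn => by simp [hn]]
    simp [hp0]
  have hA0 : A 0 = 0 := by
    simp only [hA]
    rw [tsum_eq_single 0 fun n hn => by simp [hn]]
    simp [hq0]
  rw [hB0, hA0, neg_zero, Complex.exp_zero, mul_one, Complex.exp_neg,
    mul_inv_eq_one₀ (Complex.exp_ne_zero _)] at hconst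
  simpa [hA, hB] using hconst

end PowerSeries

/-! ### Finite polymer gases with hard core -/

section Polymers

variable {α σ : Type*} [DecidableEq σ] {supp : α → Finset σ}

theorem hardCore_overlap_comm (a b : α) :
    hardCore (Overlap supp) a b = hardCore (Overlap supp) b a := by
  unfold hardCore Overlap
  rw [Finset.inter_comm]

theorem hardCore_overlap_of_disjoint {a b : α} (h : Disjoint (supp a) (supp b)) :
    hardCore (Overlap supp) a b = 0 :=
  if_neg fun h' => h'.ne_empty (Finset.disjoint_iff_inter_eq_empty.1 h)

/-- The weight of a sequence of polymers, zero unless they are pairwise compatible. -/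
noncomputable def polymerWeight (supp : α → Finset σ) (w : α → ℂ) (l : List α) : ℂ :=
  (pairProd (hardCore (Overlap supp)) l : ℂ) * (l.map w).prod

theorem pairProd_append (ζ : α → α → ℤ) {A B : List α} (h : ∀ a ∈ A, ∀ b ∈ B, ζ a b = 0) :
    pairProd ζ (A ++ B) = pairProd ζ A * pairProd ζ B := by
  induction A with
  | nil => simp [pairProd]
  | cons a A ih =>
    rw [List.cons_append, pairProd, pairProd, ih fun x hx => h x (List.mem_cons_of_mem _ hx),
      List.map_append, List.prod_append]
    have : (B.map fun b => 1 + ζ a b).prod = 1 := by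
      refine List.prod_eq_one fun x hx => ?_
      obtain ⟨b, hb, rfl⟩ := List.mem_map.1 hx
      rw [h a (by simp) b hb, add_zero]
    rw [this]
    ring

theorem polymerWeight_factorizes (w : α → ℂ) : Factorizes supp (polymerWeight supp w) where
  nil := by simp [polymerWeight, pairProd]
  cons a l ha := by
    have h := pairProd_append (hardCore (Overlap supp)) (A := [a]) (B := l) fun x hx b _ => by
      obtain rfl := List.mem_singleton.1 hx
      exact hardCore_overlap_of_disjoint (ha ▸ Finset.disjoint_empty_left _)
    rw [List.singleton_append] at h
    simp only [polymerWeight, h, List.map_cons, List.prod_cons, List.map_nil, List.prod_nil]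
    push_cast
    ring
  filter p _ l h := by
    have hperm : (l.filter (fun a => p a) ++ l.filter (fun a => ¬ p a)).Perm l := by
      simpa using List.filter_append_perm (fun a => decide (p a)) l
    unfold polymerWeight
    rw [← pairProd_perm hardCore_overlap_comm hperm, ← (hperm.map w).prod_eq, pairProd_append,
      List.map_append, List.prod_append]
    · push_cast
      ring
    · intro a ha b hb
      simp only [List.mem_filter, decide_eq_true_eq] at ha hb
      exact hardCore_overlap_of_disjoint (h a ha.1 b hb.1 ha.2 hb.2)

theorem norm_polymerWeight_le (w : α → ℂ) (l : List α) :
    ‖polymerWeight supp w l‖ ≤ (l.map fun a => ‖w a‖).prod := by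
  unfold polymerWeight
  rw [norm_mul]
  have h1 : ‖(pairProd (hardCore (Overlap supp)) l : ℂ)‖ ≤ 1 := by
    rw [Complex.norm_intCast]
    exact_mod_cast abs_pairProd_hardCore_le _ l
  have h2 : ‖(l.map w).prod‖ ≤ (l.map fun a => ‖w a‖).prod := by
    rw [List.norm_prod, List.map_map]
    rfl
  exact (mul_le_of_le_one_left (norm_nonneg _) h1).trans h2

/-- In a pairwise compatible list the support of the entry at `x` is crossed by nothing, so a list
spanned by `x` has no other entry. This makes the recursion weights of the gas sums over single
polymers. -/
theorem pairProd_overlap_eq_zero_of_spanned {x : σ} {l : List α} (h : Spanned supp {x} l)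
    (hl : 2 ≤ l.length) : pairProd (hardCore (Overlap supp)) l = 0 := by
  by_contra hne
  have hpw : ∀ l : List α, pairProd (hardCore (Overlap supp)) l ≠ 0 →
      l.Pairwise fun a b => ¬ Overlap supp a b := by
    intro l
    induction l with
    | nil => simp
    | cons a l ih =>
      intro h
      rw [pairProd] at h
      refine List.pairwise_cons.2 ⟨fun b hb hab => ?_, ih (right_ne_zero_of_mul h)⟩
      refine left_ne_zero_of_mul h (List.prod_eq_zero ?_)
      refine List.mem_map.2 ⟨b, hb, ?_⟩
      simp [hardCore, hab]
  have hp := hpw l hne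
  have hl0 : l ≠ [] := by rintro rfl; simp at hl
  obtain ⟨c, hc, hxc⟩ := mem_listSupp.1 (h.mem_listSupp hl0)
  have : Std.Symm fun a b => ¬ Overlap supp a b :=
    ⟨fun a b h => by rwa [Overlap, Finset.inter_comm]⟩
  have hsym : ∀ a ∈ l, ∀ b ∈ l, a ≠ b → ¬ Overlap supp a b :=
    fun a ha b hb hab => hp.forall ha hb hab
  have hsub := h.2 (supp c) (Finset.singleton_subset_iff.2 hxc) fun a ha => by
    by_cases hac : a = c
    · exact Or.inl (hac ▸ le_rfl)
    · refine Or.inr (Finset.disjoint_iff_inter_eq_empty.2 ?_)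
      exact Finset.not_nonempty_iff_eq_empty.1 (hsym a ha c hc hac)
  have hall : ∀ a ∈ l, a = c := by
    intro a ha
    by_contra hac
    refine hsym a ha c hc hac ?_
    rw [Overlap, Finset.inter_eq_left.2 (hsub a ha)]
    exact h.1 a ha
  match l, hl with
  | a :: b :: l, _ =>
    have ha := hall a (by simp)
    have hb := hall b (by simp)
    refine (List.pairwise_cons.1 hp).1 b (by simp) ?_
    rw [ha, hb]
    exact ⟨x, by simp [hxc]⟩

theorem spannedSum_polymerWeight (F : Finset α) (w : α → ℂ) {x : σ} {U : Finset σ} (hx : x ∈ U) :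
    spannedSum supp F (polymerWeight supp w) x U = ∑ c ∈ F with supp c = U, w c := by
  unfold spannedSum
  rw [tsum_eq_single 1]
  · simp only [listSum, Nat.factorial_one, Nat.cast_one, inv_one, one_mul]
    rw [Finset.sum_filter]
    refine Finset.sum_congr rfl fun c _ => ?_
    by_cases hc : supp c = U
    · rw [if_pos hc, if_pos]
      · simp [polymerWeight, pairProd]
      · refine ⟨⟨by simp, ?_, ?_⟩, by simp [listSupp, hc]⟩
        · simpa using ⟨x, by rwa [hc]⟩
        · intro U' hU' h a ha
          refine (h a ha).resolve_right fun hd => ?_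
          obtain rfl := List.mem_singleton.1 ha
          exact Finset.disjoint_left.1 hd (hc ▸ hx) (Finset.singleton_subset_iff.1 hU')
    · rw [if_neg hc, if_neg]
      simp [listSupp, hc]
  · intro n hn
    rw [listSum_congr (g := fun _ => 0), listSum_zero, mul_zero]
    intro l hl _
    split_ifs with h
    · rw [polymerWeight, pairProd_overlap_eq_zero_of_spanned h.1.2, Int.cast_zero, zero_mul]
      have := List.length_pos_of_ne_nil h.1.1
      omega
    · rfl

/-- The cluster expansion of the polymer partition function, for finitely many polymers. -/
theorem tsum_polymerWeight_eq_exp (F : Finset α) (w : α → ℂ)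
    (hs : Summable fun n : ℕ => ‖((n + 1)! : ℂ)⁻¹ * ∑ a ∈ F, w a * listSum F n
      (fun l => (rootedSum (hardCore (Overlap supp)) [a] l : ℂ) * (l.map w).prod)‖) :
    ∑' n : ℕ, (n ! : ℂ)⁻¹ * listSum F n (polymerWeight supp w) =
      Complex.exp (∑' n : ℕ, ((n + 1)! : ℂ)⁻¹ * ∑ a ∈ F, w a * listSum F n
        (fun l => (rootedSum (hardCore (Overlap supp)) [a] l : ℂ) * (l.map w).prod)) := by
  set ζ := hardCore (Overlap supp) with hζ
  set q : ℕ → ℂ := fun n => match n with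
    | 0 => 0
    | n + 1 => ((n + 1)! : ℂ)⁻¹ * ∑ a ∈ F, w a * listSum F n
        (fun l => (rootedSum ζ [a] l : ℂ) * (l.map w).prod) with hq
  have hqs : Summable fun n => ‖q n‖ := (summable_nat_add_iff 1).1 hs
  have hps := summable_norm_listSum (F := F) (t := polymerWeight supp w)
    fun l _ => norm_polymerWeight_le w l
  have h := tsum_eq_exp_tsum hps hqs (by simp [listSum, polymerWeight, pairProd]) rfl ?_
  · rw [h, hqs.of_norm.tsum_eq_zero_add, zero_add]
  intro n
  have hfac : ((n + 1 : ℕ) : ℂ) * ((n + 1)! : ℂ)⁻¹ = (n ! : ℂ)⁻¹ := by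
    rw [Nat.factorial_succ]
    push_cast
    have : (n : ℂ) + 1 ≠ 0 := by exact_mod_cast n.succ_ne_zero
    rw [mul_inv, mul_inv_cancel_left₀ this]
  have hfac' : ∀ i : ℕ, ((i + 1 : ℕ) : ℂ) * q (i + 1) = (i ! : ℂ)⁻¹ * ∑ a ∈ F, w a * listSum F i
        (fun l => (rootedSum ζ [a] l : ℂ) * (l.map w).prod) := by
    intro i
    simp only [hq]
    rw [← mul_assoc, Nat.factorial_succ]
    push_cast
    have : (i : ℂ) + 1 ≠ 0 := by exact_mod_cast i.succ_ne_zero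
    rw [mul_inv, mul_inv_cancel_left₀ this]
  -- Marking the first polymer corresponds to differentiating the series. The Mayer identity with
  -- the single root `a` separates what is linked to `a` from the rest, which is the relation
  -- $B'=A'B$ for coefficients.
  have hstep : ∀ (a : α) (l : List α), polymerWeight supp w (a :: l) = splitSum l (fun A B =>
      (w a * ((rootedSum ζ [a] A : ℂ) * (A.map w).prod)) * polymerWeight supp w B) := by
    intro a l
    have h1 := splitSum_rootedSum_mul_pairProd (ζ := ζ) hardCore_overlap_comm [a] l
    rw [List.singleton_append] at h1
    rw [polymerWeight, ← hζ, ← h1]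
    have h2 := splitSum_map (Int.castAddHom ℂ) l (fun A B => rootedSum ζ [a] A * pairProd ζ B)
    simp only [Int.coe_castAddHom] at h2
    rw [h2, ← splitSum_mul_right]
    refine splitSum_congr fun A B hAB => ?_
    rw [List.map_cons, List.prod_cons, ← (hAB.map w).prod_eq, List.map_append, List.prod_append,
      polymerWeight]
    push_cast
    ring
  rw [← mul_assoc, hfac]
  simp only [hfac', listSum, hstep, Finset.mul_sum, listSum_splitSum_div_factorial]
  rw [Finset.sum_comm]
  refine Finset.sum_congr rfl fun ij _ => ?_
  rw [Finset.sum_mul]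
  refine Finset.sum_congr rfl fun a _ => ?_
  have hcomm : ∀ A : List α, (ij.2 ! : ℂ)⁻¹ * listSum F ij.2 (fun B =>
      (w a * ((rootedSum ζ [a] A : ℂ) * (A.map w).prod)) * polymerWeight supp w B) =
      ((rootedSum ζ [a] A : ℂ) * (A.map w).prod) *
        (w a * ((ij.2 ! : ℂ)⁻¹ * listSum F ij.2 (polymerWeight supp w))) := fun A => by
    rw [listSum_mul_left]
    ring
  simp only [hcomm, listSum_mul_right]
  ring

end Polymers
open QLattice

/-! ### Local algebras: embedding, trace and norm -/

section Averages

/-- A function of some coordinates has the same average over all coordinates; stated without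
division. -/
theorem sum_comp_injective {X Y κ : Type*} [Fintype X] [Fintype Y] [Fintype κ] [DecidableEq X]
    [DecidableEq Y] {e : X → Y} (he : Function.Injective e) (f : (X → κ) → ℂ) :
    (∑ σ : Y → κ, f (σ ∘ e)) * (Fintype.card (X → κ) : ℂ) =
      (Fintype.card (Y → κ) : ℂ) * ∑ s : X → κ, f s := by
  classical
  let E : X ⊕ {y // y ∉ Set.range e} ≃ Y :=
    (Equiv.sumCongr (Equiv.ofInjective e he) (Equiv.refl _)).trans (Equiv.Set.sumCompl _)
  have hE : ∀ x, E (Sum.inl x) = e x := fun x => rfl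
  let E' : (Y → κ) ≃ (X → κ) × ({y // y ∉ Set.range e} → κ) :=
    (Equiv.arrowCongr E.symm (Equiv.refl κ)).trans (Equiv.sumArrowEquivProdArrow _ _ _)
  have hE' : ∀ σ, (E' σ).1 = σ ∘ e := fun σ => by
    ext x
    simp [E', hE]
  have h1 : ∑ σ : Y → κ, f (σ ∘ e) =
      (Fintype.card ({y // y ∉ Set.range e} → κ) : ℂ) * ∑ s : X → κ, f s := by
    rw [Fintype.sum_equiv E' (fun σ => f (σ ∘ e)) (fun p => f p.1) fun σ => by rw [hE'],
      Fintype.sum_prod_type, Finset.mul_sum]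
    simp
  rw [h1, Fintype.card_congr E', Fintype.card_prod]
  push_cast
  ring

end Averages

section Embed

variable {d N : ℕ} {X U V Λ : Finset (Site d)}

theorem embed_apply_eq (h : X ⊆ Λ) (A : LocalAlg N X) (σ τ : Config N Λ) :
    embed h A σ τ = if ∀ x : Λ, x.1 ∉ X → σ x = τ x then
      A (fun x => σ ⟨x.1, h x.2⟩) (fun x => τ ⟨x.1, h x.2⟩) else 0 := rfl

theorem embed_mul (h : X ⊆ Λ) (A B : LocalAlg N X) : embed h (A * B) = embed h A * embed h B := by
  ext σ τ
  rw [Matrix.mul_apply, embed_apply_eq]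
  simp only [embed_apply_eq, Matrix.mul_apply, ite_mul, zero_mul, mul_ite, mul_zero, ← ite_and]
  rw [← Finset.sum_filter]
  split_ifs with hst
  · refine Finset.sum_bij'
      (fun s _ => fun x : Λ => if hx : x.1 ∈ X then s ⟨x.1, hx⟩ else σ x)
      (fun ρ _ => fun x : X => ρ ⟨x.1, h x.2⟩) ?_ ?_ ?_ ?_ ?_
    · intro s _
      rw [Finset.mem_filter]
      refine ⟨Finset.mem_univ _, fun x hx => ?_, fun x hx => ?_⟩ <;> simp [hx, hst x hx]
    · simp
    · intro s _
      ext x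
      simp
    · intro ρ hρ
      rw [Finset.mem_filter] at hρ
      funext x
      by_cases hx : x.1 ∈ X
      · simp [hx]
      · simp [hx, hρ.2.1 x hx, hρ.2.2 x hx]
    · intro s _
      simp
  · symm
    refine Finset.sum_eq_zero fun ρ hρ => absurd (fun x hx => ?_) hst
    rw [Finset.mem_filter] at hρ
    exact (hρ.2.2 x hx).trans (hρ.2.1 x hx)

theorem embed_one (h : X ⊆ Λ) : embed h (1 : LocalAlg N X) = 1 := by
  ext σ τ
  rw [embed_apply_eq, Matrix.one_apply, Matrix.one_apply, ← ite_and]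
  refine if_congr ⟨fun hst => ?_, ?_⟩ rfl rfl
  · funext x
    by_cases hx : x.1 ∈ X
    · exact congrFun hst.2 ⟨x.1, hx⟩
    · exact hst.1 x hx
  · rintro rfl
    simp

/-- The embedding of local algebras as a star algebra homomorphism. -/
def embedHom (h : X ⊆ Λ) : LocalAlg N X →⋆ₐ[ℂ] LocalAlg N Λ where
  toFun := embed h
  map_one' := embed_one h
  map_mul' := embed_mul h
  map_zero' := by ext σ τ; simp [embed_apply_eq]
  map_add' A B := by
    ext σ τ
    simp only [embed_apply_eq, Matrix.add_apply]
    split_ifs <;> simp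
  commutes' c := by
    rw [Algebra.algebraMap_eq_smul_one, Algebra.algebraMap_eq_smul_one, ← embed_one (N := N) h]
    ext σ τ
    simp only [embed_apply_eq, Matrix.smul_apply]
    split_ifs <;> simp
  map_star' A := by
    ext σ τ
    simp only [embed_apply_eq, Matrix.star_apply, eq_comm (a := σ _)]
    split_ifs <;> simp

theorem embed_embed (h : X ⊆ U) (h' : U ⊆ Λ) (A : LocalAlg N X) :
    embed h' (embed h A) = embed (h.trans h') A := by
  ext σ τ
  simp only [embed_apply_eq, ← ite_and]
  refine if_congr ⟨fun hst x hx => ?_, fun hst => ⟨fun x hx => hst x fun hX => hx (h hX),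
    fun x hx => hst ⟨x.1, h' x.2⟩ hx⟩⟩ rfl rfl
  by_cases hU : x.1 ∈ U
  · exact hst.2 ⟨x.1, hU⟩ hx
  · exact hst.1 x hU

theorem embed_mul_embed_apply (hU : U ⊆ Λ) (hV : V ⊆ Λ) (hUV : Disjoint U V) (A : LocalAlg N U)
    (B : LocalAlg N V) (σ τ : Config N Λ) :
    (embed hU A * embed hV B) σ τ = if ∀ x : Λ, x.1 ∉ U → x.1 ∉ V → σ x = τ x then
      A (fun x => σ ⟨x.1, hU x.2⟩) (fun x => τ ⟨x.1, hU x.2⟩) *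
        B (fun x => σ ⟨x.1, hV x.2⟩) (fun x => τ ⟨x.1, hV x.2⟩) else 0 := by
  have hd : ∀ {x}, x ∈ U → x ∉ V := fun h h' => Finset.disjoint_left.1 hUV h h'
  rw [Matrix.mul_apply]
  simp only [embed_apply_eq]
  -- The left factor changes only sites of `U` and the right one only sites of `V`, so this is the
  -- only possible intermediate configuration.
  rw [Finset.sum_eq_single (fun x : Λ => if x.1 ∈ U then τ x else σ x)]
  · have h1 : ∀ x : Λ, x.1 ∉ U → σ x = if x.1 ∈ U then τ x else σ x := fun x hx => by simp [hx]
    rw [if_pos h1]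
    by_cases hst : ∀ x : Λ, x.1 ∉ U → x.1 ∉ V → σ x = τ x
    · rw [if_pos hst, if_pos]
      · congr 1
        · congr 1
          funext x
          simp
        · congr 1
          funext x
          exact if_neg fun h => hd h x.2
      · intro x hx
        dsimp only
        split_ifs with hxU
        · rfl
        · exact hst x hxU hx
    · rw [if_neg hst, if_neg, mul_zero]
      intro h
      refine hst fun x hxU hxV => ?_
      simpa [hxU] using h x hxV
  · intro ρ _ hρ
    by_cases h1 : ∀ x : Λ, x.1 ∉ U → σ x = ρ x
    · by_cases h2 : ∀ x : Λ, x.1 ∉ V → ρ x = τ x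
      · refine absurd (funext fun x => ?_) hρ
        split_ifs with hx
        · exact h2 x (hd hx)
        · exact (h1 x hx).symm
      · rw [if_neg h2, mul_zero]
    · rw [if_neg h1, zero_mul]
  · exact fun h => absurd (Finset.mem_univ _) h

theorem embed_commute (hU : U ⊆ Λ) (hV : V ⊆ Λ) (hUV : Disjoint U V) (A : LocalAlg N U)
    (B : LocalAlg N V) : Commute (embed hU A) (embed hV B) := by
  ext σ τ
  rw [embed_mul_embed_apply hU hV hUV, embed_mul_embed_apply hV hU hUV.symm]
  refine if_congr ⟨fun h x h1 h2 => h x h2 h1, fun h x h1 h2 => h x h2 h1⟩ (mul_comm _ _) rfl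

theorem ntr_embed_mul_embed (hN : 1 ≤ N) (hU : U ⊆ Λ) (hV : V ⊆ Λ) (hUV : Disjoint U V)
    (A : LocalAlg N U) (B : LocalAlg N V) : ntr (embed hU A * embed hV B) = ntr A * ntr B := by
  have hcard : ∀ W : Finset (Site d), (Fintype.card (Config N W) : ℂ) ≠ 0 := fun W => by
    have : Nonempty (Fin N) := ⟨⟨0, hN⟩⟩
    exact_mod_cast Fintype.card_ne_zero
  let e : U ⊕ V → Λ := Sum.elim (fun x => ⟨x.1, hU x.2⟩) (fun x => ⟨x.1, hV x.2⟩)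
  have he : Function.Injective e := by
    refine Function.Injective.sumElim ?_ ?_ ?_
    · intro x y h
      have h' := congrArg Subtype.val h
      exact Subtype.ext h'
    · intro x y h
      have h' := congrArg Subtype.val h
      exact Subtype.ext h'
    · intro x y h
      have : x.1 = y.1 := congrArg Subtype.val h
      exact Finset.disjoint_left.1 hUV x.2 (this ▸ y.2)
  have h := sum_comp_injective (κ := Fin N) he
    (fun s => A (s ∘ Sum.inl) (s ∘ Sum.inl) * B (s ∘ Sum.inr) (s ∘ Sum.inr))
  rw [Fintype.sum_equiv (Equiv.sumArrowEquivProdArrow U V (Fin N))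
      (fun s => A (s ∘ Sum.inl) (s ∘ Sum.inl) * B (s ∘ Sum.inr) (s ∘ Sum.inr))
      (fun p => A p.1 p.1 * B p.2 p.2) fun s => rfl, Fintype.sum_prod_type,
    ← Finset.sum_mul_sum Finset.univ Finset.univ (fun x => A x x) (fun y => B y y),
    Fintype.card_congr (Equiv.sumArrowEquivProdArrow U V (Fin N)),
    Fintype.card_prod] at h
  have htr : (embed hU A * embed hV B).trace = ∑ σ : Λ → Fin N,
      A ((σ ∘ e) ∘ Sum.inl) ((σ ∘ e) ∘ Sum.inl) * B ((σ ∘ e) ∘ Sum.inr) ((σ ∘ e) ∘ Sum.inr) := by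
    rw [Matrix.trace]
    refine Finset.sum_congr rfl fun σ _ => ?_
    rw [Matrix.diag_apply, embed_mul_embed_apply hU hV hUV, if_pos fun _ _ _ => rfl]
    rfl
  rw [ntr, htr, ntr, ntr, div_mul_div_comm, div_eq_div_iff (hcard _) (mul_ne_zero (hcard _) (hcard _))]
  rw [Nat.cast_mul] at h
  rw [h, mul_comm]
  rfl

theorem ntr_one (hN : 1 ≤ N) : ntr (1 : LocalAlg N Λ) = 1 := by
  have : Nonempty (Fin N) := ⟨⟨0, hN⟩⟩
  rw [ntr, Matrix.trace_one, div_self]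
  exact_mod_cast Fintype.card_ne_zero

end Embed

section Norm

open scoped Matrix.Norms.L2Operator

variable {d N : ℕ} {X Λ : Finset (Site d)}

theorem opNorm_eq (A : LocalAlg N X) : opNorm A = ENNReal.ofReal ‖A‖ := by
  rw [opNorm, ← ofReal_norm, Matrix.cstar_norm_def]

/-- Star homomorphisms of C*-algebras are contractions. -/
theorem norm_embed_le (h : X ⊆ Λ) (A : LocalAlg N X) : ‖embed h A‖ ≤ ‖A‖ :=
  NonUnitalStarAlgHom.norm_apply_le (embedHom h) A

theorem norm_ntr_le (A : LocalAlg N Λ) : ‖ntr A‖ ≤ ‖A‖ := by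
  have hdiag : ∀ σ, ‖A σ σ‖ ≤ ‖A‖ := by
    intro σ
    have h1 := (Matrix.toEuclideanCLM (n := Config N Λ) (𝕜 := ℂ) A).le_opNorm
      (EuclideanSpace.single σ 1)
    rw [PiLp.norm_single, norm_one, mul_one, ← Matrix.cstar_norm_def] at h1
    refine le_trans ?_ ((PiLp.norm_apply_le _ σ).trans h1)
    simp [Matrix.ofLp_toEuclideanCLM]
  rw [ntr, norm_div, Complex.norm_natCast]
  refine div_le_of_le_mul₀ (Nat.cast_nonneg _) (norm_nonneg _) ?_
  refine (norm_sum_le _ _).trans ((Finset.sum_le_sum fun σ _ => hdiag σ).trans_eq ?_)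
  simp [mul_comm]

theorem norm_list_prod_le {n α : Type*} [Fintype n] [DecidableEq n] (g : α → Matrix n n ℂ)
    (l : List α) : ‖(l.map g).prod‖ ≤ (l.map fun a => ‖g a‖).prod := by
  induction l with
  | nil =>
    -- The identity has norm at most 1; equality would need a nonempty index type.
    rw [List.map_nil, List.prod_nil, List.map_nil, List.prod_nil, Matrix.cstar_norm_def, map_one]
    exact ContinuousLinearMap.norm_id_le
  | cons a l ih =>
    simp only [List.map_cons, List.prod_cons]
    exact (norm_mul_le _ _).trans (by gcongr)

theorem hasSum_ntr_exp {M : LocalAlg N Λ} :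
    HasSum (fun n : ℕ => (n ! : ℂ)⁻¹ * ntr (M ^ n)) (ntr (NormedSpace.exp M)) := by
  let T : LocalAlg N Λ →ₗ[ℂ] ℂ :=
    ((Fintype.card (Config N Λ) : ℂ)⁻¹) • Matrix.traceLinearMap (Config N Λ) ℂ ℂ
  have hT : ∀ A, T A = ntr A := fun A => by
    simp [T, ntr, div_eq_inv_mul]
  have h := (NormedSpace.exp_series_hasSum_exp' (𝕂 := ℂ) M).mapL
    (LinearMap.toContinuousLinearMap T)
  simpa [hT] using h

end Norm

open QLattice

/-! ### The quantum lattice system as a polymer gas -/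

section Model

variable {d N : ℕ} {Λ : Finset (Site d)}

/-- The support of an interaction term. -/
def termSupp (X : Λ.powerset) : Finset (Site d) := X.1

/-- The normalized trace of the product of the interaction terms of a sequence of sets. -/
noncomputable def traceProd (Ψ : Interaction d N) (l : List Λ.powerset) : ℂ :=
  ntr (l.map (term Ψ)).prod

/-- The operator norm of an interaction term, as a real number. -/
noncomputable def termNorm (Ψ : Interaction d N) (X : Finset (Site d)) : ℝ := (opNorm (Ψ X)).toReal

theorem termNorm_nonneg (Ψ : Interaction d N) (X : Finset (Site d)) : 0 ≤ termNorm Ψ X :=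
  ENNReal.toReal_nonneg

theorem norm_traceProd_le (Ψ : Interaction d N) (l : List Λ.powerset) :
    ‖traceProd Ψ l‖ ≤ (l.map fun X => termNorm Ψ X.1).prod := by
  open scoped Matrix.Norms.L2Operator in
  refine (norm_ntr_le _).trans ((norm_list_prod_le _ l).trans ?_)
  refine List.prod_map_le_prod_map₀ _ _ (fun X _ => norm_nonneg _) fun X _ => ?_
  rw [termNorm, opNorm_eq, ENNReal.toReal_ofReal (norm_nonneg _)]
  exact norm_embed_le _ _

theorem exists_embed_eq_prod (Ψ : Interaction d N) {U : Finset (Site d)} (hU : U ⊆ Λ)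
    (l : List Λ.powerset) (hl : ∀ X ∈ l, termSupp X ⊆ U) :
    ∃ A : LocalAlg N U, embed hU A = (l.map (term Ψ)).prod := by
  induction l with
  | nil => exact ⟨1, embed_one hU⟩
  | cons X l ih =>
    obtain ⟨A, hA⟩ := ih fun Y hY => hl Y (List.mem_cons_of_mem _ hY)
    have hX : X.1 ⊆ U := hl X (by simp)
    refine ⟨embed hX (Ψ X.1) * A, ?_⟩
    rw [embed_mul, hA, embed_embed]
    rfl

theorem ntr_mul_of_disjoint (hN : 1 ≤ N) (Ψ : Interaction d N) (l l' : List Λ.powerset)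
    (h : Disjoint (listSupp termSupp l) (listSupp termSupp l')) :
    ntr ((l.map (term Ψ)).prod * (l'.map (term Ψ)).prod) = traceProd Ψ l * traceProd Ψ l' := by
  have hsub : ∀ l : List Λ.powerset, listSupp termSupp l ⊆ Λ := fun l =>
    listSupp_subset_iff.2 fun X _ => Finset.mem_powerset.1 X.2
  obtain ⟨A, hA⟩ := exists_embed_eq_prod Ψ (hsub l) l fun X hX => subset_listSupp hX
  obtain ⟨B, hB⟩ := exists_embed_eq_prod Ψ (hsub l') l' fun X hX => subset_listSupp hX
  have h1 : ∀ (U : Finset (Site d)) (hU : U ⊆ Λ) (A : LocalAlg N U), ntr (embed hU A) = ntr A := by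
    intro U hU A
    have := ntr_embed_mul_embed hN hU (Finset.empty_subset Λ) (Finset.disjoint_empty_right U) A 1
    rwa [embed_one, mul_one, ntr_one hN, mul_one] at this
  rw [traceProd, traceProd, ← hA, ← hB, ntr_embed_mul_embed hN _ _ h, h1, h1]

theorem commute_term (Ψ : Interaction d N) {X Y : Λ.powerset} (h : Disjoint (termSupp X) (termSupp Y)) :
    Commute (term Ψ X) (term Ψ Y) :=
  embed_commute _ _ h _ _

/-- Terms of the two groups commute, so the product can be sorted without changing the order inside
a group; then the trace splits over disjoint supports. -/
theorem traceProd_factorizes (hN : 1 ≤ N) (Ψ : Interaction d N) :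
    Factorizes (termSupp (Λ := Λ)) (traceProd Ψ) where
  nil := ntr_one hN
  cons X l hX := by
    rw [← ntr_mul_of_disjoint hN]
    · simp [traceProd]
    · simp [listSupp, hX]
  filter p _ l h := by
    have hprod : (l.map (term Ψ)).prod = ((l.filter fun X => p X).map (term Ψ)).prod *
        ((l.filter fun X => ¬ p X).map (term Ψ)).prod := by
      clear * - h
      induction l with
      | nil => simp
      | cons X l ih =>
        have ih := ih fun Y hY Z hZ => h Y (List.mem_cons_of_mem _ hY) Z (List.mem_cons_of_mem _ hZ)
        by_cases hX : p X
        · rw [List.filter_cons_of_pos (by simpa using hX), List.filter_cons_of_neg (by simpa using hX)]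
          simp only [List.map_cons, List.prod_cons, ih, mul_assoc]
        · rw [List.filter_cons_of_neg (by simpa using hX), List.filter_cons_of_pos (by simpa using hX)]
          simp only [List.map_cons, List.prod_cons, ih]
          rw [← mul_assoc, ← mul_assoc]
          congr 1
          refine Commute.list_prod_right _ _ fun M hM => ?_
          obtain ⟨Y, hY, rfl⟩ := List.mem_map.1 hM
          simp only [List.mem_filter, decide_eq_true_eq] at hY
          exact commute_term Ψ (h Y (List.mem_cons_of_mem _ hY.1) X (by simp) hY.2 hX).symm
    rw [traceProd, hprod, ntr_mul_of_disjoint hN]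
    rw [Finset.disjoint_left]
    intro y hy hy'
    obtain ⟨X, hX, hyX⟩ := mem_listSupp.1 hy
    obtain ⟨Y, hY, hyY⟩ := mem_listSupp.1 hy'
    simp only [List.mem_filter, decide_eq_true_eq] at hX hY
    exact Finset.disjoint_left.1 (h X hX.1 Y hY.1 hX.2 hY.2) hyX hyY

theorem partitionFunction_eq_expSum (Φ : Interaction d N) (β : ℂ) :
    partitionFunction Φ Λ β = expSum (termSupp (Λ := Λ)) Finset.univ (traceProd (-β • Φ)) Λ := by
  rw [partitionFunction, ← hasSum_ntr_exp.tsum_eq, expSum]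
  refine tsum_congr fun n => ?_
  have huniv : (Finset.univ.filter fun X : Λ.powerset => termSupp X ⊆ Λ) = Finset.univ :=
    Finset.filter_true_of_mem fun X _ => Finset.mem_powerset.1 X.2
  have hH : -β • hamiltonian Φ Λ = ∑ X : Λ.powerset, term (-β • Φ) X := by
    rw [hamiltonian, Finset.smul_sum]
    refine Finset.sum_congr rfl fun X _ => ?_
    exact (map_smul (embedHom (Finset.mem_powerset.1 X.2)) (-β) (Φ X.1)).symm
  let T : LocalAlg N Λ →+ ℂ :=
    { toFun := ntr
      map_zero' := by simp [ntr]
      map_add' := fun A B => by simp [ntr, add_div] }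
  rw [huniv, hH, ← listSum_prod]
  congr 1
  exact listSum_map T _ n _

theorem spanned_of_connected {n : ℕ} {X : Fin n → Λ.powerset} {x : Site d}
    (h : (overlapGraph fun i => (X i).1).Connected) (hx : ∃ i, x ∈ (X i).1) :
    Spanned termSupp {x} (List.ofFn X) := by
  obtain ⟨i₀, hi₀⟩ := hx
  constructor
  · intro Y hY
    obtain ⟨i, rfl⟩ := (List.mem_ofFn' _ _).1 hY
    by_cases hi : i = i₀
    · exact ⟨x, hi ▸ hi₀⟩
    · obtain ⟨p⟩ := h.preconnected i i₀
      cases p with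
      | nil => exact absurd rfl hi
      | cons hadj _ => exact hadj.2.mono Finset.inter_subset_left
  · intro U hxU hU Y hY
    obtain ⟨i, rfl⟩ := (List.mem_ofFn' _ _).1 hY
    have hU' : ∀ j, (X j).1 ⊆ U ∨ Disjoint (X j).1 U := fun j =>
      hU (X j) ((List.mem_ofFn' _ _).2 ⟨j, rfl⟩)
    have h0 : (X i₀).1 ⊆ U := (hU' i₀).resolve_right fun hd =>
      Finset.disjoint_left.1 hd hi₀ (hxU (Finset.mem_singleton_self x))
    obtain ⟨p⟩ := h.preconnected i i₀
    change (X i).1 ⊆ U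
    clear hY hi₀
    induction p with
    | nil => exact h0
    | @cons a b c hadj p ih =>
      refine (hU' a).resolve_right fun hd => ?_
      obtain ⟨y, hy⟩ := hadj.2
      rw [Finset.mem_inter] at hy
      exact Finset.disjoint_left.1 hd hy.1 (ih h0 hy.2)

theorem connected_of_spanned {n : ℕ} {X : Fin n → Λ.powerset} {x : Site d} (hn : n ≠ 0)
    (h : Spanned termSupp {x} (List.ofFn X)) : (overlapGraph fun i => (X i).1).Connected := by
  classical
  have hmem : ∀ i, X i ∈ List.ofFn X := fun i => (List.mem_ofFn' _ _).2 ⟨i, rfl⟩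
  have hne : List.ofFn X ≠ [] := by
    simpa [List.ofFn_eq_nil_iff] using hn
  obtain ⟨Y, hY, hxY⟩ := mem_listSupp.1 (h.mem_listSupp hne)
  obtain ⟨i₀, rfl⟩ := (List.mem_ofFn' _ _).1 hY
  set g := overlapGraph fun i => (X i).1 with hg
  -- The union of the sets reachable from `i₀` is crossed by no set of the sequence, hence contains
  -- every set; nonempty sets then meet a reachable one.
  set U : Finset (Site d) :=
    (Finset.univ.filter fun j => g.Reachable i₀ j).biUnion fun j => (X j).1 with hU
  have hreach : ∀ i, (∃ y ∈ (X i).1, y ∈ U) → g.Reachable i₀ i := by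
    rintro i ⟨y, hyi, hyU⟩
    obtain ⟨j, hj, hyj⟩ := Finset.mem_biUnion.1 hyU
    have hj' : g.Reachable i₀ j := (Finset.mem_filter.1 hj).2
    by_cases hij : j = i
    · exact hij ▸ hj'
    · exact hj'.trans (SimpleGraph.Adj.reachable ⟨hij, y, Finset.mem_inter.2 ⟨hyj, hyi⟩⟩)
  have hsub : ∀ i, g.Reachable i₀ i → (X i).1 ⊆ U := fun i hi y hy =>
    Finset.mem_biUnion.2 ⟨i, Finset.mem_filter.2 ⟨Finset.mem_univ _, hi⟩, hy⟩
  have hall := h.2 U (Finset.singleton_subset_iff.2 (hsub i₀ (SimpleGraph.Reachable.refl _) hxY)) (by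
    intro Z hZ
    obtain ⟨i, rfl⟩ := (List.mem_ofFn' _ _).1 hZ
    rw [or_iff_not_imp_right, Finset.not_disjoint_iff]
    exact fun hy => hsub i (hreach i hy))
  have hr : ∀ i, g.Reachable i₀ i := fun i => by
    obtain ⟨y, hy⟩ := h.1 _ (hmem i)
    exact hreach i ⟨y, hy, hall _ (hmem i) hy⟩
  have : Nonempty (Fin n) := ⟨i₀⟩
  exact ⟨fun i j => (hr i).symm.trans (hr j)⟩

theorem mem_cluster_supp {C : Cluster Λ} {x : Site d} : x ∈ C.supp ↔ ∃ i, x ∈ (C.X i).1 := by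
  simp [Cluster.supp]

theorem cluster_supp_eq (C : Cluster Λ) : C.supp = listSupp termSupp (List.ofFn C.X) := by
  ext x
  rw [mem_cluster_supp, mem_listSupp]
  simp [termSupp, List.mem_ofFn']

theorem cluster_n_ne_zero (C : Cluster Λ) : C.n ≠ 0 := by
  obtain ⟨i⟩ := C.connected.nonempty
  have := i.2
  omega

theorem weight_eq (Φ : Interaction d N) (β : ℂ) (C : Cluster Λ) :
    weight Φ β C = (C.n ! : ℂ)⁻¹ * traceProd (-β • Φ) (List.ofFn C.X) := by
  have hterm : ∀ X : Λ.powerset, term (-β • Φ) X = -β • term Φ X := fun X =>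
    map_smul (embedHom (Finset.mem_powerset.1 X.2)) (-β) (Φ X.1)
  have hprod : ∀ l : List Λ.powerset, (l.map (term (-β • Φ))).prod =
      (-β) ^ l.length • (l.map (term Φ)).prod := by
    intro l
    induction l with
    | nil => simp
    | cons X l ih =>
      simp only [List.map_cons, List.prod_cons, ih, hterm, List.length_cons, pow_succ',
        smul_mul_smul_comm]
  rw [weight, traceProd, hprod, List.length_ofFn, List.map_ofFn, ntr, ntr, Matrix.trace_smul,
    smul_eq_mul]
  simp only [Function.comp_def]
  ring

/-- The sequence underlying a cluster. -/
def clusterSeq (C : Cluster Λ) : Σ n : ℕ, Fin n → Λ.powerset := ⟨C.n, C.X⟩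

theorem clusterSeq_injective : Function.Injective (clusterSeq (Λ := Λ)) := by
  rintro ⟨n, X, h⟩ ⟨n', X', h'⟩ hC
  simp only [clusterSeq, Sigma.mk.injEq] at hC
  obtain ⟨rfl, hX⟩ := hC
  obtain rfl := eq_of_heq hX
  rfl

-- Identifies the recursion weight of the trace model with the total cluster weight at support `U`.
-- Nonempty sequences spanned by `x ∈ U` are the clusters whose support contains `x`, and the sum
-- over all sequences is dominated by an exponential series.
open scoped Classical in
theorem hasSum_weight_supp_eq (Φ : Interaction d N) (β : ℂ) {x : Site d} {U : Finset (Site d)}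
    (hx : x ∈ U) : HasSum (fun C : Cluster Λ => if C.supp = U then weight Φ β C else 0)
      (spannedSum (termSupp (Λ := Λ)) Finset.univ (traceProd (-β • Φ)) x U) := by
  set Ψ := -β • Φ with hΨ
  set w : Λ.powerset → ℝ := fun X => termNorm Ψ X.1 with hw
  set f : (Σ n : ℕ, Fin n → Λ.powerset) → ℂ := fun p => (p.1 ! : ℂ)⁻¹ *
    if (List.ofFn p.2 ≠ [] ∧ Spanned termSupp {x} (List.ofFn p.2)) ∧
      listSupp termSupp (List.ofFn p.2) = U then traceProd Ψ (List.ofFn p.2) else 0 with hf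
  have hf0 : ∀ p ∉ Set.range (clusterSeq (Λ := Λ)), f p = 0 := by
    rintro ⟨n, X⟩ hp
    rw [hf]
    dsimp only
    rw [if_neg, mul_zero]
    rintro ⟨⟨hne, hsp⟩, _⟩
    refine hp ⟨⟨n, X, connected_of_spanned ?_ hsp⟩, rfl⟩
    rintro rfl
    simp at hne
  have hcomp : (fun C : Cluster Λ => if C.supp = U then weight Φ β C else 0) =
      f ∘ clusterSeq := by
    funext C
    simp only [hf, Function.comp_apply, clusterSeq, ← cluster_supp_eq, weight_eq]
    by_cases hC : C.supp = U
    · rw [if_pos hC, if_pos]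
      refine ⟨⟨?_, spanned_of_connected C.connected (mem_cluster_supp.1 (hC ▸ hx))⟩, hC⟩
      simpa [List.ofFn_eq_nil_iff] using cluster_n_ne_zero C
    · rw [if_neg hC, if_neg (fun h => hC h.2), mul_zero]
  rw [hcomp, clusterSeq_injective.hasSum_iff hf0]
  have hbound : ∀ p : Σ n : ℕ, Fin n → Λ.powerset,
      ‖f p‖ ≤ (p.1 ! : ℝ)⁻¹ * ((List.ofFn p.2).map w).prod := by
    rintro ⟨n, X⟩
    rw [hf]
    dsimp only
    rw [norm_mul, norm_inv, Complex.norm_natCast]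
    gcongr
    split_ifs
    · exact norm_traceProd_le Ψ _
    · rw [norm_zero]
      exact prod_map_nonneg (fun X : Λ.powerset => termNorm_nonneg Ψ X.1) _
  have hfib : ∀ n : ℕ, ∑ X : Fin n → Λ.powerset, (n ! : ℝ)⁻¹ * ((List.ofFn X).map w).prod =
      (∑ X, w X) ^ n / (n ! : ℝ) := by
    intro n
    rw [← Finset.mul_sum, div_eq_inv_mul, ← listSum_prod, listSum_eq_sum_piFinset,
      Fintype.piFinset_univ]
  have hs : Summable f := by
    refine Summable.of_norm_bounded (g := fun p : Σ n : ℕ, Fin n → Λ.powerset =>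
      (p.1 ! : ℝ)⁻¹ * ((List.ofFn p.2).map w).prod) ?_ hbound
    rw [summable_sigma_of_nonneg]
    · refine ⟨fun n => Summable.of_finite, ?_⟩
      simp only [tsum_fintype, hfib]
      exact Real.summable_pow_div_factorial _
    · exact fun p => mul_nonneg (by positivity)
        (prod_map_nonneg (fun X : Λ.powerset => termNorm_nonneg Ψ X.1) _)
  rw [hs.hasSum_iff, hs.tsum_sigma, spannedSum]
  refine tsum_congr fun n => ?_
  rw [tsum_fintype, listSum_eq_sum_piFinset, Fintype.piFinset_univ, Finset.mul_sum]

end Model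

/-! ### The expansion with infinitely many polymers -/

section Ursell

variable {α : Type*}

theorem exists_subset_sigma_piFinset {α : Type*} [DecidableEq α] {g : ℕ → ℕ}
    (s : Finset (Σ k : ℕ, Fin (g k) → α)) : ∃ (K : ℕ) (F : Finset α),
      s ⊆ (Finset.range K).sigma fun k => Fintype.piFinset fun _ : Fin (g k) => F := by
  refine ⟨s.sup (fun p => p.1 + 1), s.biUnion fun p => Finset.univ.image p.2, fun p hp => ?_⟩
  rw [Finset.mem_sigma, Finset.mem_range, Fintype.mem_piFinset]
  refine ⟨Finset.le_sup (f := fun p : Σ k : ℕ, Fin (g k) → α => p.1 + 1) hp, fun i => ?_⟩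
  exact Finset.mem_biUnion.2 ⟨p, hp, Finset.mem_image_of_mem _ (Finset.mem_univ i)⟩

theorem sum_piFinset_succ {M : Type*} [AddCommMonoid M] [DecidableEq α] (F : Finset α) (k : ℕ)
    (f : α → List α → M) :
    ∑ C ∈ Fintype.piFinset (fun _ : Fin (k + 1) => F), f (C 0) (List.ofFn fun i : Fin k => C i.succ) =
      ∑ a ∈ F, listSum F k (f a) := by
  have h := listSum_eq_sum_piFinset F (k + 1) fun l => match l with
    | [] => 0
    | a :: l => f a l
  simp only [List.ofFn_succ] at h
  exact h.symm

/-- A term of the cluster expansion of a polymer model with hard core interaction. -/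
noncomputable def ursellTerm (inc : α → α → Prop) (w : α → ℂ) {k : ℕ} (C : Fin (k + 1) → α) : ℂ :=
  ((k + 1)! : ℂ)⁻¹ * ((rootedSum (hardCore inc) [C 0] (List.ofFn fun i : Fin k => C i.succ) : ℂ) *
    ∏ i, w (C i))

theorem prod_eq_mul_map_ofFn {M : Type*} [CommMonoid M] (w : α → M) {k : ℕ} (C : Fin (k + 1) → α) :
    ∏ i, w (C i) = w (C 0) * ((List.ofFn fun i : Fin k => C i.succ).map w).prod := by
  rw [Fin.prod_univ_succ, List.map_ofFn, List.prod_ofFn]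
  rfl

theorem ursellTerm_eq (inc : α → α → Prop) (w : α → ℂ) {k : ℕ} (C : Fin (k + 1) → α) :
    ursellTerm inc w C = ((k + 1)! : ℂ)⁻¹ * (w (C 0) *
      ((rootedSum (hardCore inc) [C 0] (List.ofFn fun i : Fin k => C i.succ) : ℂ) *
        ((List.ofFn fun i : Fin k => C i.succ).map w).prod)) := by
  rw [ursellTerm, prod_eq_mul_map_ofFn]
  ring

/-- Giving up a factor `k + 1` in the factorial makes the first polymer a root with `k` others, the
form that the Kotecký–Preiss bound controls. -/
theorem norm_ursellTerm_le (inc : α → α → Prop) (w : α → ℂ) {k : ℕ} (C : Fin (k + 1) → α) :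
    ‖ursellTerm inc w C‖ ≤ (k ! : ℝ)⁻¹ * (‖w (C 0)‖ *
      (|(rootedSum (hardCore inc) [C 0] (List.ofFn fun i : Fin k => C i.succ) : ℝ)| *
        ((List.ofFn fun i : Fin k => C i.succ).map fun c => ‖w c‖).prod)) := by
  rw [ursellTerm_eq, norm_mul, norm_mul, norm_mul, norm_inv, Complex.norm_natCast,
    Complex.norm_intCast, List.norm_prod, List.map_map]
  have h : ((k + 1)! : ℝ)⁻¹ ≤ (k ! : ℝ)⁻¹ := by
    gcongr
    exact Nat.le_succ k
  refine mul_le_mul_of_nonneg_right h ?_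
  have := prod_map_nonneg (w := norm ∘ w) (fun c => norm_nonneg _)
    (List.ofFn fun i : Fin k => C i.succ)
  positivity

section KP

variable {inc : α → α → Prop} {w : α → ℂ} {b : α → ℝ} {M : ℝ}

theorem sum_norm_ursellTerm_le
    (hb : ∀ (F : Finset α) v, ∑ c ∈ F, |(hardCore inc v c : ℝ)| * (‖w c‖ * Real.exp (b c)) ≤ b v)
    (hM : ∀ F : Finset α, ∑ c ∈ F, ‖w c‖ * Real.exp (b c) ≤ M)
    (s : Finset (Σ k : ℕ, Fin (k + 1) → α)) : ∑ p ∈ s, ‖ursellTerm inc w p.2‖ ≤ M := by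
  classical
  obtain ⟨K, F, hs⟩ := exists_subset_sigma_piFinset (g := Nat.succ) s
  refine (Finset.sum_le_sum_of_subset_of_nonneg hs fun p _ _ => norm_nonneg _).trans ?_
  rw [Finset.sum_sigma]
  refine le_trans (Finset.sum_le_sum fun k _ => Finset.sum_le_sum fun C _ =>
    norm_ursellTerm_le inc w C) ?_
  simp only [← Finset.mul_sum]
  have h1 : ∀ k : ℕ, ∑ C ∈ Fintype.piFinset (fun _ : Fin (k + 1) => F), ‖w (C 0)‖ *
      (|(rootedSum (hardCore inc) [C 0] (List.ofFn fun i : Fin k => C i.succ) : ℝ)| *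
        ((List.ofFn fun i : Fin k => C i.succ).map fun c => ‖w c‖).prod) =
      ∑ a ∈ F, ‖w a‖ * listSum F k (fun l => |(rootedSum (hardCore inc) [a] l : ℝ)| *
        (l.map fun c => ‖w c‖).prod) := fun k =>
    (sum_piFinset_succ F k fun a l => ‖w a‖ * (|(rootedSum (hardCore inc) [a] l : ℝ)| *
        (l.map fun c => ‖w c‖).prod)).trans
      (Finset.sum_congr rfl fun a _ => listSum_mul_left _ _ _ _)
  simp only [Nat.succ_eq_add_one, h1, Finset.mul_sum]
  rw [Finset.sum_comm]
  refine le_trans (Finset.sum_le_sum fun a _ => ?_) (hM F)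
  have h2 := sum_rootedSum_le (w := fun c => ‖w c‖) (fun c => norm_nonneg _) (hb F) K [a]
  rw [List.map_singleton, List.prod_singleton] at h2
  refine le_trans (le_of_eq ?_) (mul_le_mul_of_nonneg_left h2 (norm_nonneg (w a)))
  rw [Finset.mul_sum]
  exact Finset.sum_congr rfl fun k _ => by ring

theorem summable_norm_ursellTerm
    (hb : ∀ (F : Finset α) v, ∑ c ∈ F, |(hardCore inc v c : ℝ)| * (‖w c‖ * Real.exp (b c)) ≤ b v)
    (hM : ∀ F : Finset α, ∑ c ∈ F, ‖w c‖ * Real.exp (b c) ≤ M) :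
    Summable fun p : Σ k : ℕ, Fin (k + 1) → α => ‖ursellTerm inc w p.2‖ :=
  summable_of_sum_le (fun _ => norm_nonneg _) (sum_norm_ursellTerm_le hb hM)

theorem norm_tsum_ursellTerm_le
    (hb : ∀ (F : Finset α) v, ∑ c ∈ F, |(hardCore inc v c : ℝ)| * (‖w c‖ * Real.exp (b c)) ≤ b v)
    (hM : ∀ F : Finset α, ∑ c ∈ F, ‖w c‖ * Real.exp (b c) ≤ M) :
    ‖∑' p : Σ k : ℕ, Fin (k + 1) → α, ursellTerm inc w p.2‖ ≤ M :=
  (norm_tsum_le_tsum_norm (summable_norm_ursellTerm hb hM)).trans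
    ((summable_norm_ursellTerm hb hM).tsum_le_of_sum_le (sum_norm_ursellTerm_le hb hM))

theorem tsum_ursellTerm_rooted_le
    (hb : ∀ (F : Finset α) v, ∑ c ∈ F, |(hardCore inc v c : ℝ)| * (‖w c‖ * Real.exp (b c)) ≤ b v)
    (v : α) : ∑' m : ℕ, (m ! : ℝ≥0∞)⁻¹ * ∑' C : Fin m → α,
        ‖(rootedSum (hardCore inc) [v] (List.ofFn C) : ℂ)‖ₑ * ∏ i, ‖w (C i)‖ₑ ≤
      ENNReal.ofReal (Real.exp (b v)) := by
  classical
  simp only [← ENNReal.tsum_mul_left]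
  rw [← ENNReal.tsum_sigma' (f := fun p : Σ m : ℕ, Fin m → α => (p.1 ! : ℝ≥0∞)⁻¹ *
      (‖(rootedSum (hardCore inc) [v] (List.ofFn p.2) : ℂ)‖ₑ * ∏ i, ‖w (p.2 i)‖ₑ)),
    ENNReal.tsum_eq_iSup_sum]
  refine iSup_le fun s => ?_
  obtain ⟨K, F, hs⟩ := exists_subset_sigma_piFinset (g := id) s
  change s ⊆ (Finset.range K).sigma fun m => Fintype.piFinset fun _ : Fin m => F at hs
  refine (Finset.sum_le_sum_of_subset hs).trans ?_
  have h2 := sum_rootedSum_le (w := fun c => ‖w c‖) (fun c => norm_nonneg _) (hb F) K [v]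
  rw [List.map_singleton, List.prod_singleton] at h2
  refine le_trans (le_of_eq ?_) (ENNReal.ofReal_le_ofReal h2)
  have hnn : ∀ l : List α, 0 ≤ |(rootedSum (hardCore inc) [v] l : ℝ)| *
      (l.map fun c => ‖w c‖).prod := fun l =>
    mul_nonneg (abs_nonneg _) (prod_map_nonneg (fun c => norm_nonneg _) l)
  rw [Finset.sum_sigma, ENNReal.ofReal_sum_of_nonneg fun m _ =>
    mul_nonneg (by positivity) (listSum_nonneg hnn)]
  refine Finset.sum_congr rfl fun m _ => ?_
  rw [ENNReal.ofReal_mul (by positivity), listSum_eq_sum_piFinset,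
    ENNReal.ofReal_sum_of_nonneg fun C _ => hnn _, Finset.mul_sum]
  refine Finset.sum_congr rfl fun C _ => ?_
  rw [ENNReal.ofReal_inv_of_pos (by positivity), ENNReal.ofReal_natCast,
    ENNReal.ofReal_mul (abs_nonneg _), List.map_ofFn, List.prod_ofFn]
  simp only [Function.comp_apply]
  rw [ENNReal.ofReal_prod_of_nonneg fun i _ => norm_nonneg _, ← Complex.norm_intCast]
  simp only [ofReal_norm]

-- Restricting the polymers to `F` recovers the finite series; letting `F` grow then becomes
-- dominated convergence of one fixed series.
open scoped Classical in
theorem tsum_ite_ursellTerm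
    (hs : Summable fun p : Σ k : ℕ, Fin (k + 1) → α => ‖ursellTerm inc w p.2‖) (F : Finset α) :
    (Summable fun k : ℕ => ‖((k + 1)! : ℂ)⁻¹ * ∑ a ∈ F, w a * listSum F k
      (fun l => (rootedSum (hardCore inc) [a] l : ℂ) * (l.map w).prod)‖) ∧
    ∑' p : Σ k : ℕ, Fin (k + 1) → α, (if ∀ i, p.2 i ∈ F then ursellTerm inc w p.2 else 0) =
      ∑' k : ℕ, ((k + 1)! : ℂ)⁻¹ * ∑ a ∈ F, w a * listSum F k
        (fun l => (rootedSum (hardCore inc) [a] l : ℂ) * (l.map w).prod) := by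
  have h1 : ∀ k : ℕ, ((k + 1)! : ℂ)⁻¹ * ∑ a ∈ F, w a * listSum F k
        (fun l => (rootedSum (hardCore inc) [a] l : ℂ) * (l.map w).prod) =
      ∑ C ∈ Fintype.piFinset (fun _ : Fin (k + 1) => F), ursellTerm inc w C := by
    intro k
    simp only [ursellTerm_eq, ← Finset.mul_sum]
    congr 1
    refine Eq.symm ((sum_piFinset_succ F k fun a l => w a *
      ((rootedSum (hardCore inc) [a] l : ℂ) * (l.map w).prod)).trans ?_)
    exact Finset.sum_congr rfl fun a _ => listSum_mul_left _ _ _ _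
  constructor
  · refine Summable.of_nonneg_of_le (fun _ => norm_nonneg _) (fun k => ?_) hs.sigma
    rw [h1]
    exact (norm_sum_le _ _).trans
      ((hs.sigma_factor k).sum_le_tsum _ fun _ _ => norm_nonneg _)
  · have hs' : Summable fun p : Σ k : ℕ, Fin (k + 1) → α =>
        if ∀ i, p.2 i ∈ F then ursellTerm inc w p.2 else 0 := by
      refine Summable.of_norm_bounded hs fun p => ?_
      split_ifs
      · exact le_rfl
      · simp
    rw [hs'.tsum_sigma]
    refine tsum_congr fun k => ?_
    rw [h1, tsum_eq_sum (s := Fintype.piFinset fun _ : Fin (k + 1) => F)]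
    · exact Finset.sum_congr rfl fun C hC => if_pos (Fintype.mem_piFinset.1 hC)
    · exact fun C hC => if_neg fun h => hC (Fintype.mem_piFinset.2 h)

open scoped Classical in
theorem tendsto_tsum_ite_ursellTerm
    (hs : Summable fun p : Σ k : ℕ, Fin (k + 1) → α => ‖ursellTerm inc w p.2‖) :
    Tendsto (fun F : Finset α => ∑' p : Σ k : ℕ, Fin (k + 1) → α,
        if ∀ i, p.2 i ∈ F then ursellTerm inc w p.2 else 0) atTop
      (𝓝 (∑' p : Σ k : ℕ, Fin (k + 1) → α, ursellTerm inc w p.2)) := by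
  refine tendsto_tsum_of_dominated_convergence hs (fun p => ?_) (Eventually.of_forall fun F p => ?_)
  · refine tendsto_const_nhds.congr' ?_
    filter_upwards [eventually_ge_atTop (Finset.univ.image p.2)] with F hF
    exact (if_pos fun i => hF (Finset.mem_image_of_mem _ (Finset.mem_univ i))).symm
  · split_ifs
    · exact le_rfl
    · simp

end KP

open scoped Classical in
/-- A function of finite volumes that satisfies the site recursion with weights `ω` is the
exponential of the cluster expansion of the polymer model with these weights. -/
theorem eq_exp_tsum_ursellTerm {σ : Type*} [DecidableEq σ] {supp : α → Finset σ} {w : α → ℂ}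
    (hs : Summable fun p : Σ k : ℕ, Fin (k + 1) → α => ‖ursellTerm (Overlap supp) w p.2‖)
    {Z : Finset σ → ℂ} {ω : σ → Finset σ → ℂ}
    (hZ : ∀ A, ∀ x ∈ A, Z A = Z (A.erase x) + ∑ U ∈ A.powerset with x ∈ U, ω x U * Z (A \ U))
    (h0 : Tendsto (fun F : Finset α => Complex.exp (∑ c ∈ F with supp c = ∅, w c)) atTop (𝓝 (Z ∅)))
    (hω : ∀ x U, x ∈ U → HasSum (fun c => if supp c = U then w c else 0) (ω x U))
    {A : Finset σ} (hA : ∀ c, supp c ⊆ A) :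
    Z A = Complex.exp (∑' p : Σ k : ℕ, Fin (k + 1) → α, ursellTerm (Overlap supp) w p.2) := by
  have h := tendsto_of_site_recursion (L := atTop) (Z := Z)
    (X := fun (F : Finset α) A => expSum supp F (polymerWeight supp w) A) (ω := ω)
    (ω' := fun F x U => spannedSum supp F (polymerWeight supp w) x U) hZ
    (fun F A x _ => (polymerWeight_factorizes w).expSum_eq (fun c => norm_nonneg (w c))
      (fun l _ => norm_polymerWeight_le w l) A x) ?_ ?_ A
  -- Both sides are limits of the same finite partition functions, once through the recursion and
  -- once through their Mayer series.
  · refine tendsto_nhds_unique h ?_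
    refine ((Complex.continuous_exp.tendsto _).comp (tendsto_tsum_ite_ursellTerm hs)).congr fun F => ?_
    rw [Function.comp_apply, (tsum_ite_ursellTerm hs F).2,
      ← tsum_polymerWeight_eq_exp F w (tsum_ite_ursellTerm hs F).1, expSum,
      Finset.filter_true_of_mem fun c _ => hA c]
  · refine h0.congr fun F => ?_
    rw [(polymerWeight_factorizes w).expSum_empty]
    congr 1
    refine Finset.sum_congr rfl fun c _ => ?_
    simp [polymerWeight, pairProd]
  · intro x U hx
    refine (hω x U hx).congr fun F => ?_
    rw [spannedSum_polymerWeight F w hx, Finset.sum_filter]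

end Ursell

open QLattice

/-! ### The convergence criterion for clusters -/

section Bounds

variable {d N : ℕ} {Λ : Finset (Site d)}

/-- The cluster that consists of the empty set. -/
def emptyCluster (Λ : Finset (Site d)) : Cluster Λ where
  n := 1
  X _ := ⟨∅, Finset.empty_mem_powerset Λ⟩
  connected := ⟨fun i j => by rw [Subsingleton.elim i j]⟩

theorem emptyCluster_supp : (emptyCluster Λ).supp = ∅ := by
  refine Finset.eq_empty_of_forall_notMem fun x hx => ?_
  obtain ⟨i, hi⟩ := mem_cluster_supp.1 hx
  exact absurd hi (Finset.notMem_empty x)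

/-- The empty set overlaps nothing, not even a copy of itself, so a connected sequence of empty sets
has length 1. -/
theorem eq_emptyCluster {C : Cluster Λ} (h : C.supp = ∅) : C = emptyCluster Λ := by
  obtain ⟨n, X, hX⟩ := C
  have hX0 : ∀ i, (X i).1 = ∅ := fun i =>
    Finset.subset_empty.1 (h ▸ fun x hx => mem_cluster_supp.2 ⟨i, hx⟩)
  have hn : Subsingleton (Fin n) := by
    refine ⟨fun i j => ?_⟩
    obtain ⟨p⟩ := hX.preconnected i j
    cases p with
    | nil => rfl
    | cons hadj _ =>
      obtain ⟨y, hy⟩ := hadj.2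
      have hy := (Finset.mem_inter.1 hy).1
      simp [hX0] at hy
  obtain ⟨i⟩ := hX.nonempty
  have h1 : n = 1 := by
    have := Fin.subsingleton_iff_le_one.1 hn
    have := i.2
    omega
  subst h1
  unfold emptyCluster
  congr
  funext i
  exact Subtype.ext (hX0 i)

theorem opNorm_smul (z : ℂ) (Φ : Interaction d N) (X : Finset (Site d)) :
    opNorm ((z • Φ) X) = ‖z‖ₑ * opNorm (Φ X) := by
  rw [opNorm, opNorm, Pi.smul_apply, map_smul, enorm_smul]

theorem opNorm_ne_top {X : Finset (Site d)} (A : LocalAlg N X) : opNorm A ≠ ∞ :=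
  enorm_ne_top

theorem termNorm_smul (z : ℂ) (Φ : Interaction d N) (X : Finset (Site d)) :
    termNorm (z • Φ) X = ‖z‖ * termNorm Φ X := by
  rw [termNorm, termNorm, opNorm_smul, ENNReal.toReal_mul, toReal_enorm]

theorem norm_weight_le (Φ : Interaction d N) (β : ℂ) (C : Cluster Λ) :
    ‖weight Φ β C‖ ≤ (C.n ! : ℝ)⁻¹ * ((List.ofFn C.X).map fun X => termNorm (-β • Φ) X.1).prod := by
  rw [weight_eq, norm_mul, norm_inv, Complex.norm_natCast]
  exact mul_le_mul_of_nonneg_left (norm_traceProd_le _ _) (by positivity)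

theorem exp_card_listSupp_le {a : ℝ} (ha : 0 ≤ a) (l : List Λ.powerset) :
    Real.exp (a * (listSupp termSupp l).card) ≤
      (l.map fun X => Real.exp (a * (termSupp X).card)).prod := by
  induction l with
  | nil => simp [listSupp]
  | cons X l ih =>
    rw [List.map_cons, List.prod_cons, listSupp]
    refine le_trans ?_ (mul_le_mul_of_nonneg_left ih (Real.exp_pos _).le)
    rw [← Real.exp_add, ← mul_add]
    gcongr
    exact_mod_cast Finset.card_union_le _ _

section Convergence

variable {Φ : Interaction d N} {β : ℂ} {a : ℝ}

theorem sum_termNorm_le {r : ℝ} (hr : 0 ≤ r) (ha : 0 ≤ a)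
    (h : ‖β‖ₑ * interactionNorm Φ r ≤ ENNReal.ofReal a) (x : Site d) :
    ∑ X : Λ.powerset with x ∈ termSupp X, termNorm (-β • Φ) X.1 * r ^ (termSupp X).card ≤ a := by
  rw [← ENNReal.ofReal_le_ofReal_iff ha]
  refine le_trans ?_ h
  have hle : ‖β‖ₑ * ∑' X : {X : Finset (Site d) // x ∈ X}, opNorm (Φ X.1) * ENNReal.ofReal r ^ X.1.card
      ≤ ‖β‖ₑ * interactionNorm Φ r :=
    mul_le_mul_right (le_iSup (fun x : Site d => ∑' X : {X : Finset (Site d) // x ∈ X},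
      opNorm (Φ X.1) * ENNReal.ofReal r ^ X.1.card) x) _
  refine le_trans ?_ hle
  have hsub : ∑' X : {X : Finset (Site d) // x ∈ X}, opNorm (Φ X.1) * ENNReal.ofReal r ^ X.1.card =
      ∑' X : Finset (Site d), Set.indicator {X | x ∈ X}
        (fun X => opNorm (Φ X) * ENNReal.ofReal r ^ X.card) X :=
    tsum_subtype {X : Finset (Site d) | x ∈ X} fun X => opNorm (Φ X) * ENNReal.ofReal r ^ X.card
  rw [hsub]
  refine le_trans ?_ (mul_le_mul_right (ENNReal.sum_le_tsum Λ.powerset) _)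
  rw [← Finset.sum_coe_sort Λ.powerset, Finset.mul_sum, Finset.sum_filter,
    ENNReal.ofReal_sum_of_nonneg fun X _ => ?_]
  · refine Finset.sum_le_sum fun X _ => ?_
    by_cases hx : x ∈ X.1
    · rw [if_pos (show x ∈ termSupp X from hx), Set.indicator_of_mem (show X.1 ∈ {X | x ∈ X} from hx),
        ENNReal.ofReal_mul (termNorm_nonneg _ _), termNorm, ENNReal.ofReal_toReal (opNorm_ne_top _),
        opNorm_smul, enorm_neg, ENNReal.ofReal_pow hr, mul_assoc]
      rfl
    · rw [if_neg (show x ∉ termSupp X from hx), ENNReal.ofReal_zero]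
      exact zero_le
  · split_ifs
    · exact mul_nonneg (termNorm_nonneg _ _) (pow_nonneg hr _)
    · exact le_rfl

/-- The exploration bound with $u(X)=\|\beta\Phi_X\|e^{a|X|}$, started at the single site `x`. -/
theorem sum_norm_weight_mem_le (ha : 0 < a)
    (h : ‖β‖ₑ * interactionNorm Φ (Real.exp a * (1 + a)) ≤ ENNReal.ofReal a) (F : Finset (Cluster Λ)) (x : Site d) :
    ∑ C ∈ F with x ∈ C.supp, ‖weight Φ β C‖ * Real.exp (a * C.supp.card) ≤ a := by
  classical
  by_cases hx : x ∈ Λ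
  swap
  · rw [Finset.sum_eq_zero]
    · exact ha.le
    · intro C hC
      obtain ⟨i, hi⟩ := mem_cluster_supp.1 (Finset.mem_filter.1 hC).2
      exact absurd (Finset.mem_powerset.1 (C.X i).2 hi) hx
  set u : Λ.powerset → ℝ := fun X => termNorm (-β • Φ) X.1 * Real.exp (a * (termSupp X).card) with hu
  have hu0 : ∀ X, 0 ≤ u X := fun X => mul_nonneg (termNorm_nonneg _ _) (Real.exp_pos _).le
  set K := F.sup (fun C => C.n) + 1 with hK
  have hsp := sum_spanned_le (supp := termSupp) hu0 ha.le Λ Finset.univ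
    (fun X _ => Finset.mem_powerset.1 X.2) (fun x => ?_) K {x} (Finset.singleton_subset_iff.2 hx)
  · rw [hK, Finset.sum_range_succ', Finset.card_singleton, pow_one] at hsp
    -- The empty sequence, which is not a cluster, contributes exactly 1; removing it lowers the
    -- bound from `1 + a` to `a`.
    have h0 : listSum (Finset.univ : Finset Λ.powerset) 0
        (fun l => if Spanned termSupp {x} l then (l.map u).prod else 0) = 1 := by
      rw [listSum, if_pos]
      · simp
      · exact ⟨by simp, by simp⟩
    rw [h0, Nat.factorial_zero, Nat.cast_one, inv_one, mul_one, add_comm, add_le_add_iff_left] at hsp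
    refine le_trans ?_ hsp
    set G : (Σ n : ℕ, Fin n → Λ.powerset) → ℝ := fun p => (p.1 ! : ℝ)⁻¹ *
      if Spanned termSupp {x} (List.ofFn p.2) then ((List.ofFn p.2).map u).prod else 0 with hG
    have hG0 : ∀ p, 0 ≤ G p := fun p => by
      refine mul_nonneg (by positivity) ?_
      split_ifs
      · exact prod_map_nonneg hu0 _
      · exact le_rfl
    calc ∑ C ∈ F with x ∈ C.supp, ‖weight Φ β C‖ * Real.exp (a * C.supp.card)
        ≤ ∑ C ∈ F with x ∈ C.supp, G (clusterSeq C) := by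
          refine Finset.sum_le_sum fun C hC => ?_
          have hxC := mem_cluster_supp.1 (Finset.mem_filter.1 hC).2
          simp only [hG, clusterSeq, if_pos (spanned_of_connected C.connected hxC)]
          rw [hu, List.prod_map_mul, ← mul_assoc]
          refine mul_le_mul (norm_weight_le Φ β C) ?_ (Real.exp_pos _).le ?_
          · rw [cluster_supp_eq]
            exact exp_card_listSupp_le ha.le _
          · exact mul_nonneg (by positivity)
              (prod_map_nonneg (fun X : Λ.powerset => termNorm_nonneg _ X.1) _)
      _ = ∑ p ∈ (F.filter fun C => x ∈ C.supp).image clusterSeq, G p :=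
          (Finset.sum_image clusterSeq_injective.injOn).symm
      _ ≤ ∑ p ∈ (Finset.Ico 1 K).sigma fun n => (Finset.univ : Finset (Fin n → Λ.powerset)), G p := by
          refine Finset.sum_le_sum_of_subset_of_nonneg (fun p hp => ?_) fun p _ _ => hG0 p
          obtain ⟨C, hC, rfl⟩ := Finset.mem_image.1 hp
          rw [Finset.mem_sigma, Finset.mem_Ico]
          refine ⟨⟨Nat.one_le_iff_ne_zero.2 (cluster_n_ne_zero C), Nat.lt_succ_of_le ?_⟩,
            Finset.mem_univ _⟩
          exact Finset.le_sup (f := fun C : Cluster Λ => C.n) (Finset.mem_filter.1 hC).1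
      _ = _ := by
          rw [Finset.sum_sigma, hK, Finset.sum_Ico_eq_sum_range]
          refine Finset.sum_congr rfl fun n _ => ?_
          rw [add_comm 1 n, listSum_eq_sum_piFinset, Fintype.piFinset_univ, Finset.mul_sum]
  · refine le_trans (le_of_eq ?_) (sum_termNorm_le (Λ := Λ) (by positivity) ha.le h x)
    refine Finset.sum_congr rfl fun X _ => ?_
    simp only [hu]
    rw [mul_pow, ← Real.exp_nat_mul, mul_comm a, mul_assoc]

/-- A cluster overlapping `C₀` contains one of its sites; a union bound over these sites gives the
Kotecký–Preiss criterion with $b(C)=a|\operatorname{supp}C|$. -/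
theorem sum_hardCore_mul_norm_weight_le (ha : 0 < a)
    (h : ‖β‖ₑ * interactionNorm Φ (Real.exp a * (1 + a)) ≤ ENNReal.ofReal a) (F : Finset (Cluster Λ)) (C₀ : Cluster Λ) :
    ∑ C ∈ F, |(hardCore (Overlap Cluster.supp) C₀ C : ℝ)| *
      (‖weight Φ β C‖ * Real.exp (a * C.supp.card)) ≤ a * C₀.supp.card := by
  classical
  have hnn : ∀ C : Cluster Λ, 0 ≤ ‖weight Φ β C‖ * Real.exp (a * C.supp.card) := fun C => by positivity
  calc ∑ C ∈ F, |(hardCore (Overlap Cluster.supp) C₀ C : ℝ)| *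
        (‖weight Φ β C‖ * Real.exp (a * C.supp.card))
      ≤ ∑ C ∈ F, ∑ x ∈ C₀.supp, if x ∈ C.supp then
          ‖weight Φ β C‖ * Real.exp (a * C.supp.card) else 0 := by
        refine Finset.sum_le_sum fun C _ => ?_
        have hnn' : ∀ x ∈ C₀.supp, 0 ≤ if x ∈ C.supp then
            ‖weight Φ β C‖ * Real.exp (a * C.supp.card) else 0 := fun x _ => by
          split_ifs
          · exact hnn C
          · exact le_rfl
        by_cases hov : Overlap Cluster.supp C₀ C
        · obtain ⟨x, hx⟩ := id hov
          rw [Finset.mem_inter] at hx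
          refine le_trans (le_of_eq ?_) (Finset.single_le_sum hnn' hx.1)
          rw [if_pos hx.2, hardCore, if_pos hov]
          simp
        · rw [hardCore, if_neg hov]
          simpa using Finset.sum_nonneg hnn'
    _ = ∑ x ∈ C₀.supp, ∑ C ∈ F with x ∈ C.supp, ‖weight Φ β C‖ * Real.exp (a * C.supp.card) := by
        rw [Finset.sum_comm]
        simp only [Finset.sum_filter]
    _ ≤ ∑ x ∈ C₀.supp, a := Finset.sum_le_sum fun x _ => sum_norm_weight_mem_le ha h F x
    _ = a * C₀.supp.card := by rw [Finset.sum_const, nsmul_eq_mul, mul_comm]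

/-- The empty cluster has to be counted apart: no site sees it, and the interaction norm does not
control `Φ ∅`. -/
theorem sum_norm_weight_le (ha : 0 < a)
    (h : ‖β‖ₑ * interactionNorm Φ (Real.exp a * (1 + a)) ≤ ENNReal.ofReal a) (F : Finset (Cluster Λ)) :
    ∑ C ∈ F, ‖weight Φ β C‖ * Real.exp (a * C.supp.card) ≤ ‖β‖ * termNorm Φ ∅ + a * Λ.card := by
  classical
  have hnn : ∀ C : Cluster Λ, 0 ≤ ‖weight Φ β C‖ * Real.exp (a * C.supp.card) := fun C => by positivity
  rw [← Finset.sum_filter_add_sum_filter_not F fun C => C.supp = ∅]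
  refine add_le_add ?_ ?_
  · have hsub : F.filter (fun C => C.supp = ∅) ⊆ {emptyCluster Λ} := fun C hC =>
      Finset.mem_singleton.2 (eq_emptyCluster (Finset.mem_filter.1 hC).2)
    refine (Finset.sum_le_sum_of_subset_of_nonneg hsub fun C _ _ => hnn C).trans ?_
    rw [Finset.sum_singleton, emptyCluster_supp]
    have := norm_weight_le Φ β (emptyCluster Λ)
    rw [show (List.ofFn (emptyCluster Λ).X) = [⟨∅, Finset.empty_mem_powerset Λ⟩] from rfl,
      List.map_singleton, List.prod_singleton, termNorm_smul, norm_neg] at this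
    simpa [emptyCluster] using this
  · calc ∑ C ∈ F with ¬ C.supp = ∅, ‖weight Φ β C‖ * Real.exp (a * C.supp.card)
        ≤ ∑ C ∈ F, ∑ x ∈ Λ, if x ∈ C.supp then
            ‖weight Φ β C‖ * Real.exp (a * C.supp.card) else 0 := by
          rw [Finset.sum_filter]
          refine Finset.sum_le_sum fun C _ => ?_
          have hnn' : ∀ x ∈ Λ, 0 ≤ if x ∈ C.supp then
              ‖weight Φ β C‖ * Real.exp (a * C.supp.card) else 0 := fun x _ => by
            split_ifs
            · exact hnn C
            · exact le_rfl
          split_ifs with hC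
          · exact Finset.sum_nonneg hnn'
          · obtain ⟨x, hx⟩ := Finset.nonempty_iff_ne_empty.2 hC
            obtain ⟨i, hi⟩ := mem_cluster_supp.1 hx
            refine le_trans (le_of_eq ?_)
              (Finset.single_le_sum hnn' (Finset.mem_powerset.1 (C.X i).2 hi))
            rw [if_pos hx]
      _ = ∑ x ∈ Λ, ∑ C ∈ F with x ∈ C.supp, ‖weight Φ β C‖ * Real.exp (a * C.supp.card) := by
          rw [Finset.sum_comm]
          simp only [Finset.sum_filter]
      _ ≤ ∑ x ∈ Λ, a := Finset.sum_le_sum fun x _ => sum_norm_weight_mem_le ha h F x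
      _ = a * Λ.card := by rw [Finset.sum_const, nsmul_eq_mul, mul_comm]

end Convergence

end Bounds

open QLattice

/-! ### The cluster expansion of the partition function -/

section Expansion

variable {d N : ℕ} {Λ : Finset (Site d)} {Φ : Interaction d N} {β : ℂ} {a : ℝ}

theorem clusterTerm_div_factorial_eq {k : ℕ} (C : Fin (k + 1) → Cluster Λ) :
    1 / ((k + 1)! : ℂ) * clusterTerm Φ β C =
      ursellTerm (Overlap Cluster.supp) (weight Φ β) C := by
  rw [clusterTerm, ursellTerm, phi_eq_rootedSum, one_div]

/-- The cluster expansion of the logarithm of the partition function. -/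
noncomputable def clusterSum (Φ : Interaction d N) (Λ : Finset (Site d)) (β : ℂ) : ℂ :=
  ∑' p : Σ k : ℕ, Fin (k + 1) → Cluster Λ, 1 / ((p.1 + 1)! : ℂ) * clusterTerm Φ β p.2

theorem summable_norm_clusterTerm (ha : 0 < a)
    (h : ‖β‖ₑ * interactionNorm Φ (Real.exp a * (1 + a)) ≤ ENNReal.ofReal a) :
    Summable fun p : Σ k : ℕ, (Fin (k + 1) → Cluster Λ) =>
      ‖1 / ((p.1 + 1)! : ℂ) * clusterTerm Φ β p.2‖ := by
  simp only [clusterTerm_div_factorial_eq]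
  exact summable_norm_ursellTerm (sum_hardCore_mul_norm_weight_le ha h) (sum_norm_weight_le ha h)

theorem norm_clusterSum_le (ha : 0 < a)
    (h : ‖β‖ₑ * interactionNorm Φ (Real.exp a * (1 + a)) ≤ ENNReal.ofReal a) :
    ‖clusterSum Φ Λ β‖ ≤ ‖β‖ * termNorm Φ ∅ + a * Λ.card := by
  simp only [clusterSum, clusterTerm_div_factorial_eq]
  exact norm_tsum_ursellTerm_le (sum_hardCore_mul_norm_weight_le ha h) (sum_norm_weight_le ha h)

theorem clusterSum_eq (ha : 0 < a)
    (h : ‖β‖ₑ * interactionNorm Φ (Real.exp a * (1 + a)) ≤ ENNReal.ofReal a) :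
    clusterSum Φ Λ β = ∑' k : ℕ, 1 / ((k + 1)! : ℂ) *
      ∑' C : Fin (k + 1) → Cluster Λ, clusterTerm Φ β C := by
  rw [clusterSum, (summable_norm_clusterTerm ha h).of_norm.tsum_sigma]
  exact tsum_congr fun k => by simp only [tsum_mul_left]

theorem partitionFunction_eq_exp_clusterSum (hN : 1 ≤ N) (ha : 0 < a)
    (h : ‖β‖ₑ * interactionNorm Φ (Real.exp a * (1 + a)) ≤ ENNReal.ofReal a) :
    partitionFunction Φ Λ β = Complex.exp (clusterSum Φ Λ β) := by
  classical
  have hs := summable_norm_clusterTerm (Λ := Λ) ha h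
  simp only [clusterTerm_div_factorial_eq] at hs
  simp only [partitionFunction_eq_expSum, clusterSum, clusterTerm_div_factorial_eq]
  have hfac := traceProd_factorizes (Λ := Λ) hN (-β • Φ)
  refine eq_exp_tsum_ursellTerm hs (Z := expSum termSupp Finset.univ (traceProd (-β • Φ)))
    (fun A x _ => hfac.expSum_eq (fun X => termNorm_nonneg (-β • Φ) X.1)
      (fun l _ => norm_traceProd_le _ l) A x) ?_ (fun x U hx => hasSum_weight_supp_eq Φ β hx)
    fun C x hx => ?_
  · rw [hfac.expSum_empty]
    have h1 : (Finset.univ.filter fun X : Λ.powerset => termSupp X = ∅) =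
        {⟨∅, Finset.empty_mem_powerset Λ⟩} := by
      ext X
      rw [Finset.mem_filter, Finset.mem_singleton, Subtype.ext_iff]
      exact and_iff_right (Finset.mem_univ X)
    rw [h1, Finset.sum_singleton]
    refine tendsto_const_nhds.congr' ?_
    -- Starting value of the recursion: as soon as `F` contains the empty cluster, the two values at
    -- the empty volume agree exactly.
    filter_upwards [eventually_ge_atTop {emptyCluster Λ}] with F hF
    have h2 : (F.filter fun C => C.supp = ∅) = {emptyCluster Λ} := by
      refine Finset.Subset.antisymm (fun C hC =>
        Finset.mem_singleton.2 (eq_emptyCluster (Finset.mem_filter.1 hC).2)) ?_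
      rw [Finset.singleton_subset_iff, Finset.mem_filter]
      exact ⟨hF (Finset.mem_singleton_self _), emptyCluster_supp⟩
    rw [h2, Finset.sum_singleton, weight_eq]
    simp [emptyCluster]
  · obtain ⟨i, hi⟩ := mem_cluster_supp.1 hx
    exact Finset.mem_powerset.1 (C.X i).2 hi

/-- Since $k/k!=1/(k-1)!$, this is the rooted sum over the $k-1$ other clusters; the leading 1 is
its term without other clusters. -/
theorem tsum_rooted_clusters_le (ha : 0 < a)
    (h : ‖β‖ₑ * interactionNorm Φ (Real.exp a * (1 + a)) ≤ ENNReal.ofReal a) (C₁ : Cluster Λ) :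
    1 + ∑' k : ℕ, ((k + 2 : ℕ) : ℝ≥0∞) / ((k + 2)! : ℝ≥0∞) *
        ∑' C : Fin (k + 1) → Cluster Λ,
          ‖(phi (Fin.cons C₁ C : Fin (k + 2) → Cluster Λ) : ℂ)‖ₑ * ∏ i, ‖weight Φ β (C i)‖ₑ
      ≤ ENNReal.ofReal (Real.exp (a * (C₁.supp.card : ℝ))) := by
  refine le_trans (le_of_eq ?_)
    (tsum_ursellTerm_rooted_le (b := fun C : Cluster Λ => a * (C.supp.card : ℝ))
      (sum_hardCore_mul_norm_weight_le ha h) C₁)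
  refine Eq.trans ?_ (tsum_eq_zero_add' ENNReal.summable).symm
  congr 1
  · simp [rootedSum_cons, rootedSum_nil_left, splitSum]
  · refine tsum_congr fun k => ?_
    congr 1
    · rw [Nat.factorial_succ (k + 1), Nat.cast_mul, div_eq_mul_inv,
        ENNReal.mul_inv (Or.inr (ENNReal.natCast_ne_top _)) (Or.inl (ENNReal.natCast_ne_top _)),
        ← mul_assoc, ENNReal.mul_inv_cancel (by positivity) (ENNReal.natCast_ne_top _), one_mul]
    · refine tsum_congr fun C => ?_
      rw [phi_eq_rootedSum]
      simp only [Fin.cons_zero, Fin.cons_succ]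

end Expansion

/-! ### Limits of bounded sequences of analytic functions -/

/-- A locally bounded sequence of analytic functions on a disc has an analytic function on the disc
that agrees with the limit wherever the sequence converges. -/
theorem exists_analyticOnNhd_of_bounded {D : Set ℂ}
    (hD : ∀ z ∈ D, ∃ ρ, ‖z‖ < ρ ∧ Metric.closedBall 0 ρ ⊆ D) {F : ℕ → ℂ → ℂ}
    (hF : ∀ᶠ m in atTop, AnalyticOnNhd ℂ (F m) D)
    (hM : ∀ ρ, Metric.closedBall 0 ρ ⊆ D →
      ∃ M : ℝ, ∀ᶠ m in atTop, ∀ z ∈ Metric.closedBall 0 ρ, ‖F m z‖ ≤ M) :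
    ∃ G : ℂ → ℂ, AnalyticOnNhd ℂ G D ∧
      ∀ z ∈ D, ∀ y, Tendsto (fun m => F m z) atTop (𝓝 y) → G z = y := by
  rcases D.eq_empty_or_nonempty with rfl | ⟨z₀, hz₀⟩
  · exact ⟨0, by simp [AnalyticOnNhd], by simp⟩
  -- Taylor coefficients at 0, bounded uniformly in `m` by Cauchy's estimate.
  set c : ℕ → ℕ → ℂ := fun m j => (j ! : ℂ)⁻¹ * iteratedDeriv j (F m) 0 with hc
  have hcauchy : ∀ ρ, 0 < ρ → Metric.closedBall 0 ρ ⊆ D →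
      ∃ M : ℝ, ∀ᶠ m in atTop, ∀ j, ‖c m j‖ ≤ M / ρ ^ j := by
    intro ρ hρ hρD
    obtain ⟨M, hM⟩ := hM ρ hρD
    refine ⟨M, ?_⟩
    filter_upwards [hM, hF] with m hm hFm j
    have hd : DifferentiableOn ℂ (F m) (closure (Metric.ball 0 ρ)) := by
      rw [closure_ball _ hρ.ne']
      exact (hFm.mono hρD).differentiableOn
    have := Complex.norm_iteratedDeriv_le_of_forall_mem_sphere_norm_le j hρ hd.diffContOnCl
      fun z hz => hm z (Metric.sphere_subset_closedBall hz)
    rw [hc, norm_mul, norm_inv, Complex.norm_natCast]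
    refine (mul_le_mul_of_nonneg_left this (by positivity)).trans (le_of_eq ?_)
    have : (j ! : ℝ) ≠ 0 := by positivity
    field_simp
  -- Along a free ultrafilter all coefficients converge at once, so no subsequence has to be chosen.
  -- Ordinary limits, where they exist, coincide with the limits along it.
  set L := (hyperfilter ℕ : Filter ℕ) with hL
  have hLtop : L ≤ atTop := Nat.hyperfilter_le_atTop
  have hlim : ∀ j, ∃ y, Tendsto (fun m => c m j) L (𝓝 y) := by
    intro j
    obtain ⟨ρ, hρ, hρD⟩ := hD z₀ hz₀
    obtain ⟨M, hM⟩ := hcauchy ρ ((norm_nonneg _).trans_lt hρ) hρD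
    have hmem : ∀ᶠ m in L, c m j ∈ Metric.closedBall (0 : ℂ) (M / ρ ^ j) := by
      filter_upwards [hM.filter_mono hLtop] with m hm
      rw [mem_closedBall_zero_iff]
      exact hm j
    obtain ⟨y, _, hy⟩ := isCompact_iff_ultrafilter_le_nhds.1
      (isCompact_closedBall (0 : ℂ) (M / ρ ^ j)) ((hyperfilter ℕ).map fun m => c m j)
      (tendsto_principal.2 hmem)
    exact ⟨y, hy⟩
  choose e he using hlim
  have hebound : ∀ ρ, 0 < ρ → Metric.closedBall 0 ρ ⊆ D → ∃ M : ℝ,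
      (∀ᶠ m in L, ∀ j, ‖c m j‖ ≤ M / ρ ^ j) ∧ ∀ j, ‖e j‖ ≤ M / ρ ^ j := by
    intro ρ hρ hρD
    obtain ⟨M, hM⟩ := hcauchy ρ hρ hρD
    have hM' := hM.filter_mono hLtop
    exact ⟨M, hM', fun j => le_of_tendsto (he j).norm (hM'.mono fun m hm => hm j)⟩
  have hgeom : ∀ {M ρ r : ℝ} {b : ℕ → ℂ} {z : ℂ}, 0 < ρ → ‖z‖ ≤ r → (∀ j, ‖b j‖ ≤ M / ρ ^ j) → ∀ j,
      ‖b j * z ^ j‖ ≤ M * (r / ρ) ^ j := by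
    intro M ρ r b z hρ hz hb j
    rw [norm_mul, norm_pow, div_pow, ← mul_div_assoc, mul_comm M, mul_div_assoc, mul_comm (r ^ j)]
    exact mul_le_mul (hb j) (pow_le_pow_left₀ (norm_nonneg z) hz j) (by positivity)
      ((norm_nonneg _).trans (hb j))
  refine ⟨fun z => ∑' j, e j * z ^ j, fun z hz => ?_, fun z hz y hy => ?_⟩
  · obtain ⟨ρ, hρ, hρD⟩ := hD z hz
    obtain ⟨r, hr, hr'⟩ := exists_between hρ
    have hr0 : 0 < r := (norm_nonneg z).trans_lt hr
    obtain ⟨M, -, hM⟩ := hebound ρ (hr0.trans hr') hρD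
    refine DifferentiableOn.analyticAt (s := Metric.ball 0 r) ?_
      (Metric.isOpen_ball.mem_nhds (mem_ball_zero_iff.2 hr))
    refine Complex.differentiableOn_tsum_of_summable_norm (u := fun j => M * (r / ρ) ^ j)
      (Summable.mul_left _ (summable_geometric_of_lt_one (div_nonneg hr0.le (hr0.trans hr').le)
        ((div_lt_one (hr0.trans hr')).2 hr'))) (fun j => ?_) Metric.isOpen_ball fun j w hw => ?_
    · fun_prop
    · exact hgeom (hr0.trans hr') (mem_ball_zero_iff.1 hw).le hM j
  · obtain ⟨ρ, hρ, hρD⟩ := hD z hz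
    have hρ0 : 0 < ρ := (norm_nonneg z).trans_lt hρ
    obtain ⟨M, hM, -⟩ := hebound ρ hρ0 hρD
    refine tendsto_nhds_unique ?_ (hy.mono_left hLtop)
    have hser : ∀ᶠ m in L, ∑' j, c m j * z ^ j = F m z := by
      filter_upwards [hF.filter_mono hLtop] with m hm
      have := Complex.taylorSeries_eq_on_ball' (c := 0) (mem_ball_zero_iff.2 hρ)
        ((hm.mono (Metric.ball_subset_closedBall.trans hρD)).differentiableOn)
      simpa only [sub_zero] using this
    refine Tendsto.congr' hser ?_
    refine tendsto_tsum_of_dominated_convergence (bound := fun j => M * (‖z‖ / ρ) ^ j)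
      (Summable.mul_left _ (summable_geometric_of_lt_one (by positivity)
        ((div_lt_one hρ0).2 hρ))) (fun j => (he j).mul_const _) ?_
    filter_upwards [hM] with m hm j
    exact hgeom hρ0 le_rfl hm j

open QLattice

/-! ### Analyticity of the free energy -/

section FreeEnergy

variable {d N : ℕ} {Λ : Finset (Site d)} {Φ : Interaction d N} {a : ℝ}

theorem mem_highTempDisc_iff (ha : 0 < a)
    (hΦ : interactionNorm Φ (Real.exp a * (1 + a)) ≠ ∞) {β : ℂ} :
    β ∈ highTempDisc Φ a ↔ ‖β‖ * (interactionNorm Φ (Real.exp a * (1 + a))).toReal < a := by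
  rw [highTempDisc, Set.mem_ofPred_eq, ← ENNReal.ofReal_lt_ofReal_iff ha,
    ENNReal.ofReal_mul (norm_nonneg _), ENNReal.ofReal_toReal hΦ, ofReal_norm]

theorem exists_closedBall_subset_highTempDisc (ha : 0 < a)
    (hΦ : interactionNorm Φ (Real.exp a * (1 + a)) ≠ ∞) {β : ℂ} (hβ : β ∈ highTempDisc Φ a) :
    ∃ ρ, ‖β‖ < ρ ∧ Metric.closedBall 0 ρ ⊆ highTempDisc Φ a := by
  set s := (interactionNorm Φ (Real.exp a * (1 + a))).toReal with hs
  have hs0 : 0 ≤ s := ENNReal.toReal_nonneg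
  rw [mem_highTempDisc_iff ha hΦ] at hβ
  have hpos : 0 < (a - ‖β‖ * s) / (s + 1) := div_pos (sub_pos.2 hβ) (by positivity)
  -- Dividing by `s + 1` covers `s = 0` and uses up less than the gap `a - ‖β‖ * s`.
  refine ⟨‖β‖ + (a - ‖β‖ * s) / (s + 1), by linarith, fun z hz => ?_⟩
  rw [mem_highTempDisc_iff ha hΦ]
  refine (mul_le_mul_of_nonneg_right (mem_closedBall_zero_iff.1 hz) hs0).trans_lt ?_
  have h1 : (a - ‖β‖ * s) / (s + 1) * (s + 1) = a - ‖β‖ * s := div_mul_cancel₀ _ (by positivity)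
  linarith

theorem norm_weight_le_of_norm_le {β β' : ℂ} (h : ‖β‖ ≤ ‖β'‖) (C : Cluster Λ) :
    ‖weight Φ β C‖ ≤ ‖weight Φ β' C‖ := by
  rw [weight, weight, norm_mul, norm_mul, norm_div, norm_div, norm_pow, norm_pow, norm_neg, norm_neg]
  gcongr

/-- Cluster weights grow with `‖β‖`, so on the disc of radius `ρ` the series is dominated termwise
by its absolutely convergent value at the real point `ρ`. -/
theorem clusterSum_analyticOnNhd (ha : 0 < a)
    (hΦ : interactionNorm Φ (Real.exp a * (1 + a)) ≠ ∞) :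
    AnalyticOnNhd ℂ (clusterSum Φ Λ) (highTempDisc Φ a) := by
  intro β hβ
  obtain ⟨ρ, hρ, hρD⟩ := exists_closedBall_subset_highTempDisc ha hΦ hβ
  have hρ0 : 0 < ρ := (norm_nonneg β).trans_lt hρ
  have hnρ : ‖(ρ : ℂ)‖ = ρ := Complex.norm_of_nonneg hρ0.le
  have hmem : (ρ : ℂ) ∈ highTempDisc Φ a := hρD (mem_closedBall_zero_iff.2 hnρ.le)
  refine DifferentiableOn.analyticAt (s := Metric.ball 0 ρ) ?_
    (Metric.isOpen_ball.mem_nhds (mem_ball_zero_iff.2 hρ))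
  refine Complex.differentiableOn_tsum_of_summable_norm
    (summable_norm_clusterTerm (β := ρ) ha (le_of_lt hmem)) (fun p => ?_) Metric.isOpen_ball
    fun p w hw => ?_
  · unfold clusterTerm weight
    fun_prop
  · rw [norm_mul, norm_mul, clusterTerm, clusterTerm, norm_mul, norm_mul, norm_prod, norm_prod]
    have hw' : ‖w‖ ≤ ‖(ρ : ℂ)‖ := (mem_ball_zero_iff.1 hw).le.trans hnρ.ge
    gcongr with i
    exact norm_weight_le_of_norm_le hw' _

theorem clusterSum_zero : clusterSum Φ Λ 0 = 0 := by
  refine (tsum_congr fun p => ?_).trans tsum_zero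
  rw [clusterTerm, Finset.prod_eq_zero (Finset.mem_univ 0), mul_zero, mul_zero]
  rw [weight, neg_zero, zero_pow (cluster_n_ne_zero _), zero_div, zero_mul]

theorem highTempDisc_subset_of_eq_top (hΦ : interactionNorm Φ (Real.exp a * (1 + a)) = ∞) :
    highTempDisc Φ a ⊆ {0} := by
  intro β hβ
  by_contra h
  rw [highTempDisc, Set.mem_ofPred_eq, hΦ, ENNReal.mul_top (enorm_ne_zero.2 h)] at hβ
  exact not_top_lt hβ

theorem partitionFunction_zero (hN : 1 ≤ N) : partitionFunction Φ Λ 0 = 1 := by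
  rw [partitionFunction, neg_zero, zero_smul, NormedSpace.exp_zero, ntr_one hN]

open scoped Matrix.Norms.L2Operator in
theorem analyticAt_partitionFunction (β : ℂ) : AnalyticAt ℂ (partitionFunction Φ Λ) β := by
  have h1 : AnalyticAt ℂ (fun β : ℂ => NormedSpace.exp (-β • hamiltonian Φ Λ)) β :=
    (NormedSpace.exp_analytic (𝕂 := ℂ) _).comp (by fun_prop)
  let T : LocalAlg N Λ →ₗ[ℂ] ℂ :=
    { toFun := ntr
      map_add' := fun A B => by simp [ntr, add_div]
      map_smul' := fun z A => by simp [ntr, mul_div_assoc] }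
  exact (T.toContinuousLinearMap.analyticAt _).comp h1

end FreeEnergy

open QLattice

section FreeEnergy

variable {d N : ℕ} {Φ : Interaction d N} {a : ℝ}

theorem exists_freeEnergy_of_ne_top (hN : 1 ≤ N) (ha : 0 < a)
    (hΦ : interactionNorm Φ (Real.exp a * (1 + a)) ≠ ∞) :
    ∃ f : Finset (Site d) → ℂ → ℂ,
      (∀ Λ : Finset (Site d), Λ.Nonempty →
        AnalyticOnNhd ℂ (f Λ) (highTempDisc Φ a) ∧ f Λ 0 = 0 ∧
        ∀ β ∈ highTempDisc Φ a,
          partitionFunction Φ Λ β = Complex.exp (-(Λ.card : ℂ) * f Λ β)) ∧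
      ∀ (Λ : ℕ → Finset (Site d)), Tendsto Λ atTop atTop →
        ∃ G : ℂ → ℂ, AnalyticOnNhd ℂ G (highTempDisc Φ a) ∧
          ∀ z ∈ highTempDisc Φ a, ∀ y, Tendsto (fun m => f (Λ m) z) atTop (𝓝 y) → G z = y := by
  refine ⟨fun Λ β => -(Λ.card : ℂ)⁻¹ * clusterSum Φ Λ β, fun Λ hΛ => ⟨?_, ?_, fun β hβ => ?_⟩,
    fun Λ hΛ => ?_⟩
  · exact fun β hβ => analyticAt_const.mul (clusterSum_analyticOnNhd ha hΦ β hβ)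
  · dsimp only
    rw [clusterSum_zero, mul_zero]
  · have : (Λ.card : ℂ) ≠ 0 := by exact_mod_cast hΛ.card_pos.ne'
    rw [partitionFunction_eq_exp_clusterSum hN ha (le_of_lt hβ), ← mul_assoc, neg_mul_neg,
      mul_inv_cancel₀ this, one_mul]
  · refine exists_analyticOnNhd_of_bounded
      (fun z hz => exists_closedBall_subset_highTempDisc ha hΦ hz)
      (Eventually.of_forall fun m β hβ =>
        analyticAt_const.mul (clusterSum_analyticOnNhd ha hΦ β hβ)) fun ρ hρ => ?_
    -- The bound on `clusterSum` divided by `|Λ m|`, which is at least 1 once the site 0 is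
    -- included; the term of the empty set only shrinks.
    refine ⟨ρ * termNorm Φ ∅ + a, ?_⟩
    filter_upwards [hΛ.eventually_ge_atTop {0}] with m hm z hz
    have hcard : (1 : ℝ) ≤ (Λ m).card := by
      exact_mod_cast (Finset.singleton_subset_iff.1 hm |> fun h => Finset.card_pos.2 ⟨_, h⟩)
    have hz' : ‖z‖ ≤ ρ := mem_closedBall_zero_iff.1 hz
    have h0 := termNorm_nonneg Φ ∅
    have hρ0 : 0 ≤ ρ := (norm_nonneg z).trans hz'
    rw [norm_mul, norm_neg, norm_inv, Complex.norm_natCast, inv_mul_le_iff₀ (by linarith)]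
    refine (norm_clusterSum_le ha (le_of_lt (hρ hz))).trans ?_
    have h1 := mul_le_mul_of_nonneg_right hz' h0
    have h2 := le_mul_of_one_le_left (mul_nonneg hρ0 h0) hcard
    linarith

/-- With $0\cdot\infty=0$ the disc is `{0}`. Analyticity at 0 still concerns a neighbourhood, where
no expansion is available; the partition function is entire with value 1 at 0, so the principal
logarithm serves. -/
theorem exists_freeEnergy_of_eq_top (hN : 1 ≤ N)
    (hΦ : interactionNorm Φ (Real.exp a * (1 + a)) = ∞) :
    ∃ f : Finset (Site d) → ℂ → ℂ,
      (∀ Λ : Finset (Site d), Λ.Nonempty →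
        AnalyticOnNhd ℂ (f Λ) (highTempDisc Φ a) ∧ f Λ 0 = 0 ∧
        ∀ β ∈ highTempDisc Φ a,
          partitionFunction Φ Λ β = Complex.exp (-(Λ.card : ℂ) * f Λ β)) ∧
      ∀ (Λ : ℕ → Finset (Site d)), Tendsto Λ atTop atTop →
        ∃ G : ℂ → ℂ, AnalyticOnNhd ℂ G (highTempDisc Φ a) ∧
          ∀ z ∈ highTempDisc Φ a, ∀ y, Tendsto (fun m => f (Λ m) z) atTop (𝓝 y) → G z = y := by
  have hD := highTempDisc_subset_of_eq_top hΦ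
  have h0 : ∀ Λ : Finset (Site d),
      -(Λ.card : ℂ)⁻¹ * Complex.log (partitionFunction Φ Λ 0) = 0 := fun Λ => by
    rw [partitionFunction_zero hN, Complex.log_one, mul_zero]
  refine ⟨fun Λ β => -(Λ.card : ℂ)⁻¹ * Complex.log (partitionFunction Φ Λ β),
    fun Λ _ => ⟨fun β hβ => ?_, h0 Λ, fun β hβ => ?_⟩, fun Λ _ => ⟨0, analyticOnNhd_const, ?_⟩⟩
  · obtain rfl : β = 0 := hD hβ
    refine analyticAt_const.mul ((analyticAt_partitionFunction 0).clog ?_)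
    rw [partitionFunction_zero hN]
    exact Complex.one_mem_slitPlane
  · obtain rfl : β = 0 := hD hβ
    dsimp only
    rw [h0, mul_zero, Complex.exp_zero, partitionFunction_zero hN]
  · intro z hz y hy
    obtain rfl : z = 0 := hD hz
    simp only [h0] at hy
    exact tendsto_nhds_unique tendsto_const_nhds hy

end FreeEnergy

end ClusterExpansion

open QLattice in
theorem theorem3p1 {d N : ℕ} (hN : 1 ≤ N) (Φ : Interaction d N) (a : ℝ) (ha : 0 < a) :
    (∀ β : ℂ, ‖β‖ₑ * interactionNorm Φ (Real.exp a * (1 + a)) ≤ ENNReal.ofReal a →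
      ∀ Λ : Finset (Site d),
        -- the sums in the cluster expansion are absolutely convergent
        Summable (fun p : Σ k : ℕ, (Fin (k + 1) → Cluster Λ) =>
          ‖1 / ((p.1 + 1)! : ℂ) * clusterTerm Φ β p.2‖) ∧
        -- the cluster expansion of the partition function (the sum over `k ≥ 1` is shifted by one)
        partitionFunction Φ Λ β =
          Complex.exp (∑' k : ℕ, 1 / ((k + 1)! : ℂ) *
            ∑' C : Fin (k + 1) → Cluster Λ, clusterTerm Φ β C) ∧
        -- the bound with one cluster fixed (the sum over `k ≥ 2` is shifted by two)
        ∀ C₁ : Cluster Λ,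
          1 + ∑' k : ℕ, ((k + 2 : ℕ) : ℝ≥0∞) / ((k + 2)! : ℝ≥0∞) *
              ∑' C : Fin (k + 1) → Cluster Λ,
                ‖(phi (Fin.cons C₁ C : Fin (k + 2) → Cluster Λ) : ℂ)‖ₑ *
                  ∏ i, ‖weight Φ β (C i)‖ₑ
            ≤ ENNReal.ofReal (Real.exp (a * (C₁.supp.card : ℝ)))) ∧
    -- analyticity of the free energy, in finite volume and in the infinite-volume limit
    ∃ f : Finset (Site d) → ℂ → ℂ,
      (∀ Λ : Finset (Site d), Λ.Nonempty →
        AnalyticOnNhd ℂ (f Λ) (highTempDisc Φ a) ∧ f Λ 0 = 0 ∧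
        ∀ β ∈ highTempDisc Φ a,
          partitionFunction Φ Λ β = Complex.exp (-(Λ.card : ℂ) * f Λ β)) ∧
      ∀ (Λ : ℕ → Finset (Site d)) (g : ℝ → ℂ), Tendsto Λ atTop atTop →
        (∀ t : ℝ, 0 ≤ t → (t : ℂ) ∈ highTempDisc Φ a →
          Tendsto (fun m => f (Λ m) t) atTop (𝓝 (g t))) →
        ∃ G : ℂ → ℂ, AnalyticOnNhd ℂ G (highTempDisc Φ a) ∧
          ∀ t : ℝ, 0 ≤ t → (t : ℂ) ∈ highTempDisc Φ a → G t = g t := by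
  refine ⟨fun β h Λ => ⟨ClusterExpansion.summable_norm_clusterTerm ha h, ?_,
    ClusterExpansion.tsum_rooted_clusters_le ha h⟩, ?_⟩
  · rw [← ClusterExpansion.clusterSum_eq ha h]
    exact ClusterExpansion.partitionFunction_eq_exp_clusterSum hN ha h
  · obtain ⟨f, hf, hG⟩ : ∃ f : Finset (Site d) → ℂ → ℂ, _ := by
      by_cases hΦ : interactionNorm Φ (Real.exp a * (1 + a)) = ∞
      · exact ClusterExpansion.exists_freeEnergy_of_eq_top hN hΦ
      · exact ClusterExpansion.exists_freeEnergy_of_ne_top hN ha hΦ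
    refine ⟨f, hf, fun Λ g hΛ hg => ?_⟩
    obtain ⟨G, hGan, hGlim⟩ := hG Λ hΛ
    exact ⟨G, hGan, fun t ht htD => hGlim t htD _ (hg t ht htD)⟩
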